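/- Let $1\le r\le\infty$, let $f:\mathbb R^n\to\mathbb R^n$ and $g:\mathbb R^k\times\mathbb R^n\to\mathbb R^n$ be of class $C^r$ with $g(0,x)=0$ for all $x$, and consider the family $$x'=f(x)+g(\lambda,x),\qquad \lambda\in\mathbb R^k. \tag{1}$$ Let $p:\mathbb R\to\mathbb R^n$ be a nonconstant solution of $x'=f(x)$ with $p(t)\to p_\pm$ as $t\to\pm\infty$, where $p_+,p_-$ are hyperbolic equilibria (possibly $p_+=p_-$), and fix $t_0\in\mathbb R$. Assume that this (homo)heteroclinic orbit is nondegenerate: $\dim\big(T_{p(t_0)}W^s(p_+)\cap T_{p(t_0)}W^u(p_-)\big)=1$. Let $w_1,\dots,w_d$ be a basis of the space of solutions, bounded on $\mathbb R$, of the adjoint variational equation $w'=-Df(p(t))^*w$, and let $E^*_{t_0}$ be the space of initial values at $t_0$ of those solutions of this equation that tend to $0$ as $t\to\infty$ and as $t\to-\infty$. Then $p_\pm$ have continuations: there are functions $p_\pm(\lambda)$, continuous at $\lambda=0$, with $p_\pm(0)=p_\pm$, such that $p_\pm(\lambda)$ is a hyperbolic equilibrium of (1) for all small $\lambda$. Given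 such continuations, the bifurcation function $\xi^\infty$ is well defined near $\lambda=0$, namely $\xi^\infty(\lambda)=p_\lambda^-(t_0)-p_\lambda^+(t_0)$, where for small $\lambda$ the functions $p_\lambda^+$ on $[t_0,\infty)$ and $p_\lambda^-$ on $(-\infty,t_0]$ are the solutions of (1) that are uniformly close to $p$ (with distance tending to $0$ as $\lambda\to0$), parametrize orbits on $W^s(p_+(\lambda))$ and $W^u(p_-(\lambda))$ respectively, and satisfy $p_\lambda^\pm(t_0)\in p(t_0)+\{f(p(t_0))\}^\perp$ and $p^-_\lambda(t_0)-p^+_\lambda(t_0)\in E^*_{t_0}$; any two functions $\xi^\infty$ obtained in this way coincide near $\lambda=0$. The function $\xi^\infty$ is of class $C^r$ at $0$ and, with $\xi_i^\infty(\lambda)=\langle w_i(t_0),\xi^\infty(\lambda)\rangle$, $$\xi^\infty_{ij}:=\frac{\partial \xi_i^\infty}{\partial\lambda_j}(0)=\int_{-\infty}^{\infty}\langle w_i(s),D_{\lambda_j}g(0,p(s))\rangle\,ds,\qquad 1\le i\le d,\ 1\le j\le k,$$ the integrals being absolutely convergent. Suppose moreover that $k>d$ and $\operatorname{rank} D_\lambda\xi^\infty(0)=d$.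 Then there is an open neighbourhood $U$ of $0$ in $\mathbb R^k$ such that $M=\{\lambda\in U:\xi^\infty(\lambda)=0\}$ contains $0$ and is a regular (embedded) $C^r$ submanifold of $\mathbb R^k$ of dimension $k-d$, whose tangent space at $\lambda=0$ is the set of solutions $(\lambda_1,\dots,\lambda_k)$ of $$\sum_{j=1}^k\xi_{ij}^\infty\lambda_j=0,\qquad i=1,\dots,d,$$ and such that for every $\lambda\in M$ equation (1) has a heteroclinic orbit $p_\lambda$ from the hyperbolic equilibrium $p_-(\lambda)$ to the hyperbolic equilibrium $p_+(\lambda)$ (homoclinic, i.e. $p_-(\lambda)=p_+(\lambda)$, if $p_-=p_+$), with $\sup_{t}\|p_\lambda(t)-p(t)\|\to0$ as $\lambda\to0$ in $M$. -/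

import Mathlib

open Filter Topology MeasureTheory

/-- The Euclidean space `ℝ^n`. -/
abbrev Euc (n : ℕ) : Type := EuclideanSpace ℝ (Fin n)

/-- `u` solves the autonomous equation `x' = F(x)` on the time set `J`
(one-sided derivatives at endpoints of an interval `J`). -/
def SolvesOn {n : ℕ} (F : Euc n → Euc n) (J : Set ℝ) (u : ℝ → Euc n) : Prop :=
  ∀ t ∈ J, HasDerivWithinAt u (F (u t)) J t

/-- `q` is a hyperbolic equilibrium of `x' = F(x)`: `F q = 0` and no (complex) eigenvalue of
`DF(q)` lies on the imaginary axis. -/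
def IsHyperbolicEquilibrium {n : ℕ} (F : Euc n → Euc n) (q : Euc n) : Prop :=
  F q = 0 ∧
    ∀ z : ℂ, Polynomial.aeval z (LinearMap.charpoly (fderiv ℝ F q).toLinearMap) = 0 → z.re ≠ 0

/-- `x` parametrizes a heteroclinic (homoclinic if `qm = qp`) orbit of `x' = F(x)`, from the
hyperbolic equilibrium `qm` (as `t → -∞`) to the hyperbolic equilibrium `qp` (as `t → ∞`). -/
structure IsConnectingOrbit {n : ℕ} (F : Euc n → Euc n) (qm qp : Euc n) (x : ℝ → Euc n) :
    Prop where
  hyp_minus : IsHyperbolicEquilibrium F qm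
  hyp_plus : IsHyperbolicEquilibrium F qp
  solves : SolvesOn F Set.univ x
  tendsto_minus : Tendsto x atBot (𝓝 qm)
  tendsto_plus : Tendsto x atTop (𝓝 qp)
  nonconstant : ∃ s t, x s ≠ x t

/-- `u`, on `[t₀, ∞)`, parametrizes an orbit on the stable manifold of `q`. -/
def IsStableOrbit {n : ℕ} (F : Euc n → Euc n) (q : Euc n) (t₀ : ℝ) (u : ℝ → Euc n) : Prop :=
  SolvesOn F (Set.Ici t₀) u ∧ Tendsto u atTop (𝓝 q)

/-- `u`, on `(-∞, t₀]`, parametrizes an orbit on the unstable manifold of `q`. -/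
def IsUnstableOrbit {n : ℕ} (F : Euc n → Euc n) (q : Euc n) (t₀ : ℝ) (u : ℝ → Euc n) : Prop :=
  SolvesOn F (Set.Iic t₀) u ∧ Tendsto u atBot (𝓝 q)

/-- The tangent space `T_x W^s(q)` at `x` of the (global) stable manifold
`W^s(q) = {y | the solution through y tends to q as t → ∞}`.
Its elements are the velocities at `x` of curves `s ↦ u s 0` in `W^s(q)`. Since `W^s(q)` is in
general only an injectively immersed manifold, the curves have to be continuous for its
manifold topology, which is the topology of uniform convergence on `[0, ∞)` of the forward
orbits `u s` (and not the topology induced by `ℝ^n`). -/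
def stableTangent {n : ℕ} (F : Euc n → Euc n) (q x : Euc n) : Submodule ℝ (Euc n) :=
  Submodule.span ℝ {v | ∃ u : ℝ → ℝ → Euc n,
    (∀ᶠ s in 𝓝 (0 : ℝ), IsStableOrbit F q 0 (u s)) ∧ u 0 0 = x ∧
    TendstoUniformlyOn u (u 0) (𝓝 0) (Set.Ici 0) ∧ HasDerivAt (fun s => u s 0) v 0}

/-- The tangent space `T_x W^u(q)` at `x` of the (global) unstable manifold
`W^u(q) = {y | the solution through y tends to q as t → -∞}`; see `stableTangent`. -/
def unstableTangent {n : ℕ} (F : Euc n → Euc n) (q x : Euc n) : Submodule ℝ (Euc n) :=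
  Submodule.span ℝ {v | ∃ u : ℝ → ℝ → Euc n,
    (∀ᶠ s in 𝓝 (0 : ℝ), IsUnstableOrbit F q 0 (u s)) ∧ u 0 0 = x ∧
    TendstoUniformlyOn u (u 0) (𝓝 0) (Set.Iic 0) ∧ HasDerivAt (fun s => u s 0) v 0}

/-- A connecting orbit from `qm` to `qp` through the point `x` is nondegenerate:
`dim (T_x W^s(qp) ∩ T_x W^u(qm)) = 1`. -/
def IsNondegenerateAt {n : ℕ} (F : Euc n → Euc n) (qm qp x : Euc n) : Prop :=
  Module.finrank ℝ (stableTangent F qp x ⊓ unstableTangent F qm x : Submodule ℝ (Euc n)) = 1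

/-- The coefficient `-Df(p(t))^*` of the adjoint variational equation along `p`. -/
noncomputable def adjointCoeff {n : ℕ} (f : Euc n → Euc n) (p : ℝ → Euc n) (t : ℝ) :
    Euc n →L[ℝ] Euc n :=
  -ContinuousLinearMap.adjoint (fderiv ℝ f (p t))

/-- The space of all solutions on `ℝ` of the linear equation `w' = A(t) w`. -/
def linearSolutions {n : ℕ} (A : ℝ → Euc n →L[ℝ] Euc n) : Submodule ℝ (ℝ → Euc n) where
  carrier := {w | ∀ t, HasDerivAt w (A t (w t)) t}
  add_mem' := by
    intro a b ha hb t
    simpa using (ha t).add (hb t)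
  zero_mem' := by
    intro t
    simp
  smul_mem' := by
    intro c a ha t
    simpa using (ha t).const_smul c

/-- The space of the bounded functions `ℝ → ℝ^n`. -/
def boundedFunctions (n : ℕ) : Submodule ℝ (ℝ → Euc n) where
  carrier := {w | ∃ C : ℝ, ∀ t, ‖w t‖ ≤ C}
  add_mem' := by
    rintro a b ⟨C, hC⟩ ⟨D, hD⟩
    exact ⟨C + D, fun t => (norm_add_le _ _).trans (add_le_add (hC t) (hD t))⟩
  zero_mem' := ⟨0, fun t => by simp⟩
  smul_mem' := by
    rintro c a ⟨C, hC⟩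
    refine ⟨‖c‖ * C, fun t => ?_⟩
    rw [Pi.smul_apply, norm_smul]
    exact mul_le_mul_of_nonneg_left (hC t) (norm_nonneg c)

/-- The space of the solutions bounded on `ℝ` of the adjoint variational equation
`w' = -Df(p(t))^* w`. -/
noncomputable def boundedAdjointSolutions {n : ℕ} (f : Euc n → Euc n) (p : ℝ → Euc n) :
    Submodule ℝ (ℝ → Euc n) :=
  linearSolutions (adjointCoeff f p) ⊓ boundedFunctions n

/-- The set `E^*_{t₀} = E^{s*}_{t₀} ∩ E^{u*}_{t₀}` of the initial values at time `t₀` for which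
the solution of the adjoint variational equation tends to zero both as `t → ∞` and as
`t → -∞`. -/
def adjointDecayingValues {n : ℕ} (f : Euc n → Euc n) (p : ℝ → Euc n) (t₀ : ℝ) : Set (Euc n) :=
  {v | (∃ w ∈ linearSolutions (adjointCoeff f p), w t₀ = v ∧ Tendsto w atTop (𝓝 0)) ∧
    (∃ w ∈ linearSolutions (adjointCoeff f p), w t₀ = v ∧ Tendsto w atBot (𝓝 0))}

/-- The right-hand side `f(x) + g(lam, x)` of the perturbed family. -/
def family {n k : ℕ} (f : Euc n → Euc n) (g : Euc k → Euc n → Euc n) (lam : Euc k) :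
    Euc n → Euc n :=
  fun x => f x + g lam x

/-- `P` is (near `lam = 0`) the continuation of the equilibrium `q` of `x' = F 0 x` by hyperbolic
equilibria of `x' = F lam x`. -/
structure IsContinuation {n k : ℕ} (F : Euc k → Euc n → Euc n) (q : Euc n) (P : Euc k → Euc n) :
    Prop where
  zero : P 0 = q
  continuousAt : ContinuousAt P 0
  hyperbolic : ∀ᶠ lam in 𝓝 0, IsHyperbolicEquilibrium (F lam) (P lam)

/-- The pair `p_lam^+ = u` (on `[t₀, ∞)`) and `p_lam^- = v` (on `(-∞, t₀]`) of solutions of the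
perturbed equation which defines the bifurcation function: `u`, `v` parametrize orbits on
`W^s(Pp lam)` and `W^u(Pm lam)`, start at time `t₀` in the section
`Σ = p(t₀) + {f(p(t₀))}^⊥`, have jump `v t₀ - u t₀` in `E^*_{t₀}`, and stay
`ε`-close to `p`. -/
structure IsJumpPair {n k : ℕ} (f : Euc n → Euc n) (g : Euc k → Euc n → Euc n)
    (p : ℝ → Euc n) (t₀ : ℝ) (Pm Pp : Euc k → Euc n) (lam : Euc k) (ε : ℝ)
    (u v : ℝ → Euc n) : Prop where
  stable : IsStableOrbit (family f g lam) (Pp lam) t₀ u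
  unstable : IsUnstableOrbit (family f g lam) (Pm lam) t₀ v
  section_plus : inner ℝ (f (p t₀)) (u t₀ - p t₀) = 0
  section_minus : inner ℝ (f (p t₀)) (v t₀ - p t₀) = 0
  jump : v t₀ - u t₀ ∈ adjointDecayingValues f p t₀
  close_plus : ∀ t, t₀ ≤ t → ‖u t - p t‖ ≤ ε
  close_minus : ∀ t, t ≤ t₀ → ‖v t - p t‖ ≤ ε

/-- `ξ` is (a representative near `lam = 0` of) the bifurcation function `ξ^∞`:
`ξ(lam) = p_lam^-(t₀) - p_lam^+(t₀)` for the pair `p_lam^±` of solutions as in `IsJumpPair`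
that is arbitrarily close to `p` as `lam → 0`. -/
def IsBifurcationFunction {n k : ℕ} (f : Euc n → Euc n) (g : Euc k → Euc n → Euc n)
    (p : ℝ → Euc n) (t₀ : ℝ) (Pm Pp : Euc k → Euc n) (ξ : Euc k → Euc n) : Prop :=
  ∀ ε : ℝ, 0 < ε → ∀ᶠ lam in 𝓝 (0 : Euc k),
    ∃ u v, IsJumpPair f g p t₀ Pm Pp lam ε u v ∧ ξ lam = v t₀ - u t₀

/-- The integrand `⟨w(s), D_{lam_j} g(0, p(s))⟩` of the Melnikov integral. -/
noncomputable def melnikovIntegrand {n k : ℕ} (g : Euc k → Euc n → Euc n) (p w : ℝ → Euc n)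
    (j : Fin k) (s : ℝ) : ℝ :=
  inner ℝ (w s) (fderiv ℝ (fun lam => g lam (p s)) 0 (EuclideanSpace.single j (1 : ℝ)))

/-- `M` is a regular (embedded, without boundary) submanifold of `ℝ^k` of class `C^r` and
dimension `m`: around each of its points a `C^r` diffeomorphism between open sets of `ℝ^k`
straightens `M` to a linear subspace of dimension `m`. -/
def IsRegularSubmanifold {k : ℕ} (r : WithTop ℕ∞) (m : ℕ) (M : Set (Euc k)) : Prop :=
  ∀ x ∈ M, ∃ (φ : OpenPartialHomeomorph (Euc k) (Euc k)) (S : Submodule ℝ (Euc k)),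
    x ∈ φ.source ∧ ContDiffOn ℝ r φ φ.source ∧ ContDiffOn ℝ r φ.symm φ.target ∧
    Module.finrank ℝ S = m ∧ ∀ y ∈ φ.source, (y ∈ M ↔ φ y ∈ S)

/-- The tangent vectors at `x` of a regular submanifold `M`: velocities of curves in `M`. -/
def tangentVectors {k : ℕ} (M : Set (Euc k)) (x : Euc k) : Set (Euc k) :=
  {v | ∃ c : ℝ → Euc k, c 0 = x ∧ (∀ᶠ s in 𝓝 0, c s ∈ M) ∧ HasDerivAt c v 0}

/-! The orbits near `p` on the perturbed stable manifold are obtained from the implicit function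
theorem in spaces of functions on the compactified half-line `[0, ∞]`. The unknown is a pair `(y,
y')` of continuous functions there; since the time set is compact, superposition with a `C^r` vector
field is a `C^r` operator (`contDiff_postcomp`). The linearization is `y ↦ y' - A(t) y`, where
`A(t)` is the derivative of the vector field along `p` and `A(∞)` is hyperbolic. It is surjective
(`linearOperator_surjective`), and evaluation at time `0` identifies its kernel with the space `Es`
of initial values of decaying solutions. Prescribing the `Es`-component of the initial displacement
therefore makes the problem nondegenerate and gives a `C^r` family `U (λ, v)` with `v ∈ Es`
(`exists_stableFamily`). The unstable side, with its space `Eu`, is the same statement for `-F` in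
reversed time. These families also show that `Es` and `Eu` are the tangent spaces in the
nondegeneracy hypothesis.

A duality argument replaces exponential dichotomies: a solution of the adjoint equation whose
initial value is orthogonal to `Es` is integrable and tends to `0`
(`integrableOn_and_tendsto_of_adjoint`). It follows that `E^*` is `(Es ⊔ Eu)ᗮ`, and that evaluation
at `t₀` maps the bounded adjoint solutions bijectively onto it.

Nondegeneracy says that `Es ⊓ Eu` is the line spanned by `f(p(t₀))`. The two requirements, that the
points lie in the section and that the jump be orthogonal to `Es ⊔ Eu`, then determine the
parameters `(a, b) ∈ Es × Eu` as `C^r` functions of `λ` (`exists_section_jump`), so the jump `ξ` is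
well defined and `C^r`. For a bounded adjoint solution `w`, the pairing of `w` with the
`λ`-derivative of either family has derivative `⟨w, D_λ g⟩` in time; integrating over both
half-lines gives the Melnikov integral, while the variation of `a` and `b` is invisible because
`w(t₀)` is orthogonal to `Es` and `Eu`.

Finally `ξ` takes its values in the `d`-dimensional space `E^*`, so rank `d` makes its derivative at
`0` surjective onto that space. Hence the zero set is a submanifold near `0` tangent to the kernel
(`exists_regularSubmanifold`), and over each of its points the two half-orbits match and glue to a
connection. -/

/-! ### Smoothness of superposition operators on continuous functions. -/

section Superposition

variable {K : Type*} [TopologicalSpace K] [CompactSpace K]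
variable {E F : Type*} [NormedAddCommGroup E] [NormedSpace ℝ E]
  [NormedAddCommGroup F] [NormedSpace ℝ F]

/-- Pointwise application of a continuous family of linear maps to a continuous function. -/
noncomputable def pointwiseApply (K E F : Type*) [TopologicalSpace K] [CompactSpace K]
    [NormedAddCommGroup E] [NormedSpace ℝ E] [NormedAddCommGroup F] [NormedSpace ℝ F] :
    C(K, E →L[ℝ] F) →L[ℝ] C(K, E) →L[ℝ] C(K, F) :=
  LinearMap.mkContinuous₂
    (LinearMap.mk₂ ℝ (fun (A : C(K, E →L[ℝ] F)) (y : C(K, E)) =>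
        (⟨fun t => A t (y t), A.continuous.clm_apply y.continuous⟩ : C(K, F)))
      (fun A B y => by ext; simp) (fun c A y => by ext; simp)
      (fun A y z => by ext; simp) (fun c A y => by ext; simp)) 1
    (fun A y => by
      rw [one_mul]
      refine (ContinuousMap.norm_le _ (by positivity)).2 fun t => ?_
      exact (A t).le_of_opNorm_le_of_le (A.norm_coe_le_norm t) (y.norm_coe_le_norm t))

@[simp]
theorem pointwiseApply_apply (A : C(K, E →L[ℝ] F)) (y : C(K, E)) (t : K) :
    pointwiseApply K E F A y t = A t (y t) := rfl

theorem norm_pointwiseApply_le (A : C(K, E →L[ℝ] F)) : ‖pointwiseApply K E F A‖ ≤ ‖A‖ := by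
  refine ContinuousLinearMap.opNorm_le_bound _ (by positivity) fun y => ?_
  refine (ContinuousMap.norm_le _ (by positivity)).2 fun t => ?_
  exact (A t).le_of_opNorm_le_of_le (A.norm_coe_le_norm t) (y.norm_coe_le_norm t)

/-- The superposition operator `y ↦ f ∘ y` between spaces of continuous functions on a compact
space is differentiable if `f` is of class `C^1`. -/
theorem hasFDerivAt_postcomp {f : E → F} {f' : E → E →L[ℝ] F} (hf : Continuous f)
    (hf' : Continuous f') (h : ∀ x, HasFDerivAt f (f' x) x) (y : C(K, E)) :
    HasFDerivAt (fun y : C(K, E) => (⟨f, hf⟩ : C(E, F)).comp y)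
      (pointwiseApply K E F ((⟨f', hf'⟩ : C(E, E →L[ℝ] F)).comp y)) y := by
  rw [hasFDerivAt_iff_isLittleO_nhds_zero, Asymptotics.isLittleO_iff]
  intro ε hε
  have hc : Continuous fun y : C(K, E) => (⟨f', hf'⟩ : C(E, E →L[ℝ] F)).comp y :=
    ContinuousMap.continuous_postcomp _
  have hb : Metric.ball ((⟨f', hf'⟩ : C(E, E →L[ℝ] F)).comp y) ε ∈
      𝓝 ((⟨f', hf'⟩ : C(E, E →L[ℝ] F)).comp y) :=
    Metric.ball_mem_nhds (α := C(K, E →L[ℝ] F)) _ hε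
  obtain ⟨δ, hδ, hδε⟩ := Metric.mem_nhds_iff.1 (hc.continuousAt hb)
  filter_upwards [Metric.ball_mem_nhds (0 : C(K, E)) hδ] with z hz
  rw [mem_ball_zero_iff] at hz
  refine (ContinuousMap.norm_le _ (by positivity)).2 fun t => ?_
  -- The point `y + θ z` stays in the `δ`-ball about `y` in the supremum norm, so the derivative
  -- varies by at most `ε` along the segment, uniformly in `t`. The mean value inequality then gives
  -- the uniform remainder estimate.
  have key : ∀ x ∈ segment ℝ (y t) (y t + z t), ‖f' x - f' (y t)‖ ≤ ε := by
    intro x hx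
    rw [segment_eq_image'] at hx
    obtain ⟨θ, ⟨h0, h1⟩, rfl⟩ := hx
    have h2 : dist (y + θ • z) y < δ := by
      rw [dist_eq_norm, add_sub_cancel_left, norm_smul, Real.norm_of_nonneg h0]
      exact (mul_le_of_le_one_left (norm_nonneg _) h1).trans_lt hz
    have h3 := (ContinuousMap.dist_apply_le_dist t).trans (le_of_lt (hδε h2))
    rw [dist_eq_norm] at h3
    simpa using h3
  have := Convex.norm_image_sub_le_of_norm_hasFDerivWithin_le' (𝕜 := ℝ)
    (fun x _ => (h x).hasFDerivWithinAt) key (convex_segment (y t) (y t + z t))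
    (left_mem_segment ℝ _ _) (right_mem_segment ℝ _ _)
  simp only [add_sub_cancel_left] at this
  exact this.trans (mul_le_mul_of_nonneg_left (z.norm_coe_le_norm t) hε.le)

end Superposition

section SuperpositionSmooth

universe u v

/-- The derivative of superposition with `f` is superposition with `f'` followed by the bounded
linear map `pointwiseApply`, so one order of smoothness is gained at each induction step. The target
changes from `F` to `E →L[ℝ] F`; this is why the spaces are quantified inside the induction and
share a universe. -/
theorem contDiff_postcomp_nat {K : Type v} [TopologicalSpace K] [CompactSpace K] (m : ℕ) :
    ∀ {E F : Type u} [NormedAddCommGroup E] [NormedSpace ℝ E] [NormedAddCommGroup F]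
      [NormedSpace ℝ F] {f : E → F} (_ : ContDiff ℝ m f) (hc : Continuous f),
      ContDiff ℝ m (fun y : C(K, E) => (⟨f, hc⟩ : C(E, F)).comp y) := by
  induction m with
  | zero =>
    intro E F _ _ _ _ f hf hc
    rw [Nat.cast_zero, contDiff_zero]
    exact ContinuousMap.continuous_postcomp _
  | succ m ih =>
    intro E F _ _ _ _ f hf hc
    have hf1 : ContDiff ℝ ((m : WithTop ℕ∞) + 1) f := by exact_mod_cast hf
    obtain ⟨f', hf', hd⟩ := contDiff_succ_iff_hasFDerivAt.1 hf1
    rw [Nat.cast_add, Nat.cast_one]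
    refine contDiff_succ_iff_hasFDerivAt.2 ⟨_, ?_, hasFDerivAt_postcomp hc
      hf'.continuous hd⟩
    exact (pointwiseApply K E F).contDiff.comp (ih hf' hf'.continuous)

/-- The superposition operator `y ↦ f ∘ y` between spaces of continuous functions on a compact
space is of class `C^r` if `f` is. -/
theorem contDiff_postcomp {K : Type v} [TopologicalSpace K] [CompactSpace K] {r : ℕ∞}
    {E F : Type u} [NormedAddCommGroup E] [NormedSpace ℝ E] [NormedAddCommGroup F]
    [NormedSpace ℝ F] {f : E → F} (hf : ContDiff ℝ r f) :
    ContDiff ℝ r (fun y : C(K, E) => (⟨f, hf.continuous⟩ : C(E, F)).comp y) :=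
  contDiff_iff_forall_nat_le.2 fun m hm =>
    contDiff_postcomp_nat m (hf.of_le (by exact_mod_cast hm)) hf.continuous

end SuperpositionSmooth

/-! ### An implicit function theorem with smoothness on a neighbourhood. -/

section Implicit

variable {P X Z : Type*} [NormedAddCommGroup P] [NormedSpace ℝ P] [CompleteSpace P]
  [NormedAddCommGroup X] [NormedSpace ℝ X] [CompleteSpace X]
  [NormedAddCommGroup Z] [NormedSpace ℝ Z] [CompleteSpace Z]

/-- The implicit function theorem, with smoothness on a neighbourhood: near `a` the equation
`G (l, x) = 0` has a unique solution `x = φ l` near `b`, and `φ` is of class `C^r` near `a`. -/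
theorem exists_implicit {r : WithTop ℕ∞} (hr : r ≠ 0) {G : P × X → Z} {a : P} {b : X}
    (hG : ∀ᶠ u in 𝓝 (a, b), ContDiffAt ℝ r G u) (h0 : G (a, b) = 0)
    (hinj : ∀ x, fderiv ℝ G (a, b) (0, x) = 0 → x = 0)
    (hsurj : ∀ z, ∃ x, fderiv ℝ G (a, b) (0, x) = z) :
    ∃ φ : P → X, φ a = b ∧ (∀ᶠ l in 𝓝 a, ContDiffAt ℝ r φ l) ∧
      (∀ᶠ u in 𝓝 (a, b), G u = 0 ↔ u.2 = φ u.1) ∧ ∀ᶠ l in 𝓝 a, G (l, φ l) = 0 := by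
  have inv0 : (fderiv ℝ G (a, b) ∘L .inr ℝ P X).IsInvertible := by
    refine ⟨ContinuousLinearEquiv.ofBijective (fderiv ℝ G (a, b) ∘L .inr ℝ P X) ?_ ?_, rfl⟩
    · exact (LinearMap.ker_eq_bot').2 fun x hx => hinj x (by simpa using hx)
    · exact LinearMap.range_eq_top.2 fun z => by simpa using hsurj z
  have hc0 := hG.self_of_nhds
  set φ := hc0.implicitFunction hr inv0 with hφ
  have hφa : φ a = b := hc0.implicitFunction_apply_self hr inv0
  have hφc : ContDiffAt ℝ r φ a := hc0.contDiffAt_implicitFunction hr inv0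
  have hiff : ∀ᶠ u in 𝓝 (a, b), G u = 0 ↔ u.2 = φ u.1 := by
    filter_upwards [hc0.eventually_apply_eq_iff_implicitFunction hr inv0] with u hu
    rw [h0] at hu
    rw [hu, eq_comm]
  have hφ0 : ∀ᶠ l in 𝓝 a, G (l, φ l) = 0 := by
    filter_upwards [hc0.eventually_apply_implicitFunction hr inv0] with l hl
    rw [hl, h0]
  refine ⟨φ, hφa, ?_, hiff, hφ0⟩
  have htend : ∀ {l : P}, ContinuousAt φ l → Tendsto (fun l => (l, φ l)) (𝓝 l) (𝓝 (l, φ l)) :=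
    fun h => continuousAt_id.prodMk h
  have hta : Tendsto (fun l => (l, φ l)) (𝓝 a) (𝓝 (a, b)) := by
    simpa [hφa] using htend hφc.continuousAt
  have hφcont : ∀ᶠ l in 𝓝 a, ContinuousAt φ l := by
    filter_upwards [((hφc.of_le (m := 1) (ENat.one_le_iff_ne_zero_withTop.mpr hr)).eventually (by simp))]
      with l hl using hl.continuousAt
  have hinv : ∀ᶠ u in 𝓝 (a, b), (fderiv ℝ G u ∘L .inr ℝ P X).IsInvertible := by
    have hcf : ContinuousAt (fun u => fderiv ℝ G u ∘L .inr ℝ P X) (a, b) := by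
      have : ContinuousAt (fderiv ℝ G) (a, b) :=
        (hc0.fderiv_right (m := 0) (by simpa using ENat.one_le_iff_ne_zero_withTop.mpr hr)).continuousAt
      exact this.clm_comp continuousAt_const
    obtain ⟨e, he⟩ := inv0
    have := hcf (he ▸ ContinuousLinearEquiv.nhds e)
    filter_upwards [this] with u ⟨e', he'⟩ using ⟨e', he'⟩
  -- The partial derivative remains invertible at `(l, φ l)`, so the implicit function theorem
  -- applies again there. Local uniqueness identifies the new implicit function with `φ`, which
  -- transfers its smoothness at `l`.
  filter_upwards [hφcont, hta.eventually hG, hta.eventually hinv, hφ0.eventually_nhds]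
    with l hl hGl hinvl h0l
  have hu := hGl.eventually_apply_eq_iff_implicitFunction hr hinvl
  have hd := hGl.contDiffAt_implicitFunction hr hinvl
  refine hd.congr_of_eventuallyEq ?_
  filter_upwards [(htend hl).eventually hu, h0l] with l' hl' h0l'
  exact (hl'.1 (by rw [h0l', h0l.self_of_nhds])).symm

end Implicit

/-! ### Convergent functions on the half-line `[0, ∞]`. -/

/-- The compactified half-line `[0, ∞]`. -/
abbrev HalfLine : Type := OnePoint NNReal

/-- The point of the compactified half-line given by the time `max t 0`. -/
def atTime (t : ℝ) : HalfLine := ((t.toNNReal : NNReal) : OnePoint NNReal)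

section HalfLineFunctions

variable {E : Type*} [NormedAddCommGroup E] [NormedSpace ℝ E]

theorem continuous_atTime : Continuous atTime :=
  OnePoint.continuous_coe.comp continuous_real_toNNReal

theorem tendsto_atTime : Tendsto atTime atTop (𝓝 (OnePoint.infty : HalfLine)) := by
  have h : Tendsto ((↑) : NNReal → OnePoint NNReal) atTop (𝓝 OnePoint.infty) := by
    have := OnePoint.tendsto_coe_infty (X := NNReal)
    rwa [coclosedCompact_eq_cocompact, cocompact_eq_atTop] at this
  exact h.comp tendsto_real_toNNReal_atTop

theorem atTime_coe (s : NNReal) : atTime s = (s : OnePoint NNReal) := by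
  simp [atTime]

theorem continuous_comp_atTime {F : Type*} [TopologicalSpace F] (U : C(HalfLine, F)) : Continuous fun t => U (atTime t) :=
  U.continuous.comp continuous_atTime

theorem tendsto_comp_atTime {F : Type*} [TopologicalSpace F] (U : C(HalfLine, F)) :
    Tendsto (fun t => U (atTime t)) atTop (𝓝 (U OnePoint.infty)) :=
  (U.continuous.tendsto _).comp tendsto_atTime

theorem norm_le_of_forall_atTime {E : Type*} [NormedAddCommGroup E] {U : C(HalfLine, E)} {C : ℝ}
    (h : ∀ t, 0 ≤ t → ‖U (atTime t)‖ ≤ C) : ‖U‖ ≤ C := by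
  have hC : 0 ≤ C := (norm_nonneg _).trans (h 0 le_rfl)
  refine (ContinuousMap.norm_le _ hC).2 fun τ => ?_
  induction τ using OnePoint.rec with
  | infty =>
    exact le_of_tendsto (tendsto_comp_atTime U).norm
      ((eventually_ge_atTop 0).mono fun t ht => h t ht)
  | coe s => simpa [atTime_coe] using h s s.2

theorem halfLine_ext {F : Type*} [TopologicalSpace F] [T2Space F] {U V : C(HalfLine, F)}
    (h : ∀ t, 0 ≤ t → U (atTime t) = V (atTime t)) : U = V := by
  refine ContinuousMap.ext fun τ => ?_
  induction τ using OnePoint.rec with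
  | infty =>
    refine tendsto_nhds_unique ((U.continuous.tendsto _).comp tendsto_atTime)
      (Tendsto.congr' ?_ ((V.continuous.tendsto _).comp tendsto_atTime))
    filter_upwards [eventually_ge_atTop 0] with t ht using (h t ht).symm
  | coe s => simpa [atTime_coe] using h s s.2

/-- A continuous function on `[0, ∞)` with a limit at infinity extends to `[0, ∞]`. -/
theorem exists_halfLine_extension {F : Type*} [TopologicalSpace F] {u : ℝ → F} {l : F}
    (hu : ContinuousOn u (Set.Ici 0)) (hl : Tendsto u atTop (𝓝 l)) :
    ∃ U : C(HalfLine, F), (∀ t, 0 ≤ t → U (atTime t) = u t) ∧ U OnePoint.infty = l := by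
  have hc : Continuous fun s : NNReal => u s :=
    continuousOn_univ.1 (hu.comp NNReal.continuous_coe.continuousOn fun s _ => s.2)
  refine ⟨OnePoint.continuousMapMk ⟨_, hc⟩ l ?_, fun t ht => ?_, rfl⟩
  · rw [coclosedCompact_eq_cocompact, cocompact_eq_atTop]
    exact hl.comp (NNReal.tendsto_coe_atTop.2 tendsto_id)
  · change u (t.toNNReal : NNReal) = u t
    rw [Real.coe_toNNReal t ht]

variable (E) in
/-- The space of the continuously differentiable functions `y` on `[0, ∞)` such that `y` and `y'`
have limits at infinity, as a space of pairs `(y, y')`. -/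
def c1HalfLine : Submodule ℝ (C(HalfLine, E) × C(HalfLine, E)) where
  carrier := {x | ∀ t, 0 ≤ t → x.1 (atTime t) = x.1 (atTime 0) + ∫ s in (0 : ℝ)..t, x.2 (atTime s)}
  add_mem' := by
    intro a b ha hb t ht
    have h1 := (continuous_comp_atTime a.2).intervalIntegrable (μ := volume) 0 t
    have h2 := (continuous_comp_atTime b.2).intervalIntegrable (μ := volume) 0 t
    simp only [Prod.fst_add, Prod.snd_add, ContinuousMap.add_apply]
    rw [intervalIntegral.integral_add h1 h2, ha t ht, hb t ht]
    abel
  zero_mem' := by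
    intro t _
    simp
  smul_mem' := by
    intro c a ha t ht
    simp only [Prod.smul_fst, Prod.smul_snd, ContinuousMap.smul_apply]
    rw [intervalIntegral.integral_smul, ha t ht, smul_add]

/-- The integral form of the relation between `y` and `y'` passes to uniform limits. Closedness
makes the space complete, as the implicit function theorem and the open mapping theorem require. -/
theorem isClosed_c1HalfLine : IsClosed (c1HalfLine E : Set (C(HalfLine, E) × C(HalfLine, E))) := by
  have : (c1HalfLine E : Set (C(HalfLine, E) × C(HalfLine, E))) =
      ⋂ t ∈ Set.Ici (0 : ℝ), {x | x.1 (atTime t) = x.1 (atTime 0) +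
        ∫ s in (0 : ℝ)..t, x.2 (atTime s)} := by
    ext x
    simp only [Set.mem_iInter]
    exact Iff.rfl
  rw [this]
  refine isClosed_biInter fun t _ => isClosed_eq ?_ ?_
  · exact (continuous_eval_const (F := C(HalfLine, E)) _).comp continuous_fst
  · refine ((continuous_eval_const (F := C(HalfLine, E)) _).comp continuous_fst).add ?_
    refine intervalIntegral.continuous_parametric_intervalIntegral_of_continuous'
      (f := fun (x : C(HalfLine, E) × C(HalfLine, E)) s => x.2 (atTime s)) ?_ _ _
    exact (ContinuousEval.continuous_eval (F := C(HalfLine, E))).comp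
      ((continuous_snd.comp continuous_fst).prodMk (continuous_atTime.comp continuous_snd))

variable [CompleteSpace E]

theorem mem_c1HalfLine_iff {x : C(HalfLine, E) × C(HalfLine, E)} :
    x ∈ c1HalfLine E ↔ ∀ t ∈ Set.Ici (0 : ℝ),
      HasDerivWithinAt (fun t => x.1 (atTime t)) (x.2 (atTime t)) (Set.Ici 0) t := by
  have hc := continuous_comp_atTime x.2
  constructor
  · intro h t ht
    have h1 : HasDerivAt (fun t => x.1 (atTime 0) + ∫ s in (0 : ℝ)..t, x.2 (atTime s))
        (x.2 (atTime t)) t :=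
      (intervalIntegral.integral_hasDerivAt_right (hc.intervalIntegrable _ _)
        (hc.stronglyMeasurableAtFilter _ _) hc.continuousAt).const_add _
    exact h1.hasDerivWithinAt.congr (fun s hs => h s hs) (h t ht)
  · intro h t ht
    have := intervalIntegral.integral_eq_sub_of_hasDeriv_right_of_le ht
      (continuous_comp_atTime x.1).continuousOn
      (fun s hs => (h s hs.1.le).mono fun y hy => hs.1.le.trans (le_of_lt hy))
      (hc.intervalIntegrable _ _)
    rw [this]
    abel

instance : CompleteSpace (c1HalfLine E) := isClosed_c1HalfLine.completeSpace_coe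

/-- If a function and its derivative have limits at infinity, then the derivative tends to `0`. -/
theorem c1HalfLine_snd_infty {x : C(HalfLine, E) × C(HalfLine, E)} (hx : x ∈ c1HalfLine E) :
    x.2 OnePoint.infty = 0 := by
  have hc := continuous_comp_atTime x.2
  -- The mean of the derivative over `[t, t + 1]` tends to the limit of the derivative. It is also
  -- the increment of a convergent function, so it tends to `0`.
  have h1 : Tendsto (fun t : ℝ => ∫ s in (0 : ℝ)..1, x.2 (atTime (s + t))) atTop
      (𝓝 (∫ _s in (0 : ℝ)..1, x.2 OnePoint.infty)) := by
    refine intervalIntegral.tendsto_integral_filter_of_dominated_convergence (fun _ => ‖x.2‖)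
      (Eventually.of_forall fun t => ?_) (Eventually.of_forall fun t => ?_) (by simp) ?_
    · exact (hc.comp (continuous_id.add continuous_const)).aestronglyMeasurable
    · exact Eventually.of_forall fun s _ => x.2.norm_coe_le_norm _
    · exact Eventually.of_forall fun s _ => (tendsto_comp_atTime x.2).comp
        (tendsto_atTop_add_const_left _ _ tendsto_id)
  have h2 : Tendsto (fun t : ℝ => ∫ s in (0 : ℝ)..1, x.2 (atTime (s + t))) atTop (𝓝 0) := by
    have h3 : Tendsto (fun t : ℝ => x.1 (atTime (1 + t)) - x.1 (atTime t)) atTop (𝓝 0) := by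
      have := ((tendsto_comp_atTime x.1).comp
        (tendsto_atTop_add_const_left atTop (1 : ℝ) tendsto_id)).sub (tendsto_comp_atTime x.1)
      simpa using this
    refine h3.congr' ?_
    filter_upwards [eventually_ge_atTop 0] with t ht
    rw [intervalIntegral.integral_comp_add_right (fun s => x.2 (atTime s)), zero_add,
      hx (1 + t) (by positivity), hx t ht, add_sub_add_left_eq_sub]
    exact intervalIntegral.integral_interval_sub_left (hc.intervalIntegrable _ _)
      (hc.intervalIntegrable _ _)
  simpa using tendsto_nhds_unique h1 h2

end HalfLineFunctions

/-! ### Linear differential equations: uniqueness and global existence. -/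

section LinearODE

variable {E : Type*} [NormedAddCommGroup E] [NormedSpace ℝ E]

/-- Uniqueness for ordinary differential equations on `[a, ∞)`. -/
theorem eqOn_Ici_of_hasDerivWithinAt {v : ℝ → E → E} {s : Set E} {K : NNReal} {a : ℝ}
    {f g : ℝ → E} (hv : ∀ t, a ≤ t → LipschitzOnWith K (v t) s)
    (hf : ∀ t, a ≤ t → HasDerivWithinAt f (v t (f t)) (Set.Ici a) t) (hfs : ∀ t, a ≤ t → f t ∈ s)
    (hg : ∀ t, a ≤ t → HasDerivWithinAt g (v t (g t)) (Set.Ici a) t) (hgs : ∀ t, a ≤ t → g t ∈ s)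
    (ha : f a = g a) : ∀ t, a ≤ t → f t = g t := by
  intro t ht
  exact ODE_solution_unique_of_mem_Icc_right (a := a) (b := t) (s := fun _ => s)
    (fun τ hτ => hv τ hτ.1)
    (fun τ hτ => ((hf τ hτ.1).mono Set.Icc_subset_Ici_self).continuousWithinAt)
    (fun τ hτ => (hf τ hτ.1).mono (Set.Ici_subset_Ici.2 hτ.1)) (fun τ hτ => hfs τ hτ.1)
    (fun τ hτ => ((hg τ hτ.1).mono Set.Icc_subset_Ici_self).continuousWithinAt)
    (fun τ hτ => (hg τ hτ.1).mono (Set.Ici_subset_Ici.2 hτ.1)) (fun τ hτ => hgs τ hτ.1) ha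
    ⟨ht, le_rfl⟩

theorem lipschitzWith_clm_add {B : E →L[ℝ] E} {K : ℝ} (hB : ‖B‖ ≤ K) (h : E) :
    LipschitzWith K.toNNReal fun x => B x + h := by
  refine LipschitzWith.of_dist_le_mul fun x y => ?_
  rw [dist_add_right, dist_eq_norm, dist_eq_norm, ← map_sub]
  exact B.le_of_opNorm_le (hB.trans (Real.le_coe_toNNReal K)) _

/-- Uniqueness for linear equations on `[a, ∞)`. -/
theorem linear_eqOn_Ici {B : ℝ → E →L[ℝ] E} {h : ℝ → E} {K a : ℝ} {f g : ℝ → E}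
    (hB : ∀ t, a ≤ t → ‖B t‖ ≤ K)
    (hf : ∀ t, a ≤ t → HasDerivWithinAt f (B t (f t) + h t) (Set.Ici a) t)
    (hg : ∀ t, a ≤ t → HasDerivWithinAt g (B t (g t) + h t) (Set.Ici a) t)
    (ha : f a = g a) : ∀ t, a ≤ t → f t = g t :=
  eqOn_Ici_of_hasDerivWithinAt (v := fun t x => B t x + h t) (s := Set.univ)
    (fun t ht => (lipschitzWith_clm_add (hB t ht) (h t)).lipschitzOnWith) hf
    (fun _ _ => trivial) hg (fun _ _ => trivial) ha

/-- The gain of a factor `1 / γ` makes the Picard operator a contraction in the norm weighted by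
`exp (-γ |t|)`, so that a solution on the whole line is obtained at once. -/
theorem integral_exp_mul_abs_le {γ : ℝ} (hγ : 0 < γ) (t : ℝ) :
    |∫ s in (0 : ℝ)..t, Real.exp (γ * |s|)| ≤ Real.exp (γ * |t|) / γ := by
  have key : ∀ t : ℝ, 0 ≤ t →
      ∫ s in (0 : ℝ)..t, Real.exp (γ * |s|) = (Real.exp (γ * t) - 1) / γ := by
    intro t ht
    have h1 : ∫ s in (0 : ℝ)..t, Real.exp (γ * |s|) = ∫ s in (0 : ℝ)..t, Real.exp (γ * s) := by
      refine intervalIntegral.integral_congr fun s hs => ?_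
      rw [Set.uIcc_of_le ht] at hs
      simp only [abs_of_nonneg hs.1]
    rw [h1, intervalIntegral.integral_comp_mul_left (fun s => Real.exp s) hγ.ne', integral_exp]
    simp [div_eq_inv_mul]
  have key2 : ∀ t : ℝ, 0 ≤ t →
      |∫ s in (0 : ℝ)..t, Real.exp (γ * |s|)| ≤ Real.exp (γ * t) / γ := by
    intro t ht
    rw [key t ht, abs_of_nonneg]
    · gcongr
      linarith
    · refine div_nonneg (sub_nonneg.2 (Real.one_le_exp (by positivity))) hγ.le
  rcases le_total 0 t with ht | ht
  · rw [abs_of_nonneg ht]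
    exact key2 t ht
  · have h1 : ∫ s in (0 : ℝ)..t, Real.exp (γ * |s|) =
        -∫ s in (0 : ℝ)..(-t), Real.exp (γ * |s|) := by
      have := intervalIntegral.integral_comp_neg (a := 0) (b := -t) fun s => Real.exp (γ * |s|)
      simp only [abs_neg, neg_neg, neg_zero] at this
      rw [this, intervalIntegral.integral_symm]
    rw [h1, abs_neg, abs_of_nonpos ht]
    exact key2 (-t) (by linarith)

variable [CompleteSpace E]

/-- Global existence for linear equations with bounded continuous coefficients. -/
theorem exists_linear_solution {B : ℝ → E →L[ℝ] E} (hB : Continuous B) {K : ℝ}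
    (hK : ∀ t, ‖B t‖ ≤ K) (x₀ : E) :
    ∃ u : ℝ → E, u 0 = x₀ ∧ ∀ t, HasDerivAt u (B t (u t)) t := by
  have hK0 : 0 ≤ K := (norm_nonneg _).trans (hK 0)
  -- With this choice `K / γ ≤ 1 / 2`, and `γ` is positive even when `K = 0`.
  set γ : ℝ := 2 * K + 1 with hγdef
  have hγ : 0 < γ := by positivity
  have hcont : ∀ z : BoundedContinuousFunction ℝ E,
      Continuous fun s => Real.exp (γ * |s|) • B s (z s) := fun z =>
    (by fun_prop : Continuous fun s : ℝ => Real.exp (γ * |s|)).smul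
      (hB.clm_apply z.continuous)
  let I : BoundedContinuousFunction ℝ E → ℝ → E := fun z t =>
    ∫ s in (0 : ℝ)..t, Real.exp (γ * |s|) • B s (z s)
  have hIcont : ∀ z, Continuous (I z) := fun z =>
    intervalIntegral.continuous_primitive (fun a b => (hcont z).intervalIntegrable a b) 0
  have hIbound : ∀ (z : ℝ → E) (C t : ℝ), (∀ s, ‖z s‖ ≤ C) →
      ‖∫ s in (0 : ℝ)..t, Real.exp (γ * |s|) • B s (z s)‖ ≤
        K * C * (Real.exp (γ * |t|) / γ) := by
    intro z C t hz
    have hC : 0 ≤ C := (norm_nonneg _).trans (hz 0)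
    have h1 := intervalIntegral.norm_integral_le_abs_of_norm_le (μ := volume)
      (f := fun s => Real.exp (γ * |s|) • B s (z s)) (a := 0) (b := t)
      (g := fun s => K * C * Real.exp (γ * |s|))
      (Eventually.of_forall fun s => by
        rw [norm_smul, Real.norm_of_nonneg (Real.exp_pos _).le, mul_comm]
        gcongr
        exact (B s).le_of_opNorm_le_of_le (hK s) (hz s))
      ((by fun_prop : Continuous fun s : ℝ => K * C * Real.exp (γ * |s|)).intervalIntegrable _ _)
    refine h1.trans ?_
    rw [intervalIntegral.integral_const_mul, abs_mul, abs_of_nonneg (by positivity)]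
    exact mul_le_mul_of_nonneg_left (integral_exp_mul_abs_le hγ t) (by positivity)
  have hexp : ∀ t : ℝ, Real.exp (-(γ * |t|)) * Real.exp (γ * |t|) = 1 := fun t => by
    rw [← Real.exp_add, neg_add_cancel, Real.exp_zero]
  have hwb : ∀ (x : E) (a t : ℝ), ‖x‖ ≤ a * (Real.exp (γ * |t|) / γ) →
      ‖Real.exp (-(γ * |t|)) • x‖ ≤ a / γ := by
    intro x a t hx
    rw [norm_smul, Real.norm_of_nonneg (Real.exp_pos _).le]
    calc _ ≤ Real.exp (-(γ * |t|)) * (a * (Real.exp (γ * |t|) / γ)) := by gcongr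
      _ = a / γ * (Real.exp (-(γ * |t|)) * Real.exp (γ * |t|)) := by ring
      _ = a / γ := by rw [hexp, mul_one]
  have hΨ : ∀ z : BoundedContinuousFunction ℝ E, ∀ t,
      ‖Real.exp (-(γ * |t|)) • (x₀ + I z t)‖ ≤ ‖x₀‖ + K * ‖z‖ / γ := by
    intro z t
    rw [smul_add]
    refine (norm_add_le _ _).trans (add_le_add ?_ (hwb _ _ t (hIbound z ‖z‖ t z.norm_coe_le_norm)))
    rw [norm_smul, Real.norm_of_nonneg (Real.exp_pos _).le]
    refine mul_le_of_le_one_left (norm_nonneg _) (Real.exp_le_one_iff.2 ?_)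
    have : 0 ≤ γ * |t| := by positivity
    linarith
  -- The unknown is the weighted function `z t = exp (-γ |t|) • u t`, which is bounded even though
  -- `u` may grow exponentially; `Ψ` is the Picard operator in this variable.
  let Ψ : BoundedContinuousFunction ℝ E → BoundedContinuousFunction ℝ E := fun z =>
    BoundedContinuousFunction.ofNormedAddCommGroup
      (fun t => Real.exp (-(γ * |t|)) • (x₀ + I z t))
      ((by fun_prop : Continuous fun s : ℝ => Real.exp (-(γ * |s|))).smul
        (continuous_const.add (hIcont z))) _ (hΨ z)
  have hcontr : ContractingWith (1 / 2) Ψ := by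
    refine ⟨by norm_num, LipschitzWith.of_dist_le_mul fun z z' => ?_⟩
    rw [BoundedContinuousFunction.dist_le (by positivity)]
    intro t
    change dist (Real.exp (-(γ * |t|)) • (x₀ + I z t)) (Real.exp (-(γ * |t|)) • (x₀ + I z' t)) ≤ _
    rw [dist_eq_norm, ← smul_sub, add_sub_add_left_eq_sub]
    have h1 : I z t - I z' t = ∫ s in (0 : ℝ)..t, Real.exp (γ * |s|) • B s (z s - z' s) := by
      simp only [I]
      rw [← intervalIntegral.integral_sub ((hcont z).intervalIntegrable _ _)
        ((hcont z').intervalIntegrable _ _)]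
      simp only [map_sub, smul_sub]
    rw [h1]
    refine (hwb _ _ t (hIbound (fun s => z s - z' s) (dist z z') t fun s => ?_)).trans ?_
    · rw [← dist_eq_norm]
      exact BoundedContinuousFunction.dist_coe_le_dist s
    · rw [div_le_iff₀ hγ]
      have hd : 0 ≤ dist z z' := dist_nonneg
      have : ((1 / 2 : NNReal) : ℝ) = 1 / 2 := by norm_num
      rw [this, hγdef]
      nlinarith
  set z := hcontr.fixedPoint Ψ with hz
  have hfix : ∀ t, z t = Real.exp (-(γ * |t|)) • (x₀ + I z t) := fun t => by
    conv_lhs => rw [hz, ← hcontr.fixedPoint_isFixedPt]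
    rfl
  have hz' : ∀ t, Real.exp (γ * |t|) • z t = x₀ + I z t := fun t => by
    rw [hfix, smul_smul, mul_comm, hexp, one_smul]
  refine ⟨fun t => x₀ + I z t, by simp [I], fun t => ?_⟩
  have hd := (intervalIntegral.integral_hasDerivAt_right ((hcont z).intervalIntegrable 0 t)
    ((hcont z).stronglyMeasurableAtFilter _ _) (hcont z).continuousAt).const_add x₀
  rw [← map_smul, hz' t] at hd
  exact hd

/-- Global existence for inhomogeneous linear equations with bounded continuous coefficients. -/
theorem exists_linear_solution_inhomogeneous {B : ℝ → E →L[ℝ] E} (hB : Continuous B) {K : ℝ}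
    (hK : ∀ t, ‖B t‖ ≤ K) {h : ℝ → E} (hh : Continuous h) {C : ℝ} (hC : ∀ t, ‖h t‖ ≤ C)
    (t₀ : ℝ) (x₀ : E) :
    ∃ u : ℝ → E, u t₀ = x₀ ∧ ∀ t, HasDerivAt u (B t (u t) + h t) t := by
  -- The inhomogeneity is absorbed by a second coordinate which is constantly `1`: the system `(u,
  -- c)' = (B u + c h, 0)` is homogeneous. The time shift moves the initial time to `0`.
  let D : ℝ → (E × ℝ) →L[ℝ] (E × ℝ) := fun t =>
    ContinuousLinearMap.inl ℝ E ℝ ∘L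
      (B (t + t₀) ∘L ContinuousLinearMap.fst ℝ E ℝ +
        (ContinuousLinearMap.snd ℝ E ℝ).smulRight (h (t + t₀)))
  have hD : Continuous D := by
    have h1 : Continuous fun t : ℝ => B (t + t₀) := hB.comp (by fun_prop)
    have h2 : Continuous fun t : ℝ => h (t + t₀) := hh.comp (by fun_prop)
    refine continuous_const.clm_comp ((h1.clm_comp continuous_const).add ?_)
    exact (ContinuousLinearMap.smulRightL ℝ (E × ℝ) E
      (ContinuousLinearMap.snd ℝ E ℝ)).continuous.comp h2
  have hDK : ∀ t, ‖D t‖ ≤ K + C := by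
    intro t
    have hK0 : 0 ≤ K := (norm_nonneg _).trans (hK 0)
    have hC0 : 0 ≤ C := (norm_nonneg _).trans (hC 0)
    refine ContinuousLinearMap.opNorm_le_bound _ (by positivity) fun x => ?_
    have h1 : ‖D t x‖ = ‖B (t + t₀) x.1 + x.2 • h (t + t₀)‖ := by
      simp [D, Prod.norm_def]
    rw [h1, add_mul]
    refine (norm_add_le _ _).trans (add_le_add ?_ ?_)
    · exact (B _).le_of_opNorm_le_of_le (hK _) (norm_fst_le x)
    · rw [norm_smul, mul_comm]
      exact mul_le_mul (hC _) (norm_snd_le x) (norm_nonneg _) hC0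
  obtain ⟨u, hu0, hu⟩ := exists_linear_solution hD hDK (x₀, (1 : ℝ))
  have h2 : ∀ t, (u t).2 = 1 := by
    have hd : ∀ t, HasDerivAt (fun t => (u t).2) 0 t := fun t => by
      have := (ContinuousLinearMap.snd ℝ E ℝ).hasFDerivAt.comp_hasDerivAt t (hu t)
      simpa [D, Function.comp_def] using this
    intro t
    have := is_const_of_deriv_eq_zero (fun t => (hd t).differentiableAt)
      (fun t => (hd t).deriv) t 0
    simpa [hu0] using this
  have h1 : ∀ t, HasDerivAt (fun t => (u t).1) (B (t + t₀) (u t).1 + h (t + t₀)) t := fun t => by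
    have := (ContinuousLinearMap.fst ℝ E ℝ).hasFDerivAt.comp_hasDerivAt t (hu t)
    simpa [D, h2 t, Function.comp_def] using this
  refine ⟨fun t => (u (t - t₀)).1, by simp [hu0], fun t => ?_⟩
  have := (h1 (t - t₀)).comp_sub_const t t₀
  simpa using this

end LinearODE

/-! ### Convergent solutions with constant coefficients, one eigenvalue at a time. -/

section ScalarEquation

variable {V : Type*} [NormedAddCommGroup V] [NormedSpace ℂ V]

theorem norm_exp_smul_le {μ : ℂ} {x : V} {C : ℝ} (hx : ‖x‖ ≤ C) (s : ℝ) :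
    ‖Complex.exp (-(μ * s)) • x‖ ≤ Real.exp (-μ.re * s) * C := by
  rw [norm_smul, Complex.norm_exp]
  simp only [Complex.neg_re, Complex.mul_re, Complex.ofReal_re, Complex.ofReal_im, mul_zero,
    sub_zero, neg_mul]
  gcongr

variable [CompleteSpace V]

/-- If `Re μ > 0` and `h` is bounded and continuous, then `y' = μ y + h` has a bounded solution,
which has a limit along every translation invariant filter along which `h` has a limit. -/
theorem exists_scalar_solution_of_pos {μ : ℂ} (hμ : 0 < μ.re) {h : ℝ → V} (hh : Continuous h)
    {C : ℝ} (hC : ∀ t, ‖h t‖ ≤ C) {F : Filter ℝ} [F.IsCountablyGenerated]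
    (hF : ∀ s : ℝ, Tendsto (fun t => t + s) F F) {l : V} (hl : Tendsto h F (𝓝 l)) :
    ∃ y : ℝ → V, (∀ t, HasDerivAt y (μ • y t + h t) t) ∧ (∃ m, Tendsto y F (𝓝 m)) ∧
      (∃ D, ∀ t, ‖y t‖ ≤ D) ∧
      ∀ L : V →L[ℂ] V, (∀ t, L (h t) = 0) → ∀ t, L (y t) = 0 := by
  have hexpc : Continuous fun s : ℝ => Complex.exp (-(μ * s)) := by fun_prop
  have hint : ∀ a : ℝ, IntegrableOn (fun s : ℝ => Real.exp (-μ.re * s) * C) (Set.Ioi a) :=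
    fun a => (exp_neg_integrableOn_Ioi a hμ).mul_const C
  have hinth : ∀ (t a : ℝ),
      IntegrableOn (fun s : ℝ => Complex.exp (-(μ * s)) • h (t + s)) (Set.Ioi a) := fun t a =>
    (hint a).mono' ((hexpc.smul (hh.comp (by fun_prop))).aestronglyMeasurable)
      (Eventually.of_forall fun s => norm_exp_smul_le (hC _) s)
  have hφ : Continuous fun s : ℝ => Complex.exp (-(μ * s)) • h s := hexpc.smul hh
  have hintφ : ∀ a : ℝ, IntegrableOn (fun s : ℝ => Complex.exp (-(μ * s)) • h s) (Set.Ioi a) :=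
    fun a => by simpa using hinth 0 a
  -- This is the bounded solution, with the initial value that cancels the growing mode. The form
  -- with `h (t + s)` suits dominated convergence and the inheritance of linear relations; the
  -- variation of constants form `hform` is the one to differentiate.
  set y : ℝ → V := fun t => -∫ s in Set.Ioi (0 : ℝ), Complex.exp (-(μ * s)) • h (t + s) with hy
  have hform : ∀ t : ℝ, y t = Complex.exp (μ * t) •
      ((∫ s in (0 : ℝ)..t, Complex.exp (-(μ * s)) • h s) -
        ∫ s in Set.Ioi (0 : ℝ), Complex.exp (-(μ * s)) • h s) := by
    intro t
    have h1 : (∫ s in Set.Ioi (0 : ℝ), Complex.exp (-(μ * s)) • h (t + s)) =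
        Complex.exp (μ * t) • ∫ s in Set.Ioi t, Complex.exp (-(μ * s)) • h s := by
      rw [← integral_smul]
      have h2 := (measurePreserving_add_left volume t).setIntegral_preimage_emb
        (MeasurableEquiv.addLeft t).measurableEmbedding
        (fun s => Complex.exp (μ * t) • Complex.exp (-(μ * s)) • h s) (Set.Ioi t)
      rw [← h2]
      have h3 : (fun x => t + x) ⁻¹' Set.Ioi t = Set.Ioi 0 := by
        ext x
        simp
      rw [h3]
      refine integral_congr_ae (Eventually.of_forall fun s => ?_)
      simp only [smul_smul, ← Complex.exp_add]
      congr 2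
      push_cast
      ring
    rw [hy]
    simp only
    rw [h1, ← intervalIntegral.integral_interval_add_Ioi (hintφ 0) (hintφ t), sub_add_cancel_left,
      smul_neg]
  refine ⟨y, fun t => ?_, ⟨-∫ s in Set.Ioi (0 : ℝ), Complex.exp (-(μ * s)) • l, ?_⟩, ?_, ?_⟩
  · have h1 : HasDerivAt (fun t : ℝ => Complex.exp (μ * t)) (Complex.exp (μ * t) * μ) t := by
      have := ((Complex.ofRealCLM.hasDerivAt (x := t)).const_mul μ).cexp
      simpa using this
    have h2 := ((intervalIntegral.integral_hasDerivAt_right (hφ.intervalIntegrable 0 t)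
      (hφ.stronglyMeasurableAtFilter _ _) hφ.continuousAt).sub_const
        (∫ s in Set.Ioi (0 : ℝ), Complex.exp (-(μ * s)) • h s))
    have h3 := h1.smul h2
    have h4 : y = fun t : ℝ => Complex.exp (μ * t) •
      ((∫ s in (0 : ℝ)..t, Complex.exp (-(μ * s)) • h s) -
        ∫ s in Set.Ioi (0 : ℝ), Complex.exp (-(μ * s)) • h s) := funext hform
    rw [h4]
    convert! h3 using 1
    rw [smul_smul, smul_smul, ← Complex.exp_add, mul_comm μ, add_comm]
    simp
  · refine (tendsto_integral_filter_of_dominated_convergence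
      (fun s : ℝ => Real.exp (-μ.re * s) * C) (Eventually.of_forall fun t => ?_)
      (Eventually.of_forall fun t => ?_) (hint 0) ?_).neg
    · exact (hexpc.smul (hh.comp (by fun_prop))).aestronglyMeasurable
    · exact Eventually.of_forall fun s => norm_exp_smul_le (hC _) s
    · exact Eventually.of_forall fun s => (hl.comp (hF s)).const_smul _
  · refine ⟨∫ s in Set.Ioi (0 : ℝ), Real.exp (-μ.re * s) * C, fun t => ?_⟩
    rw [hy]
    simp only [norm_neg]
    exact norm_integral_le_of_norm_le (hint 0)
      (Eventually.of_forall fun s => norm_exp_smul_le (hC _) s)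
  · intro L hL t
    rw [hy]
    simp only [map_neg, neg_eq_zero]
    rw [← L.integral_comp_comm (hinth t 0)]
    simp [hL]

/-- If `Re μ ≠ 0` and `h` is bounded and continuous with a limit at infinity, then `y' = μ y + h`
has a bounded solution with a limit at infinity. -/
theorem exists_scalar_solution {μ : ℂ} (hμ : μ.re ≠ 0) {h : ℝ → V} (hh : Continuous h)
    {C : ℝ} (hC : ∀ t, ‖h t‖ ≤ C) {l : V} (hl : Tendsto h atTop (𝓝 l)) :
    ∃ y : ℝ → V, (∀ t, HasDerivAt y (μ • y t + h t) t) ∧ (∃ m, Tendsto y atTop (𝓝 m)) ∧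
      (∃ D, ∀ t, ‖y t‖ ≤ D) ∧
      ∀ L : V →L[ℂ] V, (∀ t, L (h t) = 0) → ∀ t, L (y t) = 0 := by
  rcases hμ.lt_or_gt with h0 | h0
  -- For `Re μ < 0` time is reversed, so the limit at `+∞` becomes one along `atBot`; the previous
  -- statement allows a general translation invariant filter for this reason.
  · obtain ⟨y, hy, ⟨m, hm⟩, ⟨D, hD⟩, hL⟩ := exists_scalar_solution_of_pos (μ := -μ)
      (by simpa using h0) (h := fun t => -h (-t)) (hh.comp continuous_neg).neg (C := C)
      (fun t => by simpa using hC (-t)) (F := atBot)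
      (fun s => tendsto_atBot_add_const_right _ _ tendsto_id) (hl.comp tendsto_neg_atBot_atTop).neg
    refine ⟨fun t => y (-t), fun t => ?_, ⟨m, hm.comp tendsto_neg_atTop_atBot⟩,
      ⟨D, fun t => hD _⟩, fun L h1 t => hL L (fun s => by simp [h1]) _⟩
    have := (hy (-t)).scomp t (hasDerivAt_neg t)
    simpa [Function.comp_def] using this
  · exact exists_scalar_solution_of_pos h0 hh hC
      (fun s => tendsto_atTop_add_const_right _ _ tendsto_id) hl

/-- If no root of a split polynomial annihilating `h` lies on the imaginary axis, then
`u' = C u + h` has a bounded solution with a limit at infinity. -/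
theorem exists_solution_of_aeval_eq_zero (B : V →L[ℂ] V) (s : Multiset ℂ)
    (hs : ∀ μ ∈ s, μ.re ≠ 0) {h : ℝ → V} (hh : Continuous h) {C : ℝ} (hC : ∀ t, ‖h t‖ ≤ C) {l : V}
    (hl : Tendsto h atTop (𝓝 l))
    (hz : ∀ t, Polynomial.aeval B (s.map fun μ => Polynomial.X - Polynomial.C μ).prod (h t) = 0) :
    ∃ u : ℝ → V, (∀ t, HasDerivAt u (B (u t) + h t) t) ∧ ∃ m, Tendsto u atTop (𝓝 m) := by
  induction s using Multiset.induction_on generalizing h C l with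
  | empty =>
    have h0 : h = fun _ => 0 := funext fun t => by simpa using hz t
    refine ⟨fun _ => 0, fun t => ?_, 0, tendsto_const_nhds⟩
    simpa [h0] using hasDerivAt_const t (0 : V)
  | cons μ s ih =>
    obtain ⟨y, hy, ⟨m, hm⟩, ⟨D, hD⟩, hL⟩ := exists_scalar_solution
      (hs μ (Multiset.mem_cons_self μ s)) hh hC hl
    have hyc : Continuous y := continuous_iff_continuousAt.2 fun t => (hy t).continuousAt
    -- If `y' = μ y + h` and `z' = B z + (B - μ) y`, then `y + z` solves `u' = B u + h`. The full
    -- product kills `h`, hence also `y`, since `y` inherits the linear relations satisfied by `h`;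
    -- therefore the product of the remaining factors kills `(B - μ) y`, and the induction
    -- hypothesis provides `z`.
    set R : V →L[ℂ] V := B - algebraMap ℂ (V →L[ℂ] V) μ with hR
    have hRx : ∀ x, R x = B x - μ • x := fun x => by simp [hR, Algebra.algebraMap_eq_smul_one]
    obtain ⟨z, hz', m', hm'⟩ := ih (fun ν hν => hs ν (Multiset.mem_cons_of_mem hν))
      (h := fun t => R (y t)) (R.continuous.comp hyc) (C := ‖R‖ * D)
      (fun t => R.le_of_opNorm_le_of_le le_rfl (hD t)) ((R.continuous.tendsto _).comp hm)
      (fun t => by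
        have h1 := hL _ hz t
        rw [Multiset.map_cons, Multiset.prod_cons, mul_comm, map_mul, map_sub, Polynomial.aeval_X,
          Polynomial.aeval_C] at h1
        exact h1)
    refine ⟨fun t => y t + z t, fun t => ?_, m + m', hm.add hm'⟩
    convert! (hy t).add (hz' t) using 1
    rw [hRx, map_add]
    abel

end ScalarEquation

/-! ### Hyperbolic linear maps with constant coefficients. -/

/-- A linear map without eigenvalues on the imaginary axis. -/
def IsHyperbolicMap {n : ℕ} (A : Euc n →L[ℝ] Euc n) : Prop :=
  ∀ z : ℂ, Polynomial.aeval z (LinearMap.charpoly A.toLinearMap) = 0 → z.re ≠ 0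

section Hyperbolic

variable {n : ℕ}

/-- The matrix of a linear map in the standard basis, with complex entries. -/
noncomputable def complexMatrix (A : Euc n →L[ℝ] Euc n) : Matrix (Fin n) (Fin n) ℂ :=
  (LinearMap.toMatrix (EuclideanSpace.basisFun (Fin n) ℝ).toBasis
    (EuclideanSpace.basisFun (Fin n) ℝ).toBasis A.toLinearMap).map (algebraMap ℝ ℂ)

theorem charpoly_complexMatrix (A : Euc n →L[ℝ] Euc n) :
    (complexMatrix A).charpoly = (LinearMap.charpoly A.toLinearMap).map (algebraMap ℝ ℂ) := by
  rw [complexMatrix, Matrix.charpoly_map, LinearMap.charpoly_toMatrix]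

/-- Hyperbolicity becomes nonvanishing of a determinant on the imaginary axis. Its invariance under
`A ↦ -A` and its openness are proved in this form. -/
theorem aeval_charpoly_eq_det (A : Euc n →L[ℝ] Euc n) (z : ℂ) :
    Polynomial.aeval z (LinearMap.charpoly A.toLinearMap) =
      (Matrix.scalar (Fin n) z - complexMatrix A).det := by
  rw [← Polynomial.eval_map_algebraMap, ← charpoly_complexMatrix, Matrix.eval_charpoly]

/-- The matrix has real entries, so it commutes with taking real parts; thus the real part of a
solution of the complexified equation solves the real equation. -/
theorem re_complexMatrix_mulVec (A : Euc n →L[ℝ] Euc n) (v : Fin n → ℂ) (i : Fin n) :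
    ((complexMatrix A).mulVec v i).re = A (WithLp.toLp 2 fun j => (v j).re) i := by
  have h1 := LinearMap.toMatrix_mulVec_repr (EuclideanSpace.basisFun (Fin n) ℝ).toBasis
    (EuclideanSpace.basisFun (Fin n) ℝ).toBasis A.toLinearMap (WithLp.toLp 2 fun j => (v j).re)
  have h2 := congrFun h1 i
  simp only [OrthonormalBasis.coe_toBasis_repr_apply, EuclideanSpace.basisFun_repr] at h2
  rw [ContinuousLinearMap.coe_coe] at h2
  rw [← h2]
  simp [Matrix.mulVec, dotProduct, complexMatrix]

/-- If `A` is hyperbolic and `h` is continuous with a limit at infinity, then `u' = A u + h`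
has a solution with a limit at infinity. -/
theorem IsHyperbolicMap.exists_solution {A : Euc n →L[ℝ] Euc n} (hA : IsHyperbolicMap A)
    {h : ℝ → Euc n} (hh : Continuous h) {C : ℝ} (hC : ∀ t, ‖h t‖ ≤ C) {l : Euc n}
    (hl : Tendsto h atTop (𝓝 l)) :
    ∃ u : ℝ → Euc n, (∀ t, HasDerivAt u (A (u t) + h t) t) ∧ ∃ m, Tendsto u atTop (𝓝 m) := by
  set M := complexMatrix A with hM
  set T : (Fin n → ℂ) →ₗ[ℂ] (Fin n → ℂ) := Matrix.toLin' M with hT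
  set B : (Fin n → ℂ) →L[ℂ] (Fin n → ℂ) := LinearMap.toContinuousLinearMap T with hB
  -- By Cayley-Hamilton the characteristic polynomial kills every inhomogeneity. It splits over `ℂ`
  -- and its roots avoid the imaginary axis, so the factor-by-factor solution applies.
  have hchar : Polynomial.aeval B M.charpoly = 0 := by
    have h1 : Polynomial.aeval T M.charpoly = 0 := by
      rw [← Matrix.charpoly_toLin', hT]
      exact LinearMap.aeval_self_charpoly _
    have h2 := Polynomial.aeval_algHom_apply
      (Module.End.toContinuousLinearMap (𝕜 := ℂ) (Fin n → ℂ)).toAlgHom T M.charpoly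
    rw [h1, map_zero] at h2
    exact h2
  have hprod : (M.charpoly.roots.map fun μ => Polynomial.X - Polynomial.C μ).prod = M.charpoly :=
    ((IsAlgClosed.splits _).eq_prod_roots_of_monic (Matrix.charpoly_monic M)).symm
  have hroots : ∀ μ ∈ M.charpoly.roots, μ.re ≠ 0 := by
    intro μ hμ
    have h1 := (Polynomial.mem_roots'.1 hμ).2
    rw [Polynomial.IsRoot.def, hM, charpoly_complexMatrix, Polynomial.eval_map_algebraMap] at h1
    exact hA μ h1
  let J : Euc n →L[ℝ] (Fin n → ℂ) :=
    ContinuousLinearMap.pi fun i => Complex.ofRealCLM ∘L EuclideanSpace.proj i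
  have hJ : ∀ x i, J x i = (x i : ℂ) := fun x i => rfl
  obtain ⟨u, hu, m, hm⟩ := exists_solution_of_aeval_eq_zero B M.charpoly.roots hroots
    (h := fun t => J (h t)) (J.continuous.comp hh) (C := ‖J‖ * C)
    (fun t => J.le_of_opNorm_le_of_le le_rfl (hC t)) ((J.continuous.tendsto _).comp hl)
    (fun t => by rw [hprod, hchar]; rfl)
  let P : (Fin n → ℂ) →L[ℝ] Euc n :=
    (EuclideanSpace.equiv (Fin n) ℝ).symm.toContinuousLinearMap ∘L
      ContinuousLinearMap.pi fun i => Complex.reCLM ∘L ContinuousLinearMap.proj i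
  have hP : ∀ v i, P v i = (v i).re := fun v i => rfl
  refine ⟨fun t => P (u t), fun t => ?_, P m, (P.continuous.tendsto _).comp hm⟩
  have h1 := P.hasFDerivAt.comp_hasDerivAt t (hu t)
  have h2 : P (B (u t) + J (h t)) = A (P (u t)) + h t := by
    ext i
    rw [hP, Pi.add_apply, Complex.add_re, hJ, Complex.ofReal_re, PiLp.add_apply]
    congr 1
    exact re_complexMatrix_mulVec A (u t) i
  rw [h2] at h1
  exact h1

/-- Up to a sign, the characteristic polynomial of `-A` at `z` is that of `A` at `-z`. This is what
time reversal needs. -/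
theorem IsHyperbolicMap.neg {A : Euc n →L[ℝ] Euc n} (hA : IsHyperbolicMap A) :
    IsHyperbolicMap (-A) := by
  have hneg : complexMatrix (-A) = -complexMatrix A := by
    ext i j
    simp [complexMatrix]
  intro z hz
  rw [aeval_charpoly_eq_det, hneg] at hz
  have h1 : Matrix.scalar (Fin n) z - -complexMatrix A =
      -(Matrix.scalar (Fin n) (-z) - complexMatrix A) := by
    rw [map_neg]
    abel
  rw [h1, Matrix.det_neg, mul_eq_zero] at hz
  have h2 := hz.resolve_left (pow_ne_zero _ (by norm_num))
  rw [← aeval_charpoly_eq_det] at h2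
  simpa using hA (-z) h2

end Hyperbolic

/-! ### The operator `y' - A(t) y` on the half-line. -/

/-- A surjection of Banach spaces has a right inverse with a norm bound, by the open mapping
theorem. A perturbation smaller than half the reciprocal of this bound is still surjective, by the
usual iteration. -/
theorem exists_forall_surjective_of_norm_sub_le {X Y : Type*} [NormedAddCommGroup X]
    [NormedSpace ℝ X] [CompleteSpace X] [NormedAddCommGroup Y] [NormedSpace ℝ Y] [CompleteSpace Y]
    {L : X →L[ℝ] Y} (hL : Function.Surjective L) :
    ∃ δ > 0, ∀ L' : X →L[ℝ] Y, ‖L' - L‖ ≤ δ → Function.Surjective L' := by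
  have hrange : L.range = ⊤ := LinearMap.range_eq_top.2 hL
  set R := L.nonlinearRightInverseOfSurjective hrange
  have hR : 0 < R.nnnorm := L.nonlinearRightInverseOfSurjective_nnnorm_pos hrange
  refine ⟨((R.nnnorm : ℝ)⁻¹ / 2), by positivity, fun L' hL' => ?_⟩
  have happ : ApproximatesLinearOn L' L Set.univ (R.nnnorm⁻¹ / 2) := by
    intro x _ y _
    have h1 : L' x - L' y - L (x - y) = (L' - L) (x - y) := by simp
    rw [h1]
    exact (L' - L).le_of_opNorm_le (by simpa using hL') _
  intro y
  have hpos : 0 < (R.nnnorm : ℝ)⁻¹ / 2 := by positivity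
  obtain ⟨x, -, hx⟩ := happ.surjOn_closedBall_of_nonlinearRightInverse R
    (ε := ‖y‖ / ((R.nnnorm : ℝ)⁻¹ / 2)) (b := 0) (by positivity) (Set.subset_univ _)
    (show y ∈ _ by
      rw [map_zero, mem_closedBall_zero_iff]
      push_cast
      rw [sub_half, mul_div_cancel₀ _ hpos.ne'])
  exact ⟨x, hx⟩

section VariableCoefficients

variable {n : ℕ}

/-- The differential operator `y ↦ y' - A y` on the half-line. -/
noncomputable def linearOperator (A : C(HalfLine, Euc n →L[ℝ] Euc n)) :
    c1HalfLine (Euc n) →L[ℝ] C(HalfLine, Euc n) :=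
  (ContinuousLinearMap.snd ℝ _ _ -
    pointwiseApply HalfLine (Euc n) (Euc n) A ∘L ContinuousLinearMap.fst ℝ _ _) ∘L
    (c1HalfLine (Euc n)).subtypeL

theorem linearOperator_apply (A : C(HalfLine, Euc n →L[ℝ] Euc n)) (x : c1HalfLine (Euc n))
    (τ : HalfLine) : linearOperator A x τ = x.1.2 τ - A τ (x.1.1 τ) := rfl

theorem hasDerivWithinAt_of_linearOperator_eq {A : C(HalfLine, Euc n →L[ℝ] Euc n)}
    {x : c1HalfLine (Euc n)} {H : C(HalfLine, Euc n)} (hx : linearOperator A x = H) (t : ℝ)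
    (ht : 0 ≤ t) :
    HasDerivWithinAt (fun t => x.1.1 (atTime t)) (A (atTime t) (x.1.1 (atTime t)) + H (atTime t))
      (Set.Ici 0) t := by
  have h1 := mem_c1HalfLine_iff.1 x.2 t ht
  rwa [← hx, linearOperator_apply, add_sub_cancel]

/-- A convergent solution of `u' = A u + H` defines an element of the space of convergent
continuously differentiable functions. -/
theorem exists_linearOperator_eq {A : C(HalfLine, Euc n →L[ℝ] Euc n)} {H : C(HalfLine, Euc n)}
    {u : ℝ → Euc n} (hu : ∀ t, 0 ≤ t →
      HasDerivWithinAt u (A (atTime t) (u t) + H (atTime t)) (Set.Ici 0) t)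
    {m : Euc n} (hm : Tendsto u atTop (𝓝 m)) :
    ∃ x : c1HalfLine (Euc n), linearOperator A x = H ∧
      (∀ t, 0 ≤ t → x.1.1 (atTime t) = u t) ∧ x.1.1 OnePoint.infty = m := by
  obtain ⟨U, hU, hUm⟩ := exists_halfLine_extension
    (fun t ht => (hu t ht).continuousWithinAt) hm
  refine ⟨⟨(U, pointwiseApply _ _ _ A U + H), mem_c1HalfLine_iff.2 fun t ht => ?_⟩, ?_, hU, hUm⟩
  · have h1 := (hu t ht).congr hU (hU t ht)
    simpa [hU t ht] using h1
  · ext1 τ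
    rw [linearOperator_apply]
    simp

theorem linearOperator_const_surjective {A : Euc n →L[ℝ] Euc n} (hA : IsHyperbolicMap A) :
    Function.Surjective (linearOperator (ContinuousMap.const HalfLine A)) := by
  intro H
  obtain ⟨u, hu, m, hm⟩ := hA.exists_solution (continuous_comp_atTime H)
    (fun t => H.norm_coe_le_norm (atTime t)) (tendsto_comp_atTime H)
  obtain ⟨x, hx, -⟩ := exists_linearOperator_eq (A := ContinuousMap.const HalfLine A) (H := H)
    (fun t _ => (hu t).hasDerivWithinAt) hm
  exact ⟨x, hx⟩

theorem norm_linearOperator_sub_le (A B : C(HalfLine, Euc n →L[ℝ] Euc n)) :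
    ‖linearOperator A - linearOperator B‖ ≤ ‖A - B‖ := by
  refine ContinuousLinearMap.opNorm_le_bound _ (by positivity) fun x => ?_
  have h1 : (linearOperator A - linearOperator B) x =
      -pointwiseApply HalfLine (Euc n) (Euc n) (A - B) x.1.1 := by
    ext1 τ
    change (x.1.2 τ - A τ (x.1.1 τ)) - (x.1.2 τ - B τ (x.1.1 τ)) = -((A τ - B τ) (x.1.1 τ))
    rw [sub_apply]
    abel
  rw [h1, norm_neg]
  refine ContinuousLinearMap.le_of_opNorm_le_of_le _ (norm_pointwiseApply_le _) ?_
  exact norm_fst_le x.1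

/-- If `A (∞)` is hyperbolic, then `u' = A u + h` has a convergent solution on `[0, ∞)` for every
convergent `h`. -/
theorem linearOperator_surjective {A : C(HalfLine, Euc n →L[ℝ] Euc n)}
    (hA : IsHyperbolicMap (A OnePoint.infty)) : Function.Surjective (linearOperator A) := by
  obtain ⟨δ, hδ, hsurj⟩ :=
    exists_forall_surjective_of_norm_sub_le (linearOperator_const_surjective hA)
  have htend := tendsto_comp_atTime A
  obtain ⟨T, hT⟩ := Metric.tendsto_atTop.1 htend δ hδ
  set T' := max T 0 with hT'
  -- Freezing the coefficient before the time `T'` makes it uniformly `δ`-close to its limit, so the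
  -- frozen operator is a small perturbation of the surjective constant coefficient operator.
  obtain ⟨A', hA', -⟩ := exists_halfLine_extension (u := fun t => A (atTime (max t T')))
    ((continuous_comp_atTime A).comp (by fun_prop : Continuous fun t => max t T')).continuousOn
    (htend.comp (tendsto_atTop_mono (fun t => le_max_left t T') tendsto_id))
  intro H
  obtain ⟨x, hx⟩ := hsurj (linearOperator A') (by
    refine (norm_linearOperator_sub_le _ _).trans (norm_le_of_forall_atTime fun t ht => ?_)
    have h1 := hT (max t T') ((le_max_left T 0).trans (le_max_right t T'))
    rw [dist_eq_norm] at h1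
    simpa [hA' t ht] using h1.le) H
  have hbound : ∀ t, ‖A (atTime t)‖ ≤ ‖A‖ := fun t => A.norm_coe_le_norm _
  -- After `T'` the frozen and the true equations coincide. The true solution with the same value at
  -- `T'` exists on the whole line and has the same convergent tail.
  obtain ⟨u, huT, hu⟩ := exists_linear_solution_inhomogeneous (continuous_comp_atTime A) hbound
    (continuous_comp_atTime H) (fun t => H.norm_coe_le_norm (atTime t)) T' (x.1.1 (atTime T'))
  have hT'0 : 0 ≤ T' := le_max_right T 0
  have heq := linear_eqOn_Ici (fun t _ => hbound t) (fun t _ => (hu t).hasDerivWithinAt)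
    (fun t (ht : T' ≤ t) => by
      have h1 := (hasDerivWithinAt_of_linearOperator_eq hx t (hT'0.trans ht)).mono
        (Set.Ici_subset_Ici.2 hT'0)
      rwa [hA' t (hT'0.trans ht), max_eq_left ht] at h1) huT
  obtain ⟨y, hy, -⟩ := exists_linearOperator_eq (A := A) (H := H)
    (fun t _ => (hu t).hasDerivWithinAt) (m := x.1.1 OnePoint.infty)
    ((tendsto_comp_atTime x.1.1).congr' (by
      filter_upwards [eventually_ge_atTop T'] with t ht using (heq t ht).symm))
  exact ⟨y, hy⟩

theorem IsHyperbolicMap.injective {A : Euc n →L[ℝ] Euc n} (hA : IsHyperbolicMap A) :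
    Function.Injective A := by
  refine (injective_iff_map_eq_zero A).2 fun v hv => ?_
  by_contra hv0
  have h1 : Module.End.HasEigenvalue (A.toLinearMap : Module.End ℝ (Euc n)) 0 :=
    Module.End.hasEigenvalue_of_hasEigenvector
      (x := v) ⟨Module.End.mem_eigenspace_iff.2 (by simpa using hv), hv0⟩
  have h2 := (Module.End.hasEigenvalue_iff_isRoot_charpoly _ _).1 h1
  refine hA 0 ?_ Complex.zero_re
  have h3 := Polynomial.aeval_algebraMap_apply ℂ (0 : ℝ) (LinearMap.charpoly A.toLinearMap)
  rw [map_zero] at h3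
  rw [h3, Polynomial.coe_aeval_eq_eval, h2.eq_zero, map_zero]

/-- The space of the initial values at time `0` of the solutions of `x' = A(t) x` on `[0, ∞)`
that tend to `0`. -/
def decayingValues (A : ℝ → Euc n →L[ℝ] Euc n) : Submodule ℝ (Euc n) where
  carrier := {v | ∃ x : ℝ → Euc n, x 0 = v ∧
    (∀ t, 0 ≤ t → HasDerivWithinAt x (A t (x t)) (Set.Ici 0) t) ∧ Tendsto x atTop (𝓝 0)}
  add_mem' := by
    rintro a b ⟨x, hx0, hx, hxt⟩ ⟨y, hy0, hy, hyt⟩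
    refine ⟨x + y, by rw [Pi.add_apply, hx0, hy0], fun t ht => ?_, by simpa [Pi.add_def] using hxt.add hyt⟩
    simpa using (hx t ht).add (hy t ht)
  zero_mem' := ⟨fun _ => 0, rfl, fun t _ => by simpa using hasDerivWithinAt_const t _ (0 : Euc n),
    tendsto_const_nhds⟩
  smul_mem' := by
    rintro c a ⟨x, hx0, hx, hxt⟩
    refine ⟨c • x, by rw [Pi.smul_apply, hx0], fun t ht => ?_, by simpa [Pi.smul_def] using hxt.const_smul c⟩
    simpa using (hx t ht).const_smul c

/-- The derivative of a convergent solution tends to `0`, so its limit lies in the kernel of `A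
(∞)`. This kernel is trivial, hence convergent homogeneous solutions decay. -/
theorem mem_decayingValues_of_linearOperator_eq_zero {A : C(HalfLine, Euc n →L[ℝ] Euc n)}
    (hA : IsHyperbolicMap (A OnePoint.infty)) {x : c1HalfLine (Euc n)}
    (hx : linearOperator A x = 0) :
    x.1.1 (atTime 0) ∈ decayingValues fun t => A (atTime t) := by
  refine ⟨fun t => x.1.1 (atTime t), rfl, fun t ht => ?_, ?_⟩
  · simpa using hasDerivWithinAt_of_linearOperator_eq hx t ht
  · have h1 := linearOperator_apply A x OnePoint.infty
    rw [hx, c1HalfLine_snd_infty x.2] at h1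
    have h2 : x.1.1 OnePoint.infty = 0 := by
      refine hA.injective ?_
      rw [map_zero]
      simpa using h1
    have := tendsto_comp_atTime x.1.1
    rwa [h2] at this

theorem exists_linearOperator_eq_zero {A : C(HalfLine, Euc n →L[ℝ] Euc n)} {v : Euc n}
    (hv : v ∈ decayingValues fun t => A (atTime t)) :
    ∃ x : c1HalfLine (Euc n), linearOperator A x = 0 ∧ x.1.1 (atTime 0) = v := by
  obtain ⟨u, hu0, hu, hut⟩ := hv
  obtain ⟨x, hx, hxu, -⟩ := exists_linearOperator_eq (A := A) (H := 0)
    (fun t ht => by simpa using hu t ht) hut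
  exact ⟨x, hx, by rw [hxu 0 le_rfl, hu0]⟩

theorem eq_zero_of_linearOperator_eq_zero {A : C(HalfLine, Euc n →L[ℝ] Euc n)}
    {x : c1HalfLine (Euc n)} (hx : linearOperator A x = 0) (h0 : x.1.1 (atTime 0) = 0) :
    x = 0 := by
  have h1 : ∀ t, 0 ≤ t → x.1.1 (atTime t) = 0 :=
    linear_eqOn_Ici (B := fun t => A (atTime t)) (h := fun _ => 0) (K := ‖A‖)
      (fun t _ => A.norm_coe_le_norm _)
      (fun t ht => hasDerivWithinAt_of_linearOperator_eq hx t ht)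
      (fun t _ => by simpa using hasDerivWithinAt_const t _ (0 : Euc n)) h0
  have h2 : x.1.1 = 0 := halfLine_ext fun t ht => by rw [h1 t ht]; rfl
  have h3 : x.1.2 = 0 := by
    ext1 τ
    have := linearOperator_apply A x τ
    rw [hx, h2] at this
    simpa using this.symm
  exact Subtype.ext (Prod.ext h2 h3)

end VariableCoefficients

/-! ### The adjoint equation and decay by duality. -/

section Adjoint

variable {n : ℕ}

/-- The two terms containing `A` cancel and only the inhomogeneity survives. This identity yields
both the orthogonality relations and the Melnikov integral. -/
theorem hasDerivWithinAt_inner_adjoint {A : Euc n →L[ℝ] Euc n} {w y : ℝ → Euc n} {h : Euc n}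
    {s : Set ℝ} {t : ℝ}
    (hw : HasDerivWithinAt w (-(ContinuousLinearMap.adjoint A) (w t)) s t)
    (hy : HasDerivWithinAt y (A (y t) + h) s t) :
    HasDerivWithinAt (fun t => inner ℝ (w t) (y t)) (inner ℝ (w t) h) s t := by
  have := hw.inner ℝ hy
  simpa [inner_add_right, inner_neg_left, ContinuousLinearMap.adjoint_inner_left] using this

theorem eq_of_hasDerivWithinAt_zero {φ : ℝ → ℝ}
    (h : ∀ t, 0 ≤ t → HasDerivWithinAt φ 0 (Set.Ici 0) t) (t : ℝ) (ht : 0 ≤ t) : φ t = φ 0 := by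
  have := (convex_Ici (0 : ℝ)).norm_image_sub_le_of_norm_hasDerivWithin_le (f := φ)
    (f' := fun _ => 0) (C := 0) h (by simp) (Set.self_mem_Ici) ht
  simpa [sub_eq_zero] using this

/-- If `x' = A x` and `w' = -A^* w` on `[0, ∞)`, then `⟨w, x⟩` is constant; hence it vanishes if
`x` is convergent to `0` and `w` is bounded. -/
theorem inner_eq_zero_of_bounded {A : ℝ → Euc n →L[ℝ] Euc n} {w : ℝ → Euc n}
    (hw : ∀ t, 0 ≤ t →
      HasDerivWithinAt w (-(ContinuousLinearMap.adjoint (A t)) (w t)) (Set.Ici 0) t)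
    (hb : ∃ C, ∀ᶠ t in atTop, ‖w t‖ ≤ C) {v : Euc n} (hv : v ∈ decayingValues A) :
    inner ℝ (w 0) v = 0 := by
  obtain ⟨x, hx0, hx, hxt⟩ := hv
  obtain ⟨C, hC⟩ := hb
  have hconst : ∀ t, 0 ≤ t → inner ℝ (w t) (x t) = inner ℝ (w 0) (x 0) :=
    eq_of_hasDerivWithinAt_zero (φ := fun t => inner ℝ (w t) (x t)) fun t ht => by
      simpa using hasDerivWithinAt_inner_adjoint (h := 0) (hw t ht) (by simpa using hx t ht)
  rw [← hx0]
  have h1 : Tendsto (fun t => inner ℝ (w t) (x t)) atTop (𝓝 0) := by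
    refine squeeze_zero_norm' (a := fun t => C * ‖x t‖) ?_ (by simpa using hxt.norm.const_mul C)
    filter_upwards [hC] with t ht
    exact (norm_inner_le_norm _ _).trans (mul_le_mul_of_nonneg_right ht (norm_nonneg _))
  refine tendsto_nhds_unique (tendsto_const_nhds.congr' ?_) h1
  filter_upwards [eventually_ge_atTop 0] with t ht using (hconst t ht).symm

/-- The operator `y' - A y` has preimages bounded by a constant `C`. Pairing `w` with a preimage of
an approximation of `w / ‖w‖`, cut off after time `T`, turns the integral of `‖w‖` into the boundary
term `-⟨w(0), y(0)⟩`, which is at most `C ‖w(0)‖` independently of `T`. The orthogonality hypothesis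
removes the other boundary term. -/
theorem integral_norm_le_of_adjoint {A : C(HalfLine, Euc n →L[ℝ] Euc n)}
    (hA : IsHyperbolicMap (A OnePoint.infty)) {w : ℝ → Euc n}
    (hw : ∀ t, 0 ≤ t →
      HasDerivWithinAt w (-(ContinuousLinearMap.adjoint (A (atTime t))) (w t)) (Set.Ici 0) t)
    (h0 : ∀ v ∈ decayingValues fun t => A (atTime t), inner ℝ (w 0) v = 0) :
    ∃ C, ∀ T, 0 ≤ T → ∫ t in (0 : ℝ)..T, ‖w t‖ ≤ C := by
  obtain ⟨C, hC0, hC⟩ := (linearOperator A).exists_preimage_norm_le (linearOperator_surjective hA)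
  have hwc : ContinuousOn w (Set.Ici 0) := fun t ht => (hw t ht).continuousWithinAt
  refine ⟨C * ‖w 0‖, fun T hT => ?_⟩
  have key : ∀ ε > 0, ∫ t in (0 : ℝ)..T, ‖w t‖ ≤ C * ‖w 0‖ + ε * T := by
    intro ε hε
    -- The cutoff is `1` up to `T` and `0` after `T + 1`. The positive `ε` in the denominator of `h`
    -- keeps it continuous without knowing that `w` has no zeros.
    set χ : ℝ → ℝ := fun t => max 0 (min 1 (T + 1 - t)) with hχ
    have hχc : Continuous χ := by fun_prop
    have hχ0 : ∀ t, 0 ≤ χ t := fun t => le_max_left _ _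
    have hχ1 : ∀ t, χ t ≤ 1 := fun t => max_le zero_le_one (min_le_left _ _)
    have hχT : ∀ t, t ≤ T → χ t = 1 := fun t ht => by
      simp only [hχ]
      rw [min_eq_left (by linarith), max_eq_right zero_le_one]
    have hχT1 : ∀ t, T + 1 ≤ t → χ t = 0 := fun t ht => by
      simp only [hχ]
      rw [max_eq_left]
      exact (min_le_right _ _).trans (by linarith)
    have hpos : ∀ t, 0 < ε + ‖w t‖ := fun t => by positivity
    set h : ℝ → Euc n := fun t => (χ t / (ε + ‖w t‖)) • w t with hh
    have hhc : ContinuousOn h (Set.Ici 0) :=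
      (hχc.continuousOn.div (continuousOn_const.add hwc.norm) fun t _ => (hpos t).ne').smul hwc
    have hh0 : ∀ t, T + 1 ≤ t → h t = 0 := fun t ht => by simp [hh, hχT1 t ht]
    obtain ⟨H, hH, -⟩ := exists_halfLine_extension hhc (l := 0)
      (tendsto_const_nhds.congr' (by
        filter_upwards [eventually_ge_atTop (T + 1)] with t ht using (hh0 t ht).symm))
    have hHnorm : ‖H‖ ≤ 1 := norm_le_of_forall_atTime fun t ht => by
      rw [hH t ht, hh]
      simp only
      rw [norm_smul, Real.norm_of_nonneg (div_nonneg (hχ0 t) (hpos t).le), div_mul_eq_mul_div,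
        div_le_one (hpos t)]
      nlinarith [hχ1 t, hχ0 t, norm_nonneg (w t)]
    obtain ⟨x, hx, hxC⟩ := hC H
    have hx0 : ‖x.1.1 (atTime 0)‖ ≤ C :=
      ((x.1.1.norm_coe_le_norm _).trans (norm_fst_le x.1)).trans
        (hxC.trans (mul_le_of_le_one_right hC0.le hHnorm))
    have hxd := hasDerivWithinAt_of_linearOperator_eq hx
    have hT1 : 0 ≤ T + 1 := by linarith
    -- After `T + 1` the inhomogeneity vanishes, so `x` coincides there with a homogeneous solution
    -- `z` defined on all of `[0, ∞)`. Its initial value is a decaying one, hence orthogonal to `w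
    -- 0`, and `⟨w, z⟩` is constant.
    have hend : inner ℝ (w (T + 1)) (x.1.1 (atTime (T + 1))) = 0 := by
      have hbound : ∀ t, ‖A (atTime t)‖ ≤ ‖A‖ := fun t => A.norm_coe_le_norm _
      obtain ⟨z, hzT, hz⟩ := exists_linear_solution_inhomogeneous (continuous_comp_atTime A)
        hbound (continuous_const (y := (0 : Euc n))) (C := 0) (by simp) (T + 1)
        (x.1.1 (atTime (T + 1)))
      have heq := linear_eqOn_Ici (a := T + 1) (fun t _ => hbound t)
        (fun t _ => (hz t).hasDerivWithinAt)
        (fun t (ht : T + 1 ≤ t) => by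
          have h1 := (hxd t (hT1.trans ht)).mono (Set.Ici_subset_Ici.2 hT1)
          rwa [hH t (hT1.trans ht), hh0 t ht] at h1) hzT
      obtain ⟨y, hy, hyz, -⟩ := exists_linearOperator_eq (A := A) (H := 0)
        (fun t _ => (hz t).hasDerivWithinAt) (m := x.1.1 OnePoint.infty)
        ((tendsto_comp_atTime x.1.1).congr' (by
          filter_upwards [eventually_ge_atTop (T + 1)] with t ht using (heq t ht).symm))
      have h1 := h0 _ (mem_decayingValues_of_linearOperator_eq_zero hA hy)
      rw [hyz 0 le_rfl] at h1
      rw [← hzT, ← h1]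
      exact eq_of_hasDerivWithinAt_zero (φ := fun t => inner ℝ (w t) (z t)) (fun t ht => by
        simpa using hasDerivWithinAt_inner_adjoint (h := 0) (hw t ht) (hz t).hasDerivWithinAt)
        (T + 1) hT1
    have hφ : ∀ t, 0 ≤ t → HasDerivWithinAt (fun t => inner ℝ (w t) (x.1.1 (atTime t)))
        (inner ℝ (w t) (h t)) (Set.Ici 0) t := fun t ht => by
      have := hasDerivWithinAt_inner_adjoint (hw t ht) (hxd t ht)
      rwa [hH t ht] at this
    have hqc : ContinuousOn (fun t => inner ℝ (w t) (h t)) (Set.Ici 0) := hwc.inner hhc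
    have hint : ∀ a b, 0 ≤ a → 0 ≤ b →
        IntervalIntegrable (fun t => inner ℝ (w t) (h t)) volume a b := fun a b ha hb =>
      (hqc.mono fun t ht => (le_min ha hb).trans ht.1).intervalIntegrable
    have hftc := intervalIntegral.integral_eq_sub_of_hasDeriv_right_of_le hT1
      (fun t ht => ((hφ t ht.1).mono Set.Icc_subset_Ici_self).continuousWithinAt)
      (fun s hs => (hφ s hs.1.le).mono fun y hy => hs.1.le.trans (le_of_lt hy))
      (hint 0 (T + 1) le_rfl hT1)
    rw [hend, zero_sub] at hftc
    have hq : ∀ t, inner ℝ (w t) (h t) = χ t * (‖w t‖ ^ 2 / (ε + ‖w t‖)) := fun t => by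
      simp only [hh]
      rw [inner_smul_right, real_inner_self_eq_norm_sq]
      ring
    have hq0 : ∀ t, 0 ≤ inner ℝ (w t) (h t) := fun t => by
      rw [hq]
      exact mul_nonneg (hχ0 t) (div_nonneg (sq_nonneg _) (hpos t).le)
    have h1 : ∫ t in (0 : ℝ)..T, inner ℝ (w t) (h t) ≤ C * ‖w 0‖ := by
      have h2 := intervalIntegral.integral_add_adjacent_intervals (hint 0 T le_rfl hT)
        (hint T (T + 1) hT hT1)
      have h3 : 0 ≤ ∫ t in T..(T + 1), inner ℝ (w t) (h t) :=
        intervalIntegral.integral_nonneg (by linarith) fun t _ => hq0 t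
      have h4 : -inner ℝ (w 0) (x.1.1 (atTime 0)) ≤ C * ‖w 0‖ := by
        have := (abs_le.1 (abs_real_inner_le_norm (w 0) (x.1.1 (atTime 0)))).1
        nlinarith [norm_nonneg (w 0)]
      linarith
    -- Pointwise, `‖w‖ ≤ ‖w‖² / (ε + ‖w‖) + ε`.
    have h2 : ∫ t in (0 : ℝ)..T, ‖w t‖ ≤ ∫ t in (0 : ℝ)..T, (inner ℝ (w t) (h t) + ε) := by
      refine intervalIntegral.integral_mono_on hT
        ((hwc.norm.mono fun t ht => (le_min le_rfl hT).trans ht.1).intervalIntegrable)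
        ((hint 0 T le_rfl hT).add (by simp)) fun t ht => ?_
      rw [hq, hχT t ht.2, one_mul, div_add' _ _ _ (hpos t).ne', le_div_iff₀ (hpos t)]
      nlinarith [norm_nonneg (w t)]
    rw [intervalIntegral.integral_add (hint 0 T le_rfl hT) (by simp)] at h2
    simp only [intervalIntegral.integral_const, smul_eq_mul, sub_zero] at h2
    linarith
  refine le_of_forall_pos_le_add fun ε hε => ?_
  have h1 := key (ε / (T + 1)) (by positivity)
  have h2 : ε / (T + 1) * T ≤ ε := by
    rw [div_mul_eq_mul_div, div_le_iff₀ (by positivity)]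
    nlinarith
  linarith

/-- A solution of the adjoint equation on `[0, ∞)` whose initial value is orthogonal to the
initial values of the decaying solutions of `x' = A x` is integrable and tends to `0`. -/
theorem integrableOn_and_tendsto_of_adjoint {A : C(HalfLine, Euc n →L[ℝ] Euc n)}
    (hA : IsHyperbolicMap (A OnePoint.infty)) {w : ℝ → Euc n}
    (hw : ∀ t, 0 ≤ t →
      HasDerivWithinAt w (-(ContinuousLinearMap.adjoint (A (atTime t))) (w t)) (Set.Ici 0) t)
    (h0 : ∀ v ∈ decayingValues fun t => A (atTime t), inner ℝ (w 0) v = 0) :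
    IntegrableOn w (Set.Ioi 0) ∧ Tendsto w atTop (𝓝 0) := by
  obtain ⟨C, hC⟩ := integral_norm_le_of_adjoint hA hw h0
  have hwc : ContinuousOn w (Set.Ici 0) := fun t ht => (hw t ht).continuousWithinAt
  have hint : IntegrableOn w (Set.Ioi 0) := by
    refine integrableOn_Ioi_of_intervalIntegral_norm_bounded (l := atTop) (b := id) C 0
      (fun T => ?_) tendsto_id ((eventually_ge_atTop 0).mono fun T hT => hC T hT)
    exact ((hwc.mono Set.Icc_subset_Ici_self).integrableOn_compact isCompact_Icc).mono_set
      Set.Ioc_subset_Icc_self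
  refine ⟨hint, ?_⟩
  refine tendsto_zero_of_hasDerivAt_of_integrableOn_Ioi (a := 0)
    (fun t ht => (hw t (le_of_lt ht)).hasDerivAt (Ici_mem_nhds ht)) ?_ hint
  have hadj : Continuous fun t => -(ContinuousLinearMap.adjoint (A (atTime t))) :=
    (ContinuousLinearMap.adjoint.continuous.comp (continuous_comp_atTime A)).neg
  refine (hint.norm.const_mul ‖A‖).mono' ?_ (Eventually.of_forall fun t => ?_)
  · exact ((hadj.continuousOn.clm_apply hwc).mono Set.Ioi_subset_Ici_self).aestronglyMeasurable
      measurableSet_Ioi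
  · rw [norm_neg]
    refine (ContinuousLinearMap.adjoint (A (atTime t))).le_of_opNorm_le ?_ (w t)
    rw [LinearIsometryEquiv.norm_map]
    exact A.norm_coe_le_norm _

end Adjoint

/-! ### The smooth family of convergent orbits near `p`. -/

section StableFamily

variable {n k : ℕ}

/-- The space of the initial values of the solutions of the variational equation along `p` that
tend to `0`. -/
noncomputable abbrev stableSubspace (f : Euc n → Euc n) (p : ℝ → Euc n) : Submodule ℝ (Euc n) :=
  decayingValues fun t => fderiv ℝ f (p t)

/-- A parametrization `U (l, v)`, by a parameter `l` and an element `v` of the stable subspace,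
of the convergent solutions of `x' = F l x` on `[0, ∞)` that are close to `p`. -/
structure IsStableFamily (r : WithTop ℕ∞) (F : Euc k → Euc n → Euc n) (p : ℝ → Euc n)
    (U : Euc k × stableSubspace (F 0) p → C(HalfLine, Euc n)) : Prop where
  contDiffAt : ∀ᶠ z in 𝓝 0, ContDiffAt ℝ r U z
  zero : ∀ t, 0 ≤ t → U 0 (atTime t) = p t
  solves : ∀ᶠ z in 𝓝 0, SolvesOn (F z.1) (Set.Ici 0) fun t => U z (atTime t)
  unique : ∃ ε > 0, ∀ᶠ l in 𝓝 (0 : Euc k), ∀ (u : ℝ → Euc n) (m : Euc n),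
    SolvesOn (F l) (Set.Ici 0) u → Tendsto u atTop (𝓝 m) → (∀ t, 0 ≤ t → ‖u t - p t‖ ≤ ε) →
    ∀ t, 0 ≤ t →
      u t = U (l, (stableSubspace (F 0) p).orthogonalProjectionOnto (u 0 - p 0)) (atTime t)
  fderiv_apply_zero : ∀ v : stableSubspace (F 0) p, fderiv ℝ U 0 (0, v) (atTime 0) = v
  inner_fderiv : ∀ (l : Euc k) (w : ℝ → Euc n),
    (∀ t, 0 ≤ t → HasDerivWithinAt w (adjointCoeff (F 0) p t (w t)) (Set.Ici 0) t) →
    IntegrableOn w (Set.Ioi 0) → Tendsto w atTop (𝓝 0) →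
    IntegrableOn (fun s => inner ℝ (w s) (fderiv ℝ (fun m => F m (p s)) 0 l)) (Set.Ioi 0) ∧
    inner ℝ (w 0) (fderiv ℝ U 0 (l, 0) (atTime 0)) =
      -∫ s in Set.Ioi 0, inner ℝ (w s) (fderiv ℝ (fun m => F m (p s)) 0 l)

/-- The continuous map `τ ↦ (l, y τ)` as a function of `(l, y)`. -/
noncomputable def pairWithConst (k n : ℕ) :
    (Euc k × C(HalfLine, Euc n)) →L[ℝ] C(HalfLine, Euc k × Euc n) :=
  ContinuousLinearMap.compLeftContinuous ℝ HalfLine (ContinuousLinearMap.inl ℝ (Euc k) (Euc n)) ∘L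
      (ContinuousLinearMap.const ℝ HalfLine) ∘L ContinuousLinearMap.fst ℝ _ _ +
    ContinuousLinearMap.compLeftContinuous ℝ HalfLine
      (ContinuousLinearMap.inr ℝ (Euc k) (Euc n)) ∘L ContinuousLinearMap.snd ℝ _ _

theorem pairWithConst_apply (z : Euc k × C(HalfLine, Euc n)) (τ : HalfLine) :
    pairWithConst k n z τ = (z.1, z.2 τ) := by
  change ((z.1, 0) : Euc k × Euc n) + (0, z.2 τ) = _
  simp

-- This is the implicit function theorem applied to the differential equation together with the
-- prescribed `Es`-component of the initial displacement. The linearization in the unknown is `y ↦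
-- (y' - A y, π (y(0)))`, where `π` is the orthogonal projection onto `Es`. It is bijective because
-- the first component is surjective and its kernel is parametrized by `Es` through the initial
-- value.
set_option maxHeartbeats 1600000 in
theorem exists_stableFamily {r : ℕ∞} (hr : 1 ≤ r) {F : Euc k → Euc n → Euc n}
    (hF : ContDiff ℝ r fun y : Euc k × Euc n => F y.1 y.2) {q : Euc n}
    (hq : IsHyperbolicMap (fderiv ℝ (F 0) q)) {p : ℝ → Euc n} (hp : IsStableOrbit (F 0) q 0 p) :
    ∃ U, IsStableFamily r F p U := by
  have hr1 : (1 : WithTop ℕ∞) ≤ (r : WithTop ℕ∞) := by exact_mod_cast hr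
  have hr0 : (r : WithTop ℕ∞) ≠ 0 := fun h => by simp [h] at hr1
  set G : Euc k × Euc n → Euc n := fun y => F y.1 y.2 with hG
  have hdG : ∀ y, HasFDerivAt G (fderiv ℝ G y) y := fun y =>
    ((hF.differentiable hr0) y).hasFDerivAt
  have hdGc : Continuous (fderiv ℝ G) := hF.continuous_fderiv hr0
  obtain ⟨P, hP, hPq⟩ := exists_halfLine_extension
    (fun t ht => (hp.1 t ht).continuousWithinAt) hp.2
  have hFx : ∀ x, fderiv ℝ (F 0) x = fderiv ℝ G (0, x) ∘L ContinuousLinearMap.inr ℝ _ _ := by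
    intro x
    have h1 : HasFDerivAt (fun x : Euc n => ((0 : Euc k), x))
        (ContinuousLinearMap.inr ℝ (Euc k) (Euc n)) x :=
      (hasFDerivAt_const (0 : Euc k) x).prodMk (hasFDerivAt_id x)
    exact ((hdG (0, x)).comp x h1).fderiv
  have hFl : ∀ x, fderiv ℝ (fun m => F m x) 0 =
      fderiv ℝ G (0, x) ∘L ContinuousLinearMap.inl ℝ _ _ := by
    intro x
    have h1 : HasFDerivAt (fun m : Euc k => (m, x))
        (ContinuousLinearMap.inl ℝ (Euc k) (Euc n)) 0 :=
      (hasFDerivAt_id (0 : Euc k)).prodMk (hasFDerivAt_const x (0 : Euc k))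
    exact ((hdG (0, x)).comp (0 : Euc k) h1).fderiv
  -- the superposition operator and its derivative
  set N : Euc k × C(HalfLine, Euc n) → C(HalfLine, Euc n) := fun z =>
    (⟨G, hF.continuous⟩ : C(Euc k × Euc n, Euc n)).comp (pairWithConst k n z) with hN
  have hNapp : ∀ z τ, N z τ = F z.1 (z.2 τ) := fun z τ => by
    change G (pairWithConst k n z τ) = _
    rw [pairWithConst_apply]
  have hNc : ContDiff ℝ r N := (contDiff_postcomp hF).comp (pairWithConst k n).contDiff
  set D : C(HalfLine, (Euc k × Euc n) →L[ℝ] Euc n) :=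
    (⟨fderiv ℝ G, hdGc⟩ : C(Euc k × Euc n, (Euc k × Euc n) →L[ℝ] Euc n)).comp
      (pairWithConst k n (0, P)) with hD
  have hDapp : ∀ τ, D τ = fderiv ℝ G (0, P τ) := fun τ => by
    change fderiv ℝ G (pairWithConst k n (0, P) τ) = _
    rw [pairWithConst_apply]
  have hNd : HasFDerivAt N (pointwiseApply _ _ _ D ∘L pairWithConst k n) (0, P) :=
    (hasFDerivAt_postcomp hF.continuous hdGc hdG (pairWithConst k n (0, P))).comp _
      (pairWithConst k n).hasFDerivAt
  set A : C(HalfLine, Euc n →L[ℝ] Euc n) :=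
    ⟨fun τ => D τ ∘L ContinuousLinearMap.inr ℝ (Euc k) (Euc n),
      D.continuous.clm_comp continuous_const⟩ with hA
  have hAapp : ∀ τ, A τ = fderiv ℝ (F 0) (P τ) := fun τ => by
    change D τ ∘L _ = _
    rw [hDapp, hFx]
  have hAt : ∀ t, 0 ≤ t → A (atTime t) = fderiv ℝ (F 0) (p t) := fun t ht => by
    rw [hAapp, hP t ht]
  have hAhyp : IsHyperbolicMap (A OnePoint.infty) := by rwa [hAapp, hPq]
  have hEs : decayingValues (fun t => A (atTime t)) = stableSubspace (F 0) p := by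
    have : ∀ A B : ℝ → Euc n →L[ℝ] Euc n, (∀ t, 0 ≤ t → A t = B t) →
        decayingValues A ≤ decayingValues B := by
      rintro A B hAB v ⟨x, hx0, hx, hxt⟩
      exact ⟨x, hx0, fun t ht => by rw [← hAB t ht]; exact hx t ht, hxt⟩
    exact le_antisymm (this _ _ hAt) (this _ _ fun t ht => (hAt t ht).symm)
  set Es := stableSubspace (F 0) p with hEsdef
  set π := Es.orthogonalProjectionOnto with hπ
  have hπmem : ∀ {v}, v ∈ Es → ((π v : Es) : Euc n) = v := fun {v} hv =>
    congrArg Subtype.val (Es.orthogonalProjectionOnto_mem_subspace_eq_self ⟨v, hv⟩)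
  -- the equation
  let X := c1HalfLine (Euc n)
  let e0 : C(HalfLine, Euc n) →L[ℝ] Euc n := ContinuousMap.evalCLM ℝ (atTime 0)
  let fstX : X →L[ℝ] C(HalfLine, Euc n) := ContinuousLinearMap.fst ℝ _ _ ∘L X.subtypeL
  let sndX : X →L[ℝ] C(HalfLine, Euc n) := ContinuousLinearMap.snd ℝ _ _ ∘L X.subtypeL
  let ι : ((Euc k × Es) × X) →L[ℝ] Euc k × C(HalfLine, Euc n) :=
    (ContinuousLinearMap.fst ℝ _ _ ∘L ContinuousLinearMap.fst ℝ _ _).prod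
      (fstX ∘L ContinuousLinearMap.snd ℝ _ _)
  -- Only the projection of the initial displacement onto `Es` is prescribed; convergence at
  -- infinity determines the rest.
  let Θ : (Euc k × Es) × X → C(HalfLine, Euc n) × Es := fun z =>
    (sndX z.2 - N (ι z), π (e0 (fstX z.2) - p 0) - z.1.2)
  have hxp : (P, N (0, P)) ∈ X := mem_c1HalfLine_iff.2 fun t ht => by
    rw [hNapp]
    have := (hp.1 t ht).congr hP (hP t ht)
    simpa [hP t ht] using this
  let xp : X := ⟨(P, N (0, P)), hxp⟩
  have hΘc : ContDiff ℝ r Θ := by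
    refine ((sndX.contDiff.comp contDiff_snd).sub (hNc.comp ι.contDiff)).prodMk ?_
    exact (π.contDiff.comp ((e0.contDiff.comp (fstX.contDiff.comp contDiff_snd)).sub
      contDiff_const)).sub (contDiff_snd.comp contDiff_fst)
  have hιp : ι (0, xp) = (0, P) := rfl
  have hΘ0 : Θ (0, xp) = 0 := by
    have h1 : e0 (fstX xp) - p 0 = 0 := by
      change P (atTime 0) - p 0 = 0
      rw [hP 0 le_rfl, sub_self]
    refine Prod.ext ?_ ?_
    · change N (0, P) - N (ι (0, xp)) = 0
      rw [hιp, sub_self]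
    · change π (e0 (fstX xp) - p 0) - 0 = 0
      rw [h1, map_zero, sub_zero]
  let Θ' : ((Euc k × Es) × X) →L[ℝ] C(HalfLine, Euc n) × Es :=
    (sndX ∘L ContinuousLinearMap.snd ℝ _ _ -
      (pointwiseApply _ _ _ D ∘L pairWithConst k n) ∘L ι).prod
    (π ∘L e0 ∘L fstX ∘L ContinuousLinearMap.snd ℝ _ _ -
      ContinuousLinearMap.snd ℝ _ _ ∘L ContinuousLinearMap.fst ℝ _ _)
  have hΘd : HasFDerivAt Θ Θ' (0, xp) := by
    refine HasFDerivAt.prodMk ?_ ?_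
    · refine (sndX.hasFDerivAt.comp _ hasFDerivAt_snd).sub ?_
      exact HasFDerivAt.comp (0, xp) (g := N) (f := ι) (by rw [hιp]; exact hNd) ι.hasFDerivAt
    · have h1 : HasFDerivAt (fun z : (Euc k × Es) × X => e0 (fstX z.2) - p 0)
          (e0 ∘L fstX ∘L ContinuousLinearMap.snd ℝ _ _) (0, xp) :=
        HasFDerivAt.sub_const (f := fun z : (Euc k × Es) × X => e0 (fstX z.2)) (p 0)
          (e0 ∘L fstX ∘L ContinuousLinearMap.snd ℝ (Euc k × Es) X).hasFDerivAt
      exact (π.hasFDerivAt.comp _ h1).sub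
        (HasFDerivAt.comp (0, xp) (g := Prod.snd) hasFDerivAt_snd hasFDerivAt_fst)
  have hΘ'1 : ∀ (l : Euc k) (v : Es) (x : X) (τ : HalfLine), (Θ' ((l, v), x)).1 τ =
      linearOperator A x τ - fderiv ℝ (fun m => F m (P τ)) 0 l := by
    intro l v x τ
    change x.1.2 τ - D τ (pairWithConst k n (l, x.1.1) τ) = (x.1.2 τ - D τ (0, x.1.1 τ)) - _
    rw [pairWithConst_apply, hFl, ← hDapp]
    have : D τ (l, x.1.1 τ) = D τ (0, x.1.1 τ) + D τ (l, 0) := by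
      rw [← map_add]
      simp
    rw [this]
    change _ = _ - D τ (l, 0)
    abel
  have hΘ'2 : ∀ (l : Euc k) (v : Es) (x : X),
      (Θ' ((l, v), x)).2 = π (x.1.1 (atTime 0)) - v := fun l v x => rfl
  have hΘ'lin : ∀ (v : Es) (x : X), (Θ' ((0, v), x)).1 = linearOperator A x := fun v x => by
    ext1 τ
    rw [hΘ'1, map_zero, sub_zero]
  have hinj : ∀ x, fderiv ℝ Θ (0, xp) (0, x) = 0 → x = 0 := by
    intro x hx
    rw [hΘd.fderiv] at hx
    have h1 : linearOperator A x = 0 := by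
      rw [← hΘ'lin 0 x]
      exact congrArg Prod.fst hx
    have h2 : π (x.1.1 (atTime 0)) = 0 := by
      have : (Θ' ((0, 0), x)).2 = 0 := congrArg Prod.snd hx
      rwa [hΘ'2, sub_zero] at this
    have h3 := mem_decayingValues_of_linearOperator_eq_zero hAhyp h1
    rw [hEs] at h3
    refine eq_zero_of_linearOperator_eq_zero h1 ?_
    rw [← hπmem h3, h2]
    rfl
  have hsurj : ∀ y, ∃ x, fderiv ℝ Θ (0, xp) (0, x) = y := by
    rintro ⟨H, v⟩
    obtain ⟨x, hx⟩ := linearOperator_surjective hAhyp H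
    -- Any solution of the inhomogeneous equation is corrected by a decaying homogeneous solution,
    -- which adjusts the `Es`-component of its initial value to `v`.
    obtain ⟨y, hy, hyv⟩ := exists_linearOperator_eq_zero (A := A)
      (v := ((v - π (x.1.1 (atTime 0)) : Es) : Euc n)) (by rw [hEs]; exact Subtype.mem _)
    refine ⟨x + y, ?_⟩
    rw [hΘd.fderiv]
    refine Prod.ext ?_ ?_
    · rw [show ((0 : Euc k × Es), x + y) = (((0 : Euc k), (0 : Es)), x + y) from rfl, hΘ'lin,
        map_add, hx, hy, add_zero]
    · change π (x.1.1 (atTime 0) + y.1.1 (atTime 0)) - 0 = v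
      rw [map_add, hyv, sub_zero]
      have : π ((v - π (x.1.1 (atTime 0)) : Es) : Euc n) = v - π (x.1.1 (atTime 0)) :=
        Es.orthogonalProjectionOnto_mem_subspace_eq_self _
      rw [this, add_sub_cancel]
  obtain ⟨φ, hφ0, hφc, hφiff, hφsol⟩ := exists_implicit hr0 (a := (0 : Euc k × Es)) (b := xp)
    (Eventually.of_forall fun _ => hΘc.contDiffAt) hΘ0 hinj hsurj
  have hφd : HasFDerivAt φ (fderiv ℝ φ 0) 0 :=
    (hφc.self_of_nhds.differentiableAt hr0).hasFDerivAt
  -- Differentiating `Θ (z, φ z) = 0` at the origin gives the variational equation for the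
  -- derivative of the family.
  have hlin : ∀ z, Θ' (z, fderiv ℝ φ 0 z) = 0 := by
    have h1 : HasFDerivAt (fun z => Θ (z, φ z))
        (Θ' ∘L (ContinuousLinearMap.id ℝ _).prod (fderiv ℝ φ 0)) 0 :=
      HasFDerivAt.comp (0 : Euc k × Es) (g := Θ) (f := fun z => (z, φ z))
        (by rw [hφ0]; exact hΘd) ((hasFDerivAt_id _).prodMk hφd)
    have h2 : HasFDerivAt (fun z => Θ (z, φ z)) (0 : (Euc k × Es) →L[ℝ] _) 0 :=
      (hasFDerivAt_const (0 : C(HalfLine, Euc n) × Es) (0 : Euc k × Es)).congr_of_eventuallyEq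
        hφsol
    intro z
    exact DFunLike.congr_fun (h1.unique h2) z
  have hUd : fderiv ℝ (fun z => fstX (φ z)) 0 = fstX ∘L fderiv ℝ φ 0 :=
    (fstX.hasFDerivAt.comp _ hφd).fderiv
  refine ⟨fun z => fstX (φ z), ?_, ?_, ?_, ?_, ?_, ?_⟩
  · filter_upwards [hφc] with z hz using fstX.contDiff.contDiffAt.comp z hz
  · intro t ht
    simp only [hφ0]
    exact hP t ht
  · filter_upwards [hφsol] with z hz t ht
    have h1 := mem_c1HalfLine_iff.1 (φ z).2 t ht
    have h2 : (φ z).1.2 = N (z.1, (φ z).1.1) := sub_eq_zero.1 (congrArg Prod.fst hz)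
    rw [h2, hNapp] at h1
    exact h1
  · have hemb : 𝓝 ((0 : Euc k × Es), xp) = comap (Prod.map id Subtype.val)
        (𝓝 ((0 : Euc k × Es), (P, N (0, P)))) :=
      ((IsEmbedding.id.prodMap IsEmbedding.subtypeVal).isInducing.nhds_eq_comap _)
    rw [hemb, eventually_comap] at hφiff
    -- Local uniqueness holds for pairs `(y, y')`, whereas only uniform closeness of `y` is assumed.
    -- For a solution the second entry is `N (l, y)`, which is continuous in `(l, y)`, so closeness
    -- of `y` suffices.
    have hcont : Continuous fun z : Euc k × C(HalfLine, Euc n) =>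
        (((z.1, π (e0 z.2 - p 0)) : Euc k × Es), (z.2, N z)) := by
      have := hNc.continuous
      fun_prop
    have h0 : (((0 : Euc k), π (e0 P - p 0)) : Euc k × Es) = 0 := by
      have h1 : e0 P - p 0 = 0 := by
        change P (atTime 0) - p 0 = 0
        rw [hP 0 le_rfl, sub_self]
      rw [h1, map_zero]
      rfl
    have hev := (hcont.tendsto (0, P)).eventually (by
      simp only
      rw [h0]
      exact hφiff)
    rw [nhds_prod_eq] at hev
    obtain ⟨pa, hpa, pb, hpb, hab⟩ := eventually_prod_iff.1 hev
    obtain ⟨ε, hε, hball⟩ := Metric.mem_nhds_iff.1 hpb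
    refine ⟨ε / 2, by positivity, ?_⟩
    filter_upwards [hpa] with l hl u m hu hum hclose
    obtain ⟨Y, hY, -⟩ := exists_halfLine_extension
      (fun t ht => (hu t ht).continuousWithinAt) hum
    have hYball : Y ∈ Metric.ball P ε := by
      rw [mem_ball_iff_norm]
      refine lt_of_le_of_lt (norm_le_of_forall_atTime fun t ht => ?_) (half_lt_self hε)
      rw [ContinuousMap.sub_apply, hY t ht, hP t ht]
      exact hclose t ht
    have hYX : (Y, N (l, Y)) ∈ X := mem_c1HalfLine_iff.2 fun t ht => by
      rw [hNapp]
      have := (hu t ht).congr hY (hY t ht)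
      simpa [hY t ht] using this
    have h2 := (hab hl (hball hYball) ((l, π (e0 Y - p 0)), ⟨(Y, N (l, Y)), hYX⟩) rfl).1 (by
      refine Prod.ext ?_ ?_
      · exact sub_self _
      · exact sub_self _)
    intro t ht
    have h3 : e0 Y = u 0 := hY 0 le_rfl
    rw [← hY t ht, ← h3]
    exact congrArg (fun x : X => x.1.1 (atTime t)) h2
  · intro v
    rw [hUd]
    have h1 := hlin (0, v)
    set x := fderiv ℝ φ 0 (0, v) with hx
    have h2 : linearOperator A x = 0 := by
      rw [← hΘ'lin v x, h1]
      rfl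
    have h3 := mem_decayingValues_of_linearOperator_eq_zero hAhyp h2
    rw [hEs] at h3
    have h4 : π (x.1.1 (atTime 0)) - v = 0 := by
      rw [← hΘ'2 0 v x, h1]
      rfl
    change x.1.1 (atTime 0) = v
    rw [← hπmem h3, sub_eq_zero.1 h4]
  · intro l w hw hwint hwt
    rw [hUd]
    have h1 := hlin (l, 0)
    set x := fderiv ℝ φ 0 (l, 0) with hx
    have hxA : ∀ τ, linearOperator A x τ = fderiv ℝ (fun m => F m (P τ)) 0 l := fun τ => by
      have := hΘ'1 l 0 x τ
      rw [h1] at this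
      exact (sub_eq_zero.1 this.symm)
    have hxd := hasDerivWithinAt_of_linearOperator_eq (rfl : linearOperator A x = _)
    have hpair : ∀ t, 0 ≤ t → HasDerivWithinAt (fun t => inner ℝ (w t) (x.1.1 (atTime t)))
        (inner ℝ (w t) (fderiv ℝ (fun m => F m (p t)) 0 l)) (Set.Ici 0) t := by
      intro t ht
      have h2 := hasDerivWithinAt_inner_adjoint (A := A (atTime t)) (w := w)
        (by rw [hAt t ht]; exact hw t ht) (hxd t ht)
      rwa [hxA, hP t ht] at h2
    have hint : IntegrableOn (fun s => inner ℝ (w s) (fderiv ℝ (fun m => F m (p s)) 0 l))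
        (Set.Ioi 0) := by
      have hwc : ContinuousOn w (Set.Ici 0) := fun t ht => (hw t ht).continuousWithinAt
      have h2 : IntegrableOn (fun s => inner ℝ (w s) (linearOperator A x (atTime s)))
          (Set.Ioi 0) := by
        refine (hwint.norm.mul_const ‖linearOperator A x‖).mono' ?_
          (Eventually.of_forall fun s => ?_)
        · exact ((hwc.inner (continuous_comp_atTime (linearOperator A x)).continuousOn).mono
            Set.Ioi_subset_Ici_self).aestronglyMeasurable measurableSet_Ioi
        · exact (norm_inner_le_norm _ _).trans (mul_le_mul_of_nonneg_left
            ((linearOperator A x).norm_coe_le_norm _) (norm_nonneg _))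
      refine h2.congr_fun (fun s hs => ?_) measurableSet_Ioi
      simp only
      rw [hxA, hP s (le_of_lt hs)]
    refine ⟨hint, ?_⟩
    -- The decay of `w` removes the boundary term at infinity, so the integral of the derivative of
    -- `⟨w, x⟩` is minus its value at `0`.
    have hlim : Tendsto (fun t => inner ℝ (w t) (x.1.1 (atTime t))) atTop (𝓝 0) := by
      simpa using hwt.inner (𝕜 := ℝ) (tendsto_comp_atTime x.1.1)
    have h5 := integral_Ioi_of_hasDerivAt_of_tendsto (a := 0)
      ((hpair 0 le_rfl).continuousWithinAt)
      (fun t ht => (hpair t (le_of_lt ht)).hasDerivAt (Ici_mem_nhds ht)) hint hlim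
    rw [h5]
    change inner ℝ (w 0) (x.1.1 (atTime 0)) = _
    ring

end StableFamily

/-! ### Openness of hyperbolicity and continuation of equilibria. -/

section Equilibria

variable {n k : ℕ}

theorem continuous_complexMatrix :
    Continuous (complexMatrix : (Euc n →L[ℝ] Euc n) → Matrix (Fin n) (Fin n) ℂ) := by
  refine continuous_matrix fun i j => ?_
  have h1 : Continuous fun A : Euc n →L[ℝ] Euc n => A (EuclideanSpace.single j 1) i := by
    fun_prop
  refine (Complex.continuous_ofReal.comp h1).congr fun A => ?_
  simp [complexMatrix, LinearMap.toMatrix_apply]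

/-- Hyperbolicity is an open condition. -/
theorem IsHyperbolicMap.eventually {A : Euc n →L[ℝ] Euc n} (hA : IsHyperbolicMap A) :
    ∀ᶠ B in 𝓝 A, IsHyperbolicMap B := by
  -- The imaginary axis is not compact, so the determinant is homogenized to `det (i a - b B)`, with
  -- `(a, b)` on the unit sphere. Points with `b ≠ 0` represent the axis; at `b = 0` the determinant
  -- is `(i a)^n ≠ 0`. Compactness of the sphere then gives openness.
  set g : (Euc n →L[ℝ] Euc n) × (ℝ × ℝ) → ℂ := fun y =>
    (Matrix.scalar (Fin n) ((y.2.1 : ℂ) * Complex.I) - (y.2.2 : ℂ) • complexMatrix y.1).det with hg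
  have hgc : Continuous g := by
    have h1 := (continuous_complexMatrix (n := n))
    refine Continuous.matrix_det ?_
    refine Continuous.sub ?_ ?_
    · have : Continuous fun z : ℂ => Matrix.scalar (Fin n) z := by
        refine continuous_matrix fun i j => ?_
        by_cases h : i = j
        · subst h
          simpa using continuous_id'
        · simpa [Matrix.diagonal_apply_ne _ h] using continuous_const
      exact this.comp (by fun_prop)
    · exact (Complex.continuous_ofReal.comp (by fun_prop)).smul (h1.comp continuous_fst)
  have hscale : ∀ (B : Euc n →L[ℝ] Euc n) (a b : ℝ), b ≠ 0 → g (B, (a, b)) =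
      (b : ℂ) ^ n * (Matrix.scalar (Fin n) (((a / b : ℝ) : ℂ) * Complex.I) -
        complexMatrix B).det := by
    intro B a b hb
    have hb' : (b : ℂ) ≠ 0 := by exact_mod_cast hb
    have h1 : Matrix.scalar (Fin n) ((a : ℂ) * Complex.I) - (b : ℂ) • complexMatrix B =
        (b : ℂ) • (Matrix.scalar (Fin n) (((a / b : ℝ) : ℂ) * Complex.I) - complexMatrix B) := by
      rw [smul_sub]
      congr 1
      ext i j
      simp only [Matrix.scalar_apply, Matrix.smul_apply, Matrix.diagonal_apply, smul_eq_mul]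
      split_ifs
      · push_cast
        field_simp
      · simp
    simp only [hg]
    rw [h1, Matrix.det_smul, Fintype.card_fin]
  have hne : ∀ y ∈ Metric.sphere (0 : ℝ × ℝ) 1, g (A, y) ≠ 0 := by
    rintro ⟨a, b⟩ hy
    by_cases hb : b = 0
    · subst hb
      have ha : a ≠ 0 := by
        rintro rfl
        simp at hy
      simp only [hg, Complex.ofReal_zero, zero_smul, sub_zero]
      rw [Matrix.scalar_apply, Matrix.det_diagonal, Finset.prod_const]
      exact pow_ne_zero _ (mul_ne_zero (by exact_mod_cast ha) Complex.I_ne_zero)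
    · rw [hscale A a b hb]
      refine mul_ne_zero (pow_ne_zero _ (by exact_mod_cast hb)) fun h0 => ?_
      rw [← aeval_charpoly_eq_det] at h0
      exact hA _ h0 (by simp)
  have hev : ∀ᶠ B in 𝓝 A, ∀ y ∈ Metric.sphere (0 : ℝ × ℝ) 1, g (B, y) ≠ 0 :=
    (isCompact_sphere (0 : ℝ × ℝ) 1).eventually_forall_of_forall_eventually fun y hy =>
      (hgc.tendsto (A, y)).eventually_ne (hne y hy)
  filter_upwards [hev] with B hB z hz hre
  rw [aeval_charpoly_eq_det] at hz
  -- The sphere in `ℝ × ℝ` is that of the maximum norm, so `ρ` normalizes `(Im z, 1)`.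
  set ρ := max |z.im| 1 with hρ
  have hρ0 : 0 < ρ := lt_of_lt_of_le one_pos (le_max_right _ _)
  have hz' : z = ((z.im / ρ / (1 / ρ) : ℝ) : ℂ) * Complex.I := by
    have : z.im / ρ / (1 / ρ) = z.im := by field_simp
    rw [this]
    apply Complex.ext <;> simp [hre]
  refine hB (z.im / ρ, 1 / ρ) ?_ ?_
  · rw [mem_sphere_zero_iff_norm, Prod.norm_def]
    simp only [Real.norm_eq_abs, abs_div, abs_of_pos hρ0, abs_one]
    rw [max_div_div_right hρ0.le, ← hρ, div_self hρ0.ne']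
  · rw [hscale _ _ _ (by positivity), ← hz', hz, mul_zero]

theorem IsHyperbolicEquilibrium.isHyperbolicMap {f : Euc n → Euc n} {q : Euc n}
    (h : IsHyperbolicEquilibrium f q) : IsHyperbolicMap (fderiv ℝ f q) := h.2

/-- Hyperbolic equilibria have continuations, and these are locally unique. -/
theorem exists_continuation {r : ℕ∞} (hr : 1 ≤ r) {F : Euc k → Euc n → Euc n}
    (hF : ContDiff ℝ r fun y : Euc k × Euc n => F y.1 y.2) {q : Euc n}
    (hq : IsHyperbolicEquilibrium (F 0) q) :
    ∃ Q : Euc k → Euc n, IsContinuation F q Q ∧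
      ∀ᶠ y in 𝓝 ((0 : Euc k), q), F y.1 y.2 = 0 ↔ y.2 = Q y.1 := by
  have hr1 : (1 : WithTop ℕ∞) ≤ (r : WithTop ℕ∞) := by exact_mod_cast hr
  have hr0 : (r : WithTop ℕ∞) ≠ 0 := fun h => by simp [h] at hr1
  set G : Euc k × Euc n → Euc n := fun y => F y.1 y.2 with hG
  have hdG : ∀ y, HasFDerivAt G (fderiv ℝ G y) y := fun y =>
    ((hF.differentiable hr0) y).hasFDerivAt
  have hFx : ∀ l x, fderiv ℝ (F l) x = fderiv ℝ G (l, x) ∘L ContinuousLinearMap.inr ℝ _ _ := by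
    intro l x
    have h1 : HasFDerivAt (fun x : Euc n => (l, x))
        (ContinuousLinearMap.inr ℝ (Euc k) (Euc n)) x :=
      (hasFDerivAt_const l x).prodMk (hasFDerivAt_id x)
    exact ((hdG (l, x)).comp x h1).fderiv
  have happ : ∀ x, fderiv ℝ G (0, q) (0, x) = fderiv ℝ (F 0) q x := fun x => by
    rw [hFx]
    rfl
  have hinj := hq.isHyperbolicMap.injective
  have hsurj : Function.Surjective (fderiv ℝ (F 0) q) :=
    LinearMap.surjective_of_injective (f := (fderiv ℝ (F 0) q).toLinearMap) hinj
  obtain ⟨Q, hQ0, hQc, hQiff, hQsol⟩ := exists_implicit hr0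
    (Eventually.of_forall fun _ => hF.contDiffAt) hq.1
    (fun x hx => by
      rw [happ] at hx
      exact hinj (by rw [hx, map_zero]))
    (fun y => by
      obtain ⟨x, hx⟩ := hsurj y
      exact ⟨x, by rw [happ, hx]⟩)
  have hQcont : ContinuousAt Q 0 := hQc.self_of_nhds.continuousAt
  refine ⟨Q, ⟨hQ0, hQcont, ?_⟩, hQiff⟩
  have hc : ContinuousAt (fun l => fderiv ℝ (F l) (Q l)) 0 := by
    simp only [hFx]
    exact ((hF.continuous_fderiv hr0).continuousAt.comp
      (continuousAt_id.prodMk hQcont)).clm_comp continuousAt_const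
  have hhyp : IsHyperbolicMap (fderiv ℝ (F 0) (Q 0)) := by
    rw [hQ0]
    exact hq.isHyperbolicMap
  filter_upwards [hQsol, hc.eventually hhyp.eventually] with l h1 h2 using ⟨h1, h2⟩

/-- Continuity at `0` alone places `(l, P l)` in the region where the equilibrium is unique.
Arbitrary continuations may therefore be replaced by the one from the implicit function theorem. -/
theorem IsContinuation.eventuallyEq {F : Euc k → Euc n → Euc n} {q : Euc n} {P Q : Euc k → Euc n}
    (hP : IsContinuation F q P)
    (hQ : ∀ᶠ y in 𝓝 ((0 : Euc k), q), F y.1 y.2 = 0 ↔ y.2 = Q y.1) : P =ᶠ[𝓝 0] Q := by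
  have h1 : Tendsto (fun l => (l, P l)) (𝓝 0) (𝓝 ((0 : Euc k), q)) := by
    have := continuousAt_id.prodMk hP.continuousAt
    rw [← hP.zero]
    exact this
  filter_upwards [h1.eventually hQ, hP.hyperbolic] with l h2 h3 using h2.1 h3.1

/-- The limit of a convergent solution is an equilibrium. -/
theorem eq_zero_of_tendsto_of_solvesOn {f : Euc n → Euc n} (hf : Continuous f) {u : ℝ → Euc n}
    (hu : SolvesOn f (Set.Ici 0) u) {m : Euc n} (hm : Tendsto u atTop (𝓝 m)) : f m = 0 := by
  obtain ⟨U, hU, hUm⟩ := exists_halfLine_extension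
    (fun t ht => (hu t ht).continuousWithinAt) hm
  have hX : (U, (⟨f, hf⟩ : C(Euc n, Euc n)).comp U) ∈ c1HalfLine (Euc n) :=
    mem_c1HalfLine_iff.2 fun t ht => by
      have := (hu t ht).congr hU (hU t ht)
      simpa [hU t ht] using this
  have := c1HalfLine_snd_infty hX
  rw [← hUm]
  exact this

theorem exists_bound_of_solvesOn {f : Euc n → Euc n} {u : ℝ → Euc n}
    (hu : SolvesOn f (Set.Ici 0) u) {m : Euc n} (hm : Tendsto u atTop (𝓝 m)) :
    ∃ R, ∀ t, 0 ≤ t → ‖u t‖ ≤ R := by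
  obtain ⟨U, hU, -⟩ := exists_halfLine_extension
    (fun t ht => (hu t ht).continuousWithinAt) hm
  exact ⟨‖U‖, fun t ht => by rw [← hU t ht]; exact U.norm_coe_le_norm _⟩

/-- Convergent solutions on `[0, ∞)` are determined by their initial values. -/
theorem IsStableOrbit.eq_of_eq_zero {f : Euc n → Euc n} (hf : ContDiff ℝ 1 f) {q q' : Euc n}
    {u v : ℝ → Euc n} (hu : IsStableOrbit f q 0 u) (hv : IsStableOrbit f q' 0 v)
    (h0 : u 0 = v 0) : ∀ t, 0 ≤ t → u t = v t := by
  obtain ⟨R, hR⟩ := exists_bound_of_solvesOn hu.1 hu.2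
  obtain ⟨R', hR'⟩ := exists_bound_of_solvesOn hv.1 hv.2
  obtain ⟨K, hK⟩ := (hf.contDiffOn (s := Metric.closedBall 0 (max R R'))).exists_lipschitzOnWith
    one_ne_zero (convex_closedBall _ _) (isCompact_closedBall _ _)
  exact eqOn_Ici_of_hasDerivWithinAt (v := fun _ => f) (fun _ _ => hK) hu.1
    (fun t ht => mem_closedBall_zero_iff.2 ((hR t ht).trans (le_max_left _ _))) hv.1
    (fun t ht => mem_closedBall_zero_iff.2 ((hR' t ht).trans (le_max_right _ _))) h0

end Equilibria

/-! ### The tangent space of the stable manifold. -/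

section StableTangent

variable {n k : ℕ}

namespace IsStableFamily

variable {r : WithTop ℕ∞} {F : Euc k → Euc n → Euc n} {p : ℝ → Euc n}
  {U : Euc k × stableSubspace (F 0) p → C(HalfLine, Euc n)}

theorem hasFDerivAt (hU : IsStableFamily r F p U) (hr : r ≠ 0) :
    HasFDerivAt U (fderiv ℝ U 0) 0 :=
  (hU.contDiffAt.self_of_nhds.differentiableAt hr).hasFDerivAt

theorem eventually_norm_sub_le (hU : IsStableFamily r F p U) {ε : ℝ} (hε : 0 < ε) :
    ∀ᶠ z in 𝓝 0, ∀ t, 0 ≤ t → ‖U z (atTime t) - p t‖ ≤ ε := by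
  have hc : ContinuousAt U 0 := hU.contDiffAt.self_of_nhds.continuousAt
  filter_upwards [hc (Metric.ball_mem_nhds (U 0) hε)] with z hz t ht
  rw [Set.mem_preimage, mem_ball_iff_norm] at hz
  rw [← hU.zero t ht]
  exact ((U z - U 0).norm_coe_le_norm (atTime t)).trans hz.le

/-- The limit of a convergent solution is an equilibrium. It depends continuously on the parameters
and is near `q`, so local uniqueness identifies it with the continued equilibrium. -/
theorem eventually_isStableOrbit (hU : IsStableFamily r F p U)
    (hF : ∀ l, Continuous (F l)) {q : Euc n} {Q : Euc k → Euc n}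
    (hp : IsStableOrbit (F 0) q 0 p)
    (hQ : ∀ᶠ y in 𝓝 ((0 : Euc k), q), F y.1 y.2 = 0 ↔ y.2 = Q y.1) :
    ∀ᶠ z in 𝓝 0, IsStableOrbit (F z.1) (Q z.1) 0 fun t => U z (atTime t) := by
  have hc : ContinuousAt U 0 := hU.contDiffAt.self_of_nhds.continuousAt
  have hq : U 0 OnePoint.infty = q :=
    tendsto_nhds_unique (tendsto_comp_atTime (U 0)) (hp.2.congr' (by
      filter_upwards [eventually_ge_atTop 0] with t ht using (hU.zero t ht).symm))
  have h1 : Tendsto (fun z => (z.1, U z OnePoint.infty)) (𝓝 0) (𝓝 ((0 : Euc k), q)) := by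
    have h2 : ContinuousAt (fun z => U z OnePoint.infty) 0 :=
      ((ContinuousMap.evalCLM ℝ (OnePoint.infty : HalfLine)).continuous.continuousAt).comp hc
    have h3 := (continuousAt_fst (p := (0 : Euc k × stableSubspace (F 0) p))).prodMk h2
    rw [← hq]
    exact h3
  filter_upwards [hU.solves, h1.eventually hQ] with z hz hz2
  have h4 := tendsto_comp_atTime (U z)
  have h5 := hz2.1 (eq_zero_of_tendsto_of_solvesOn (hF z.1) hz h4)
  rw [h5] at h4
  exact ⟨hz, h4⟩

/-- The tangent space of the stable manifold along a convergent orbit is the space of the initial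
values of the decaying solutions of the variational equation. -/
theorem stableTangent_eq (hU : IsStableFamily r F p U) (hr : r ≠ 0)
    (hF : ∀ l, Continuous (F l)) (hF0 : ContDiff ℝ 1 (F 0)) {q : Euc n} {Q : Euc k → Euc n}
    (hp : IsStableOrbit (F 0) q 0 p) (hQ0 : Q 0 = q)
    (hQ : ∀ᶠ y in 𝓝 ((0 : Euc k), q), F y.1 y.2 = 0 ↔ y.2 = Q y.1) :
    stableTangent (F 0) q (p 0) = stableSubspace (F 0) p := by
  refine le_antisymm (Submodule.span_le.2 ?_) fun v hv => Submodule.subset_span ?_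
  · rintro v ⟨u, hu, hu0, hunif, hv⟩
    have hup : ∀ t, 0 ≤ t → u 0 t = p t := hu.self_of_nhds.eq_of_eq_zero hF0 hp hu0
    obtain ⟨ε, hε, huniq⟩ := hU.unique
    set π := (stableSubspace (F 0) p).orthogonalProjectionOnto
    -- Uniform closeness of the forward orbits places the curve in the family, as `U (0, π (u s 0 -
    -- p 0))`. Differentiating at `s = 0` shows that its velocity `v` equals `π v`.
    have h1 : ∀ᶠ s in 𝓝 (0 : ℝ), u s 0 = U (0, π (u s 0 - p 0)) (atTime 0) := by
      filter_upwards [hu, Metric.tendstoUniformlyOn_iff.1 hunif ε hε] with s hs hs2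
      refine huniq.self_of_nhds (u s) q hs.1 hs.2 (fun t ht => ?_) 0 le_rfl
      have := (hs2 t ht).le
      rwa [dist_comm, dist_eq_norm, hup t ht] at this
    have h2 : HasDerivAt (fun s => ((0 : Euc k), π (u s 0 - p 0))) (0, π v) 0 :=
      (hasDerivAt_const (0 : ℝ) (0 : Euc k)).prodMk
        (π.hasFDerivAt.comp_hasDerivAt (0 : ℝ) (hv.sub_const (p 0)))
    have h3 : ((0 : Euc k), π (u 0 0 - p 0)) = 0 := by
      rw [hu0, sub_self, map_zero]
      rfl
    have h4 : HasDerivAt (fun s => U (0, π (u s 0 - p 0))) (fderiv ℝ U 0 (0, π v)) 0 :=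
      HasFDerivAt.comp_hasDerivAt (0 : ℝ) (by rw [h3]; exact hU.hasFDerivAt hr) h2
    have h5 := (ContinuousMap.evalCLM ℝ (atTime 0)).hasFDerivAt.comp_hasDerivAt (0 : ℝ) h4
    have h6 := (hv.congr_of_eventuallyEq (h1.mono fun s hs => hs.symm)).unique h5
    have h7 := hU.fderiv_apply_zero (π v)
    rw [h6]
    change fderiv ℝ U 0 (0, π v) (atTime 0) ∈ _
    rw [h7]
    exact Subtype.mem _
  · set v' : stableSubspace (F 0) p := ⟨v, hv⟩
    have hd : HasDerivAt (fun s : ℝ => ((0 : Euc k), s • v')) (0, v') 0 := by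
      have := (hasDerivAt_const (0 : ℝ) (0 : Euc k)).prodMk
        ((hasDerivAt_id (0 : ℝ)).smul_const v')
      simpa using this
    have h0 : ((0 : Euc k), (0 : ℝ) • v') = 0 := by
      rw [zero_smul]
      rfl
    have htend : Tendsto (fun s : ℝ => ((0 : Euc k), s • v')) (𝓝 0) (𝓝 0) := by
      have := hd.continuousAt.tendsto
      rwa [h0] at this
    -- Conversely, the line `s ↦ s • v` in the parameter space gives a curve in the stable manifold
    -- with velocity `v`.
    refine ⟨fun s t => U (0, s • v') (atTime t), ?_, ?_, ?_, ?_⟩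
    · filter_upwards [htend.eventually (hU.eventually_isStableOrbit hF hp hQ)] with s hs
      rwa [hQ0] at hs
    · change U (0, (0 : ℝ) • v') (atTime 0) = p 0
      rw [h0]
      exact hU.zero 0 le_rfl
    · rw [Metric.tendstoUniformlyOn_iff]
      intro ε hε
      filter_upwards [htend.eventually (hU.eventually_norm_sub_le (half_pos hε))] with s hs t ht
      rw [h0, hU.zero t ht, dist_comm, dist_eq_norm]
      exact (hs t ht).trans_lt (half_lt_self hε)
    · have h4 : HasDerivAt (fun s : ℝ => U (0, s • v')) (fderiv ℝ U 0 (0, v')) 0 :=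
        HasFDerivAt.comp_hasDerivAt (0 : ℝ) (by rw [h0]; exact hU.hasFDerivAt hr) hd
      have h5 := (ContinuousMap.evalCLM ℝ (atTime 0)).hasFDerivAt.comp_hasDerivAt (0 : ℝ) h4
      have h7 := hU.fderiv_apply_zero v'
      change HasDerivAt _ (fderiv ℝ U 0 (0, v') (atTime 0)) 0 at h5
      rw [h7] at h5
      exact h5

end IsStableFamily

end StableTangent

/-! ### Time shift and time reversal. -/

section TimeReversal

variable {n : ℕ} {F : Euc n → Euc n} {q : Euc n} {t₀ : ℝ} {u : ℝ → Euc n}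

theorem isStableOrbit_iff_shift :
    IsStableOrbit F q t₀ u ↔ IsStableOrbit F q 0 fun s => u (t₀ + s) := by
  constructor
  · rintro ⟨h1, h2⟩
    refine ⟨fun t (ht : 0 ≤ t) => ?_, h2.comp (tendsto_atTop_add_const_left _ _ tendsto_id)⟩
    have h3 := (h1 (t₀ + t) (by simpa using ht)).scomp t
      ((hasDerivAt_id t).const_add t₀).hasDerivWithinAt
      (show Set.MapsTo _ (Set.Ici 0) _ from
        fun s (hs : 0 ≤ s) => show t₀ ≤ t₀ + s by linarith)
    simpa [Function.comp_def] using h3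
  · rintro ⟨h1, h2⟩
    refine ⟨fun t (ht : t₀ ≤ t) => ?_, ?_⟩
    · have h3 := (h1 (t - t₀) (by simpa using ht)).scomp t
        ((hasDerivAt_id t).sub_const t₀).hasDerivWithinAt
        (show Set.MapsTo _ (Set.Ici t₀) _ from
          fun s (hs : t₀ ≤ s) => show 0 ≤ s - t₀ by linarith)
      simpa [Function.comp_def] using h3
    · have := h2.comp (tendsto_atTop_add_const_right atTop (-t₀) tendsto_id)
      simpa [Function.comp_def] using this

/-- This reduces every statement about unstable orbits to stable orbits of `-F` starting at time
`0`. -/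
theorem isUnstableOrbit_iff_reverse :
    IsUnstableOrbit F q t₀ u ↔ IsStableOrbit (fun x => -F x) q 0 fun s => u (t₀ - s) := by
  constructor
  · rintro ⟨h1, h2⟩
    refine ⟨fun t (ht : 0 ≤ t) => ?_, h2.comp (tendsto_atBot_add_const_left _ t₀
      tendsto_neg_atTop_atBot)⟩
    have h3 := (h1 (t₀ - t) (by simpa using ht)).scomp t
      ((hasDerivAt_id t).const_sub t₀).hasDerivWithinAt
      (show Set.MapsTo _ (Set.Ici 0) _ from
        fun s (hs : 0 ≤ s) => show t₀ - s ≤ t₀ by linarith)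
    simpa [Function.comp_def] using h3
  · rintro ⟨h1, h2⟩
    refine ⟨fun t (ht : t ≤ t₀) => ?_, ?_⟩
    · have h3 := (h1 (t₀ - t) (by simpa using ht)).scomp t
        ((hasDerivAt_id t).const_sub t₀).hasDerivWithinAt
        (show Set.MapsTo _ (Set.Iic t₀) _ from
          fun s (hs : s ≤ t₀) => show 0 ≤ t₀ - s by linarith)
      simpa [Function.comp_def] using h3
    · have := h2.comp (tendsto_atTop_add_const_left atBot t₀ tendsto_neg_atBot_atTop)
      simpa [Function.comp_def] using this

theorem unstableTangent_eq (F : Euc n → Euc n) (q x : Euc n) :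
    unstableTangent F q x = stableTangent (fun x => -F x) q x := by
  refine le_antisymm (Submodule.span_le.2 ?_) (Submodule.span_le.2 ?_)
  · rintro v ⟨u, hu, hu0, hunif, hv⟩
    refine Submodule.subset_span ⟨fun s t => u s (0 - t), ?_, by simpa using hu0, ?_,
      by simpa using hv⟩
    · filter_upwards [hu] with s hs using isUnstableOrbit_iff_reverse.1 hs
    · intro V hV
      filter_upwards [hunif V hV] with s hs t (ht : 0 ≤ t)
      exact hs (0 - t) (show 0 - t ≤ 0 by linarith)
  · rintro v ⟨u, hu, hu0, hunif, hv⟩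
    refine Submodule.subset_span ⟨fun s t => u s (0 - t), ?_, by simpa using hu0, ?_,
      by simpa using hv⟩
    · filter_upwards [hu] with s hs
      refine isUnstableOrbit_iff_reverse.2 ?_
      simpa using hs
    · intro V hV
      filter_upwards [hunif V hV] with s hs t (ht : t ≤ 0)
      exact hs (0 - t) (show 0 ≤ 0 - t by linarith)

end TimeReversal

/-! ### Bounded and decaying solutions of the adjoint equation along `p`. -/

section AdjointValues

variable {n : ℕ} {f : Euc n → Euc n} {pm pp : Euc n} {p : ℝ → Euc n}

theorem IsHyperbolicEquilibrium.neg {q : Euc n} (h : IsHyperbolicEquilibrium f q) :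
    IsHyperbolicEquilibrium (fun x => -f x) q := by
  refine ⟨by simp [h.1], ?_⟩
  have h1 : fderiv ℝ (fun x => -f x) q = -fderiv ℝ f q := fderiv_fun_neg
  rw [h1]
  exact h.isHyperbolicMap.neg

theorem IsConnectingOrbit.isStableOrbit (hp : IsConnectingOrbit f pm pp p) (t₀ : ℝ) :
    IsStableOrbit f pp t₀ p :=
  ⟨fun t _ => (hp.solves t trivial).mono (Set.subset_univ _), hp.tendsto_plus⟩

theorem IsConnectingOrbit.isUnstableOrbit (hp : IsConnectingOrbit f pm pp p) (t₀ : ℝ) :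
    IsUnstableOrbit f pm t₀ p :=
  ⟨fun t _ => (hp.solves t trivial).mono (Set.subset_univ _), hp.tendsto_minus⟩

theorem IsConnectingOrbit.continuous (hp : IsConnectingOrbit f pm pp p) : Continuous p :=
  continuous_iff_continuousAt.2 fun t =>
    (hasDerivWithinAt_univ.1 (hp.solves t trivial)).continuousAt

/-- A continuous function on `ℝ` with limits at `±∞` is bounded. -/
theorem exists_bound_of_tendsto {E : Type*} [NormedAddCommGroup E] {u : ℝ → E}
    (hu : Continuous u) {a b : E} (ha : Tendsto u atBot (𝓝 a)) (hb : Tendsto u atTop (𝓝 b)) :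
    ∃ C, ∀ t, ‖u t‖ ≤ C := by
  obtain ⟨U, hU, -⟩ := exists_halfLine_extension hu.continuousOn hb
  obtain ⟨V, hV, -⟩ := exists_halfLine_extension (u := fun t => u (-t))
    (hu.comp continuous_neg).continuousOn (ha.comp tendsto_neg_atTop_atBot)
  refine ⟨max ‖U‖ ‖V‖, fun t => ?_⟩
  rcases le_total 0 t with ht | ht
  · rw [← hU t ht]
    exact (U.norm_coe_le_norm _).trans (le_max_left _ _)
  · have := hV (-t) (by linarith)
    rw [neg_neg] at this
    rw [← this]
    exact (V.norm_coe_le_norm _).trans (le_max_right _ _)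

theorem continuous_adjointCoeff (hf : ContDiff ℝ 1 f) (hp : Continuous p) :
    Continuous (adjointCoeff f p) :=
  (ContinuousLinearMap.adjoint.continuous.comp
    ((hf.continuous_fderiv one_ne_zero).comp hp)).neg

theorem IsConnectingOrbit.exists_adjointCoeff_bound (hf : ContDiff ℝ 1 f)
    (hp : IsConnectingOrbit f pm pp p) : ∃ C, ∀ t, ‖adjointCoeff f p t‖ ≤ C := by
  have hc : Continuous fun x => -ContinuousLinearMap.adjoint (fderiv ℝ f x) :=
    (ContinuousLinearMap.adjoint.continuous.comp (hf.continuous_fderiv one_ne_zero)).neg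
  exact exists_bound_of_tendsto (continuous_adjointCoeff hf hp.continuous)
    ((hc.tendsto pm).comp hp.tendsto_minus) ((hc.tendsto pp).comp hp.tendsto_plus)

theorem IsConnectingOrbit.exists_adjoint_solution (hf : ContDiff ℝ 1 f)
    (hp : IsConnectingOrbit f pm pp p) (t₀ : ℝ) (v : Euc n) :
    ∃ w ∈ linearSolutions (adjointCoeff f p), w t₀ = v := by
  obtain ⟨C, hC⟩ := hp.exists_adjointCoeff_bound hf
  obtain ⟨w, hw0, hw⟩ := exists_linear_solution_inhomogeneous
    (continuous_adjointCoeff hf hp.continuous) hC (continuous_const (y := (0 : Euc n))) (C := 0)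
    (by simp) t₀ v
  exact ⟨w, fun t => by simpa using hw t, hw0⟩

theorem IsConnectingOrbit.adjoint_solution_unique (hf : ContDiff ℝ 1 f)
    (hp : IsConnectingOrbit f pm pp p) {t₀ : ℝ} {w w' : ℝ → Euc n}
    (hw : w ∈ linearSolutions (adjointCoeff f p)) (hw' : w' ∈ linearSolutions (adjointCoeff f p))
    (h0 : w t₀ = w' t₀) : w = w' := by
  obtain ⟨C, hC⟩ := hp.exists_adjointCoeff_bound hf
  refine ODE_solution_unique_univ (v := fun t x => adjointCoeff f p t x) (s := fun _ => Set.univ)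
    (K := C.toNNReal) (fun t => ?_) (fun t => ⟨hw t, trivial⟩) (fun t => ⟨hw' t, trivial⟩) h0
  have := (lipschitzWith_clm_add (hC t) 0).lipschitzOnWith (s := Set.univ)
  simpa only [add_zero] using this

/-- Along a convergent orbit, a solution of the adjoint equation with initial value orthogonal to
the stable subspace is integrable and tends to `0`. -/
theorem integrableOn_and_tendsto_of_inner_eq_zero (hf : ContDiff ℝ 1 f) {q : Euc n}
    (hq : IsHyperbolicEquilibrium f q) (hp : IsStableOrbit f q 0 p) {w : ℝ → Euc n}
    (hw : ∀ t, 0 ≤ t → HasDerivWithinAt w (adjointCoeff f p t (w t)) (Set.Ici 0) t)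
    (h0 : ∀ v ∈ stableSubspace f p, inner ℝ (w 0) v = 0) :
    IntegrableOn w (Set.Ioi 0) ∧ Tendsto w atTop (𝓝 0) := by
  have hfc := hf.continuous_fderiv one_ne_zero
  obtain ⟨A, hA, hAq⟩ := exists_halfLine_extension (u := fun t => fderiv ℝ f (p t))
    (hfc.comp_continuousOn fun t ht => (hp.1 t ht).continuousWithinAt)
    ((hfc.tendsto q).comp hp.2)
  refine integrableOn_and_tendsto_of_adjoint (A := A) (by rw [hAq]; exact hq.isHyperbolicMap)
    (fun t ht => by rw [hA t ht]; exact hw t ht) fun v hv => h0 v ?_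
  obtain ⟨x, hx0, hx, hxt⟩ := hv
  exact ⟨x, hx0, fun t ht => by simpa only [← hA t ht] using hx t ht, hxt⟩

/-- The vector field along a convergent orbit is a decaying solution of the variational
equation. -/
theorem IsStableOrbit.apply_mem_stableSubspace (hf : ContDiff ℝ 1 f) {q : Euc n} (hq : f q = 0)
    (hp : IsStableOrbit f q 0 p) : f (p 0) ∈ stableSubspace f p := by
  refine ⟨fun t => f (p t), rfl, fun t ht => ?_, ?_⟩
  · exact ((hf.differentiable one_ne_zero) (p t)).hasFDerivAt.comp_hasDerivWithinAt t (hp.1 t ht)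
  · have := (hf.continuous.tendsto q).comp hp.2
    rwa [hq] at this

/-- If the vector field vanished at `p t₀`, uniqueness forwards and backwards would force `p` to be
constant. Hence `f (p t₀)` spans the one-dimensional intersection of the tangent spaces. -/
theorem IsConnectingOrbit.apply_ne_zero (hf : ContDiff ℝ 1 f) (hp : IsConnectingOrbit f pm pp p)
    (t₀ : ℝ) : f (p t₀) ≠ 0 := by
  intro h0
  have h1 := (isStableOrbit_iff_shift.1 (hp.isStableOrbit t₀)).eq_of_eq_zero hf
    (v := fun _ => p t₀) (q' := p t₀)
    ⟨fun t _ => by simpa [h0] using hasDerivWithinAt_const t _ (p t₀), tendsto_const_nhds⟩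
    (by simp)
  have h2 := (isUnstableOrbit_iff_reverse.1 (hp.isUnstableOrbit t₀)).eq_of_eq_zero hf.neg
    (v := fun _ => p t₀) (q' := p t₀)
    ⟨fun t _ => by simpa [h0] using hasDerivWithinAt_const t _ (p t₀), tendsto_const_nhds⟩
    (by simp)
  have h3 : ∀ t, p t = p t₀ := fun t => by
    rcases le_total t₀ t with ht | ht
    · simpa using h1 (t - t₀) (by linarith)
    · simpa using h2 (t₀ - t) (by linarith)
  obtain ⟨s, t, hst⟩ := hp.nonconstant
  exact hst (by rw [h3 s, h3 t])

theorem hasDerivWithinAt_adjoint_shift {w : ℝ → Euc n}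
    (hw : w ∈ linearSolutions (adjointCoeff f p)) (t₀ t : ℝ) :
    HasDerivWithinAt (fun s => w (t₀ + s))
      (adjointCoeff f (fun s => p (t₀ + s)) t (w (t₀ + t))) (Set.Ici 0) t := by
  have := (hw (t₀ + t)).scomp t ((hasDerivAt_id t).const_add t₀)
  rw [one_smul] at this
  exact this.hasDerivWithinAt

theorem hasDerivWithinAt_adjoint_reverse {w : ℝ → Euc n}
    (hw : w ∈ linearSolutions (adjointCoeff f p)) (t₀ t : ℝ) :
    HasDerivWithinAt (fun s => w (t₀ - s))
      (adjointCoeff (fun x => -f x) (fun s => p (t₀ - s)) t (w (t₀ - t))) (Set.Ici 0) t := by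
  have h1 := (hw (t₀ - t)).scomp t ((hasDerivAt_id t).const_sub t₀)
  have h2 : fderiv ℝ (fun x => -f x) (p (t₀ - t)) = -fderiv ℝ f (p (t₀ - t)) := fderiv_fun_neg
  have h3 : adjointCoeff (fun x => -f x) (fun s => p (t₀ - s)) t = -adjointCoeff f p (t₀ - t) := by
    simp only [adjointCoeff]
    rw [h2, map_neg]
  rw [h3]
  simpa [Function.comp_def] using h1.hasDerivWithinAt

/-- The sum of the spaces of the initial values at `t₀` of the solutions of the variational
equation that decay as `t → ∞` and as `t → -∞`. -/
noncomputable abbrev decayingSum (f : Euc n → Euc n) (p : ℝ → Euc n) (t₀ : ℝ) :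
    Submodule ℝ (Euc n) :=
  stableSubspace f (fun s => p (t₀ + s)) ⊔ stableSubspace (fun x => -f x) (fun s => p (t₀ - s))

theorem mem_decayingSum_orthogonal_iff {t₀ : ℝ} {v : Euc n} :
    v ∈ (decayingSum f p t₀)ᗮ ↔
      (∀ x ∈ stableSubspace f (fun s => p (t₀ + s)), inner ℝ v x = 0) ∧
      ∀ x ∈ stableSubspace (fun x => -f x) (fun s => p (t₀ - s)), inner ℝ v x = 0 := by
  rw [decayingSum, ← Submodule.inf_orthogonal, Submodule.mem_inf, Submodule.mem_orthogonal',
    Submodule.mem_orthogonal']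

theorem IsConnectingOrbit.adjoint_integrable (hf : ContDiff ℝ 1 f)
    (hp : IsConnectingOrbit f pm pp p) {t₀ : ℝ} {w : ℝ → Euc n}
    (hw : w ∈ linearSolutions (adjointCoeff f p)) (h0 : w t₀ ∈ (decayingSum f p t₀)ᗮ) :
    (IntegrableOn (fun s => w (t₀ + s)) (Set.Ioi 0) ∧
      Tendsto (fun s => w (t₀ + s)) atTop (𝓝 0)) ∧
    IntegrableOn (fun s => w (t₀ - s)) (Set.Ioi 0) ∧
      Tendsto (fun s => w (t₀ - s)) atTop (𝓝 0) := by
  rw [mem_decayingSum_orthogonal_iff] at h0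
  constructor
  · exact integrableOn_and_tendsto_of_inner_eq_zero hf hp.hyp_plus
      (isStableOrbit_iff_shift.1 (hp.isStableOrbit t₀))
      (fun t _ => hasDerivWithinAt_adjoint_shift hw t₀ t) (by simpa using h0.1)
  · exact integrableOn_and_tendsto_of_inner_eq_zero hf.neg hp.hyp_minus.neg
      (isUnstableOrbit_iff_reverse.1 (hp.isUnstableOrbit t₀))
      (fun t _ => hasDerivWithinAt_adjoint_reverse hw t₀ t) (by simpa using h0.2)

theorem tendsto_of_tendsto_shift {w : ℝ → Euc n} {t₀ : ℝ}
    (h : Tendsto (fun s => w (t₀ + s)) atTop (𝓝 0)) : Tendsto w atTop (𝓝 0) := by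
  have := h.comp (tendsto_atTop_add_const_right atTop (-t₀) tendsto_id)
  simpa [Function.comp_def] using this

theorem tendsto_of_tendsto_reverse {w : ℝ → Euc n} {t₀ : ℝ}
    (h : Tendsto (fun s => w (t₀ - s)) atTop (𝓝 0)) : Tendsto w atBot (𝓝 0) := by
  have := h.comp (tendsto_atTop_add_const_left atBot t₀ tendsto_neg_atBot_atTop)
  simpa [Function.comp_def] using this

/-- Boundedness at `+∞` gives orthogonality to the stable part, boundedness at `-∞` to the unstable
part. Two solutions with a common value at `t₀` are allowed, to match the definition of
`adjointDecayingValues`. -/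
theorem mem_decayingSum_orthogonal_of_bounded {t₀ : ℝ} {w w' : ℝ → Euc n}
    (hw : w ∈ linearSolutions (adjointCoeff f p)) (hw' : w' ∈ linearSolutions (adjointCoeff f p))
    (hww' : w t₀ = w' t₀) (hb : ∃ C, ∀ᶠ t in atTop, ‖w t‖ ≤ C)
    (hb' : ∃ C, ∀ᶠ t in atBot, ‖w' t‖ ≤ C) :
    w t₀ ∈ (decayingSum f p t₀)ᗮ := by
  refine mem_decayingSum_orthogonal_iff.2 ⟨fun x hx => ?_, fun x hx => ?_⟩
  · have := inner_eq_zero_of_bounded (w := fun s => w (t₀ + s))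
      (fun t _ => hasDerivWithinAt_adjoint_shift hw t₀ t) ?_ hx
    · simpa using this
    · obtain ⟨C, hC⟩ := hb
      exact ⟨C, (tendsto_atTop_add_const_left atTop t₀ tendsto_id).eventually hC⟩
  · have := inner_eq_zero_of_bounded (w := fun s => w' (t₀ - s))
      (fun t _ => hasDerivWithinAt_adjoint_reverse hw' t₀ t) ?_ hx
    · rw [hww']
      simpa using this
    · obtain ⟨C, hC⟩ := hb'
      exact ⟨C, (tendsto_atBot_add_const_left atTop t₀ tendsto_neg_atTop_atBot).eventually hC⟩

/-- Decay implies orthogonality by constancy of the pairing; the converse is the duality estimate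
for the adjoint equation. The jump condition thus becomes linear: orthogonality to the sum of the
tangent spaces. -/
theorem IsConnectingOrbit.mem_adjointDecayingValues_iff (hf : ContDiff ℝ 1 f)
    (hp : IsConnectingOrbit f pm pp p) {t₀ : ℝ} {v : Euc n} :
    v ∈ adjointDecayingValues f p t₀ ↔ v ∈ (decayingSum f p t₀)ᗮ := by
  constructor
  · rintro ⟨⟨w, hw, hwv, hwt⟩, ⟨w', hw', hwv', hwt'⟩⟩
    rw [← hwv]
    refine mem_decayingSum_orthogonal_of_bounded hw hw' (hwv.trans hwv'.symm) ⟨1, ?_⟩ ⟨1, ?_⟩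
    · filter_upwards [hwt (Metric.closedBall_mem_nhds _ one_pos)] with t ht
      simpa using ht
    · filter_upwards [hwt' (Metric.closedBall_mem_nhds _ one_pos)] with t ht
      simpa using ht
  · intro hv
    obtain ⟨w, hw, hwv⟩ := hp.exists_adjoint_solution hf t₀ v
    obtain ⟨⟨-, h1⟩, -, h2⟩ := hp.adjoint_integrable hf hw (by rwa [hwv])
    exact ⟨⟨w, hw, hwv, tendsto_of_tendsto_shift h1⟩, ⟨w, hw, hwv, tendsto_of_tendsto_reverse h2⟩⟩

theorem apply_mem_of_mem_boundedAdjointSolutions {t₀ : ℝ} {w : ℝ → Euc n}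
    (hw : w ∈ boundedAdjointSolutions f p) : w t₀ ∈ (decayingSum f p t₀)ᗮ := by
  obtain ⟨h1, C, hC⟩ := hw
  exact mem_decayingSum_orthogonal_of_bounded h1 h1 rfl ⟨C, Eventually.of_forall hC⟩
    ⟨C, Eventually.of_forall hC⟩

theorem IsConnectingOrbit.exists_boundedAdjointSolution (hf : ContDiff ℝ 1 f)
    (hp : IsConnectingOrbit f pm pp p) {t₀ : ℝ} {v : Euc n} (hv : v ∈ (decayingSum f p t₀)ᗮ) :
    ∃ w ∈ boundedAdjointSolutions f p, w t₀ = v := by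
  obtain ⟨w, hw, hwv⟩ := hp.exists_adjoint_solution hf t₀ v
  obtain ⟨⟨-, h1⟩, -, h2⟩ := hp.adjoint_integrable hf hw (by rwa [hwv])
  refine ⟨w, ⟨hw, ?_⟩, hwv⟩
  exact exists_bound_of_tendsto (continuous_iff_continuousAt.2 fun t => (hw t).continuousAt)
    (tendsto_of_tendsto_reverse h2) (tendsto_of_tendsto_shift h1)

/-- Evaluation at `t₀` identifies the bounded solutions of the adjoint equation with the
orthogonal complement of the sum of the spaces of decaying initial values. -/
noncomputable def IsConnectingOrbit.evalEquiv (hf : ContDiff ℝ 1 f)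
    (hp : IsConnectingOrbit f pm pp p) (t₀ : ℝ) :
    boundedAdjointSolutions f p ≃ₗ[ℝ] ((decayingSum f p t₀)ᗮ : Submodule ℝ (Euc n)) :=
  LinearEquiv.ofBijective
    (((LinearMap.proj t₀).domRestrict (boundedAdjointSolutions f p)).codRestrict
      (decayingSum f p t₀)ᗮ fun w => apply_mem_of_mem_boundedAdjointSolutions w.2) (by
    constructor
    · intro w w' h
      exact Subtype.ext (hp.adjoint_solution_unique hf (t₀ := t₀) w.2.1 w'.2.1
        (congrArg Subtype.val h))
    · rintro ⟨v, hv⟩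
      obtain ⟨w, hw, hwv⟩ := hp.exists_boundedAdjointSolution hf hv
      exact ⟨⟨w, hw⟩, Subtype.ext hwv⟩)

theorem IsConnectingOrbit.evalEquiv_apply (hf : ContDiff ℝ 1 f)
    (hp : IsConnectingOrbit f pm pp p) (t₀ : ℝ) (w : boundedAdjointSolutions f p) :
    (hp.evalEquiv hf t₀ w : Euc n) = (w : ℝ → Euc n) t₀ := rfl

end AdjointValues

/-! ### Existence, uniqueness and derivative of the jump. -/

section SectionAndJump

variable {X E : Type*} [NormedAddCommGroup X] [NormedSpace ℝ X]
  [NormedAddCommGroup E] [InnerProductSpace ℝ E]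

/-- Two families of points, parametrized by their tangent spaces `Es`, `Eu` and a parameter `l`,
have unique members in a transversal section to `Es ⊓ Eu` with difference orthogonal to
`Es ⊔ Eu`. -/
theorem exists_section_jump [CompleteSpace X] [FiniteDimensional ℝ E] {r : WithTop ℕ∞} (hr : r ≠ 0) {Es Eu : Submodule ℝ E} {x₀ v₀ : E}
    (hv₀ : v₀ ≠ 0) (hspan : Es ⊓ Eu = ℝ ∙ v₀) {σ : X × Es → E} {τ : X × Eu → E}
    (hσ : ∀ᶠ z in 𝓝 0, ContDiffAt ℝ r σ z) (hτ : ∀ᶠ z in 𝓝 0, ContDiffAt ℝ r τ z)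
    (hσ0 : σ 0 = x₀) (hτ0 : τ 0 = x₀) (hσ' : ∀ a : Es, fderiv ℝ σ 0 (0, a) = a)
    (hτ' : ∀ b : Eu, fderiv ℝ τ 0 (0, b) = b) :
    ∃ (η : X → Es) (ζ : X → Eu), η 0 = 0 ∧ ζ 0 = 0 ∧
      (∀ᶠ l in 𝓝 0, ContDiffAt ℝ r η l) ∧ (∀ᶠ l in 𝓝 0, ContDiffAt ℝ r ζ l) ∧
      ∀ᶠ z in 𝓝 (0 : X × Es × Eu), (inner ℝ v₀ (σ (z.1, z.2.1) - x₀) = 0 ∧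
        τ (z.1, z.2.2) - σ (z.1, z.2.1) ∈ (Es ⊔ Eu)ᗮ) ↔ (z.2.1 = η z.1 ∧ z.2.2 = ζ z.1) := by
  set W := Es ⊔ Eu with hW
  set s : X × Es × Eu →L[ℝ] X × Es := (ContinuousLinearMap.fst ℝ X (Es × Eu)).prod
    ((ContinuousLinearMap.fst ℝ Es Eu).comp (ContinuousLinearMap.snd ℝ X (Es × Eu))) with hs
  set u : X × Es × Eu →L[ℝ] X × Eu := (ContinuousLinearMap.fst ℝ X (Es × Eu)).prod
    ((ContinuousLinearMap.snd ℝ Es Eu).comp (ContinuousLinearMap.snd ℝ X (Es × Eu))) with hu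
  -- The derivative in `(a, b)` is `(⟨v₀, a⟩, P (b - a))`, with `P` the projection onto `Es ⊔ Eu`.
  -- If it vanishes, then `a = b` lies in `Es ⊓ Eu = ℝ v₀` and is orthogonal to `v₀`, so it is zero.
  set G : X × Es × Eu → ℝ × W := fun z =>
    (inner ℝ v₀ (σ (s z) - x₀), W.orthogonalProjectionOnto (τ (u z) - σ (s z))) with hG
  have hs0 : Tendsto s (𝓝 0) (𝓝 0) := by simpa using s.continuous.tendsto 0
  have hu0 : Tendsto u (𝓝 0) (𝓝 0) := by simpa using u.continuous.tendsto 0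
  have hGc : ∀ᶠ z in 𝓝 0, ContDiffAt ℝ r G z := by
    filter_upwards [hs0.eventually hσ, hu0.eventually hτ] with z h1 h2
    have h3 := h1.comp z s.contDiff.contDiffAt
    have h4 := h2.comp z u.contDiff.contDiffAt
    exact (contDiffAt_const.inner ℝ (h3.sub contDiffAt_const)).prodMk
      (W.orthogonalProjectionOnto.contDiff.contDiffAt.comp z (h4.sub h3))
  have hG' : ∀ y : Es × Eu, fderiv ℝ G (0, 0) (0, y) =
      (inner ℝ v₀ (y.1 : E), W.orthogonalProjectionOnto ((y.2 : E) - y.1)) := by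
    intro y
    have h1 : HasFDerivAt (fun z => σ (s z)) ((fderiv ℝ σ 0).comp s) 0 := by
      have : HasFDerivAt σ (fderiv ℝ σ 0) (s 0) := by
        rw [map_zero]; exact (hσ.self_of_nhds.differentiableAt hr).hasFDerivAt
      exact this.comp 0 s.hasFDerivAt
    have h2 : HasFDerivAt (fun z => τ (u z)) ((fderiv ℝ τ 0).comp u) 0 := by
      have : HasFDerivAt τ (fderiv ℝ τ 0) (u 0) := by
        rw [map_zero]; exact (hτ.self_of_nhds.differentiableAt hr).hasFDerivAt
      exact this.comp 0 u.hasFDerivAt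
    have h3 : HasFDerivAt G (((innerSL ℝ v₀).comp ((fderiv ℝ σ 0).comp s)).prod
        (W.orthogonalProjectionOnto.comp ((fderiv ℝ τ 0).comp u - (fderiv ℝ σ 0).comp s))) 0 :=
      ((innerSL ℝ v₀).hasFDerivAt.comp 0 (h1.sub_const x₀)).prodMk
        (W.orthogonalProjectionOnto.hasFDerivAt.comp 0 (h2.sub h1))
    have h4 : fderiv ℝ G (0, 0) = _ := h3.fderiv
    rw [h4]
    have h5 : s ((0 : X), y) = (0, y.1) := rfl
    have h6 : u ((0 : X), y) = (0, y.2) := rfl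
    simp [h5, h6, hσ', hτ']
  have hG0 : G (0, 0) = 0 := by
    have h1 : s 0 = 0 := map_zero s
    have h2 : u 0 = 0 := map_zero u
    have h3 : G 0 = 0 := by simp [hG, h1, h2, hσ0, hτ0]
    exact h3
  have hv₀m : v₀ ∈ Es ⊓ Eu := hspan ▸ Submodule.mem_span_singleton_self v₀
  have hvv : inner ℝ v₀ v₀ ≠ 0 := inner_self_ne_zero.2 hv₀
  have hinj : ∀ y : Es × Eu, fderiv ℝ G (0, 0) (0, y) = 0 → y = 0 := by
    rintro ⟨a, b⟩ hab
    rw [hG'] at hab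
    obtain ⟨h1, h2⟩ := Prod.ext_iff.1 hab
    have h3 : (b : E) - a ∈ Wᗮ := W.orthogonalProjectionOnto_eq_zero_iff.1 h2
    have h4 : (b : E) - a ∈ W := sub_mem (Submodule.mem_sup_right b.2) (Submodule.mem_sup_left a.2)
    have h5 : (b : E) = a := by
      have := Submodule.inner_right_of_mem_orthogonal h4 h3
      exact sub_eq_zero.1 (inner_self_eq_zero.1 this)
    have h6 : (a : E) ∈ Es ⊓ Eu := ⟨a.2, h5 ▸ b.2⟩
    rw [hspan, Submodule.mem_span_singleton] at h6
    obtain ⟨c, hc⟩ := h6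
    have h7 : c = 0 := by
      have h1' : inner ℝ v₀ (a : E) = 0 := h1
      rw [← hc, inner_smul_right] at h1'
      exact (mul_eq_zero.1 h1').resolve_right hvv
    have h8 : (a : E) = 0 := by rw [← hc, h7, zero_smul]
    exact Prod.ext (Subtype.ext h8) (Subtype.ext (h5.trans h8))
  have hsurj : ∀ y : ℝ × W, ∃ x : Es × Eu, fderiv ℝ G (0, 0) (0, x) = y := by
    rintro ⟨c, w, hw⟩
    obtain ⟨a, ha, b, hb, hab⟩ := Submodule.mem_sup.1 hw
    -- Adding the same multiple of `v₀` to both entries does not change their difference `b - (-a) =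
    -- w`; this multiple is tuned to give the first component the value `c`.
    set e := (c + inner ℝ v₀ a) / inner ℝ v₀ v₀ with he
    refine ⟨(⟨-a + e • v₀, Es.add_mem (Es.neg_mem ha) (Es.smul_mem _ hv₀m.1)⟩,
      ⟨b + e • v₀, Eu.add_mem hb (Eu.smul_mem _ hv₀m.2)⟩), ?_⟩
    rw [hG']
    refine Prod.ext ?_ ?_
    · change inner ℝ v₀ (-a + e • v₀) = c
      rw [inner_add_right, inner_neg_right, inner_smul_right, he]
      field_simp
      ring
    · change W.orthogonalProjectionOnto (b + e • v₀ - (-a + e • v₀)) = ⟨w, hw⟩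
      have : b + e • v₀ - (-a + e • v₀) = ((⟨w, hw⟩ : W) : E) := by
        change _ = w
        rw [← hab]; abel
      rw [this]
      exact W.orthogonalProjectionOnto_mem_subspace_eq_self _
  obtain ⟨φ, hφ0, hφ, hφG, -⟩ := exists_implicit (a := (0 : X)) (b := (0 : Es × Eu)) (G := G) hr
    hGc hG0 hinj hsurj
  refine ⟨fun l => (φ l).1, fun l => (φ l).2, by simp [hφ0], by simp [hφ0],
    hφ.mono fun l h => h.fst, hφ.mono fun l h => h.snd, ?_⟩
  filter_upwards [hφG] with z hz
  rw [← Prod.ext_iff, ← hz, Prod.ext_iff]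
  exact and_congr Iff.rfl W.orthogonalProjectionOnto_eq_zero_iff.symm

/-- By the chain rule the variations of `η` and `ζ` contribute vectors of `Es` and `Eu`, which are
orthogonal to `w`. Only the explicit dependence on the parameter remains, so the derivatives of `η`
and `ζ` need not be computed. -/
theorem inner_fderiv_jump {r : WithTop ℕ∞} (hr : r ≠ 0) {Es Eu : Submodule ℝ E}
    {σ : X × Es → E} {τ : X × Eu → E} (hσ : ContDiffAt ℝ r σ 0) (hτ : ContDiffAt ℝ r τ 0)
    (hσ' : ∀ a : Es, fderiv ℝ σ 0 (0, a) = a) (hτ' : ∀ b : Eu, fderiv ℝ τ 0 (0, b) = b)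
    {η : X → Es} {ζ : X → Eu} (hη : ContDiffAt ℝ r η 0) (hζ : ContDiffAt ℝ r ζ 0)
    (hη0 : η 0 = 0) (hζ0 : ζ 0 = 0) {w : E} (hw : w ∈ (Es ⊔ Eu)ᗮ) (l : X) :
    inner ℝ w (fderiv ℝ (fun l => τ (l, ζ l) - σ (l, η l)) 0 l) =
      inner ℝ w (fderiv ℝ τ 0 (l, 0)) - inner ℝ w (fderiv ℝ σ 0 (l, 0)) := by
  have h1 : HasFDerivAt (fun l => σ (l, η l)) ((fderiv ℝ σ 0).comp
      ((ContinuousLinearMap.id ℝ X).prod (fderiv ℝ η 0))) 0 := by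
    have h2 : HasFDerivAt σ (fderiv ℝ σ 0) (0, η 0) := by
      rw [hη0]; exact (hσ.differentiableAt hr).hasFDerivAt
    exact h2.comp (0 : X) ((hasFDerivAt_id 0).prodMk (hη.differentiableAt hr).hasFDerivAt)
  have h2 : HasFDerivAt (fun l => τ (l, ζ l)) ((fderiv ℝ τ 0).comp
      ((ContinuousLinearMap.id ℝ X).prod (fderiv ℝ ζ 0))) 0 := by
    have h2 : HasFDerivAt τ (fderiv ℝ τ 0) (0, ζ 0) := by
      rw [hζ0]; exact (hτ.differentiableAt hr).hasFDerivAt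
    exact h2.comp (0 : X) ((hasFDerivAt_id 0).prodMk (hζ.differentiableAt hr).hasFDerivAt)
  have h3 := (h2.sub h1).fderiv
  have h4 : ∀ a : Es, fderiv ℝ σ 0 (l, a) = fderiv ℝ σ 0 (l, 0) + a := fun a => by
    rw [← hσ' a, ← map_add]; simp
  have h5 : ∀ b : Eu, fderiv ℝ τ 0 (l, b) = fderiv ℝ τ 0 (l, 0) + b := fun b => by
    rw [← hτ' b, ← map_add]; simp
  have h6 : ∀ a : Es, inner ℝ w (a : E) = 0 := fun a =>
    Submodule.inner_left_of_mem_orthogonal (Submodule.mem_sup_left a.2) hw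
  have h7 : ∀ b : Eu, inner ℝ w (b : E) = 0 := fun b =>
    Submodule.inner_left_of_mem_orthogonal (Submodule.mem_sup_right b.2) hw
  have h8 : fderiv ℝ (fun l => τ (l, ζ l) - σ (l, η l)) 0 l =
      fderiv ℝ τ 0 (l, fderiv ℝ ζ 0 l) - fderiv ℝ σ 0 (l, fderiv ℝ η 0 l) := by
    have := congrArg (fun A => A l) h3
    exact this
  rw [h8, h4, h5, inner_sub_right, inner_add_right, inner_add_right, h6, h7, add_zero, add_zero]

end SectionAndJump

/-! ### Splitting an integral over the line at `t₀`. -/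

section HalfLines

theorem integrable_and_integral_of_halfLines {h : ℝ → ℝ} {t₀ : ℝ}
    (h1 : IntegrableOn (fun s => h (t₀ + s)) (Set.Ioi 0))
    (h2 : IntegrableOn (fun s => h (t₀ - s)) (Set.Ioi 0)) :
    Integrable h ∧ ∫ s, h s = (∫ s in Set.Ioi 0, h (t₀ + s)) + ∫ s in Set.Ioi 0, h (t₀ - s) := by
  have m1 := measurePreserving_add_left (volume : Measure ℝ) t₀
  have m2 := Measure.measurePreserving_sub_left (volume : Measure ℝ) t₀
  have e1 : MeasurableEmbedding fun s : ℝ => t₀ + s := measurableEmbedding_addLeft t₀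
  have e2 : MeasurableEmbedding fun s : ℝ => t₀ - s := (MeasurableEquiv.subLeft t₀).measurableEmbedding
  have s1 : (fun s : ℝ => t₀ + s) ⁻¹' Set.Ioi t₀ = Set.Ioi 0 := by simp
  have s2 : (fun s : ℝ => t₀ - s) ⁻¹' Set.Iio t₀ = Set.Ioi 0 := by simp
  have i1 : IntegrableOn h (Set.Ioi t₀) :=
    (m1.integrableOn_comp_preimage e1).1 (by rw [s1]; exact h1)
  have i2 : IntegrableOn h (Set.Iic t₀) := (integrableOn_Iic_iff_integrableOn_Iio).2
    ((m2.integrableOn_comp_preimage e2).1 (by rw [s2]; exact h2))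
  refine ⟨?_, ?_⟩
  · rw [← integrableOn_univ, ← Set.Iic_union_Ioi (a := t₀)]
    exact i2.union i1
  · rw [← intervalIntegral.integral_Iic_add_Ioi i2 i1, integral_Iic_eq_integral_Iio,
      ← m1.setIntegral_preimage_emb e1 h (Set.Ioi t₀),
      ← m2.setIntegral_preimage_emb e2 h (Set.Iio t₀), s1, s2, add_comm]

end HalfLines

/-! ### The families along a connecting orbit and their jump. -/

section JumpFamily

variable {n k : ℕ}

theorem IsStableFamily.fderiv_eval {r : WithTop ℕ∞} {F : Euc k → Euc n → Euc n} {p : ℝ → Euc n}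
    {U : Euc k × stableSubspace (F 0) p → C(HalfLine, Euc n)} (hU : IsStableFamily r F p U)
    (hr : r ≠ 0) (z : Euc k × stableSubspace (F 0) p) :
    fderiv ℝ (fun z => U z (atTime 0)) 0 z = fderiv ℝ U 0 z (atTime 0) := by
  have := ((ContinuousMap.evalCLM ℝ (atTime 0)).hasFDerivAt (x := U 0)).comp 0 (hU.hasFDerivAt hr)
  exact congrArg (fun A => A z) this.fderiv

theorem IsStableFamily.contDiffAt_eval {r : WithTop ℕ∞} {F : Euc k → Euc n → Euc n}
    {p : ℝ → Euc n} {U : Euc k × stableSubspace (F 0) p → C(HalfLine, Euc n)}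
    (hU : IsStableFamily r F p U) :
    ∀ᶠ z in 𝓝 0, ContDiffAt ℝ r (fun z => U z (atTime 0)) z :=
  hU.contDiffAt.mono fun z hz =>
    (ContinuousMap.evalCLM (M := Euc n) ℝ (atTime 0)).contDiff.contDiffAt.comp z hz

theorem span_eq_of_finrank_eq_one {E : Type*} [AddCommGroup E] [Module ℝ E] {S : Submodule ℝ E}
    (h : Module.finrank ℝ S = 1) {v : E} (hv : v ∈ S) (hv0 : v ≠ 0) : S = ℝ ∙ v := by
  have : (⟨v, hv⟩ : S) ≠ 0 := fun h => hv0 (congrArg Subtype.val h)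
  refine le_antisymm (fun x hx => ?_) ((Submodule.span_singleton_le_iff_mem _ _).2 hv)
  obtain ⟨c, hc⟩ := (finrank_eq_one_iff_of_nonzero' _ this).1 h ⟨x, hx⟩
  exact Submodule.mem_span_singleton.2 ⟨c, congrArg Subtype.val hc⟩

variable {r : ℕ∞} {F : Euc k → Euc n → Euc n} {pm pp : Euc n} {p : ℝ → Euc n} {t₀ : ℝ}

theorem contDiff_apply_of_uncurry {r : WithTop ℕ∞}
    (hF : ContDiff ℝ r fun y : Euc k × Euc n => F y.1 y.2) (l : Euc k) : ContDiff ℝ r (F l) :=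
  hF.comp (contDiff_const.prodMk contDiff_id)

/-- Stable and unstable families along a connecting orbit, parametrized at time `t₀` by the
tangent spaces of the stable and unstable manifolds. -/
theorem IsConnectingOrbit.exists_families (hr : 1 ≤ r)
    (hF : ContDiff ℝ r fun y : Euc k × Euc n => F y.1 y.2)
    (hp : IsConnectingOrbit (F 0) pm pp p) (t₀ : ℝ) {Pm Pp : Euc k → Euc n}
    (hPm : IsContinuation F pm Pm) (hPp : IsContinuation F pp Pp) :
    ∃ (U : Euc k × stableSubspace (F 0) (fun s => p (t₀ + s)) → C(HalfLine, Euc n))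
      (V : Euc k × stableSubspace (fun x => -F 0 x) (fun s => p (t₀ - s)) → C(HalfLine, Euc n)),
      IsStableFamily r F (fun s => p (t₀ + s)) U ∧
      IsStableFamily r (fun l x => -F l x) (fun s => p (t₀ - s)) V ∧
      (∀ᶠ z in 𝓝 0, IsStableOrbit (F z.1) (Pp z.1) 0 fun t => U z (atTime t)) ∧
      (∀ᶠ z in 𝓝 0, IsStableOrbit (fun x => -F z.1 x) (Pm z.1) 0 fun t => V z (atTime t)) ∧
      stableTangent (F 0) pp (p t₀) = stableSubspace (F 0) (fun s => p (t₀ + s)) ∧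
      unstableTangent (F 0) pm (p t₀) =
        stableSubspace (fun x => -F 0 x) (fun s => p (t₀ - s)) := by
  have hr1 : (1 : WithTop ℕ∞) ≤ (r : WithTop ℕ∞) := by exact_mod_cast hr
  have hr0 : (r : WithTop ℕ∞) ≠ 0 := fun h => by simp [h] at hr1
  have hFl := fun l => contDiff_apply_of_uncurry hF l
  obtain ⟨Qp, hQp, hQp'⟩ := exists_continuation hr hF hp.hyp_plus
  obtain ⟨Qm, hQm, hQm'⟩ := exists_continuation hr hF hp.hyp_minus
  have hQm'' : ∀ᶠ y in 𝓝 ((0 : Euc k), pm), -F y.1 y.2 = 0 ↔ y.2 = Qm y.1 := by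
    simpa only [neg_eq_zero] using hQm'
  have hpf := isStableOrbit_iff_shift.1 (hp.isStableOrbit t₀)
  have hpb := isUnstableOrbit_iff_reverse.1 (hp.isUnstableOrbit t₀)
  obtain ⟨U, hU⟩ := exists_stableFamily hr hF hp.hyp_plus.isHyperbolicMap hpf
  obtain ⟨V, hV⟩ := exists_stableFamily (F := fun l x => -F l x) hr hF.neg
    hp.hyp_minus.neg.isHyperbolicMap hpb
  refine ⟨U, V, hU, hV, ?_, ?_, ?_, ?_⟩
  · have h1 := (hPp.eventuallyEq hQp').comp_tendsto
      (continuous_fst.tendsto' (0 : Euc k × stableSubspace (F 0) fun s => p (t₀ + s)) 0 rfl)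
    filter_upwards [hU.eventually_isStableOrbit (fun l => (hFl l).continuous) hpf hQp', h1]
      with z hz hz1
    have hz1' : Pp z.1 = Qp z.1 := hz1
    rwa [hz1']
  · have h1 := (hPm.eventuallyEq hQm').comp_tendsto
      (continuous_fst.tendsto'
        (0 : Euc k × stableSubspace (fun x => -F 0 x) fun s => p (t₀ - s)) 0 rfl)
    filter_upwards [hV.eventually_isStableOrbit (fun l => (hFl l).continuous.neg) hpb hQm'', h1]
      with z hz hz1
    have hz1' : Pm z.1 = Qm z.1 := hz1
    rwa [hz1']
  · have := hU.stableTangent_eq hr0 (fun l => (hFl l).continuous) ((hFl 0).of_le hr1) hpf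
      hQp.zero hQp'
    simpa only [add_zero] using this
  · have := hV.stableTangent_eq hr0 (fun l => (hFl l).continuous.neg) ((hFl 0).neg.of_le hr1) hpb
      hQm.zero hQm''
    rw [unstableTangent_eq]
    simpa only [sub_zero] using this

/-- The pairs of solutions on the half-lines defining the bifurcation function exist, are unique,
depend smoothly on the parameter, and their jump has the Melnikov integrals as derivative. -/
theorem IsConnectingOrbit.exists_jump (hr : 1 ≤ r)
    (hF : ContDiff ℝ r fun y : Euc k × Euc n => F y.1 y.2) {g : Euc k → Euc n → Euc n}
    (hFg : ∀ l, family (F 0) g l = F l)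
    (hp : IsConnectingOrbit (F 0) pm pp p) (hnd : IsNondegenerateAt (F 0) pm pp (p t₀))
    {Pm Pp : Euc k → Euc n} (hPm : IsContinuation F pm Pm) (hPp : IsContinuation F pp Pp) :
    ∃ u v : Euc k → ℝ → Euc n,
      (∀ ε > 0, ∀ᶠ l in 𝓝 0, IsJumpPair (F 0) g p t₀ Pm Pp l ε (u l) (v l)) ∧
      (∃ ε > 0, ∀ᶠ l in 𝓝 0, ∀ u' v', IsJumpPair (F 0) g p t₀ Pm Pp l ε u' v' →
        v' t₀ - u' t₀ = v l t₀ - u l t₀) ∧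
      (∀ᶠ l in 𝓝 0, ContDiffAt ℝ r (fun l => v l t₀ - u l t₀) l) ∧
      ∀ w ∈ boundedAdjointSolutions (F 0) p, ∀ μ,
        Integrable (fun s => inner ℝ (w s) (fderiv ℝ (fun m => F m (p s)) 0 μ)) ∧
        inner ℝ (w t₀) (fderiv ℝ (fun l => v l t₀ - u l t₀) 0 μ) =
          ∫ s, inner ℝ (w s) (fderiv ℝ (fun m => F m (p s)) 0 μ) := by
  have hr1 : (1 : WithTop ℕ∞) ≤ (r : WithTop ℕ∞) := by exact_mod_cast hr
  have hr0 : (r : WithTop ℕ∞) ≠ 0 := fun h => by simp [h] at hr1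
  have hF0 : ContDiff ℝ 1 (F 0) := (contDiff_apply_of_uncurry hF 0).of_le hr1
  obtain ⟨U, V, hU, hV, hUo, hVo, hEs, hEu⟩ := hp.exists_families hr hF t₀ hPm hPp
  let Es := stableSubspace (F 0) (fun s => p (t₀ + s))
  let Eu := stableSubspace (fun x => -F 0 x) (fun s => p (t₀ - s))
  have hfs : F 0 (p t₀) ∈ Es := by
    have := (isStableOrbit_iff_shift.1 (hp.isStableOrbit t₀)).apply_mem_stableSubspace hF0
      hp.hyp_plus.1
    simpa only [add_zero] using this
  have hfu : F 0 (p t₀) ∈ Eu := by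
    have := (isUnstableOrbit_iff_reverse.1 (hp.isUnstableOrbit t₀)).apply_mem_stableSubspace hF0.neg
      hp.hyp_minus.neg.1
    simpa only [sub_zero, neg_neg] using neg_mem this
  have hne := hp.apply_ne_zero hF0 t₀
  have hspan : Es ⊓ Eu = ℝ ∙ F 0 (p t₀) := by
    rw [IsNondegenerateAt, hEs, hEu] at hnd
    exact span_eq_of_finrank_eq_one hnd ⟨hfs, hfu⟩ hne
  have hU0 : U 0 (atTime 0) = p t₀ := by rw [hU.zero 0 le_rfl, add_zero]
  have hV0 : V 0 (atTime 0) = p t₀ := by rw [hV.zero 0 le_rfl, sub_zero]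
  have hU' : ∀ a : Es, fderiv ℝ (fun z => U z (atTime 0)) 0 (0, a) = a := fun a => by
    rw [hU.fderiv_eval hr0, hU.fderiv_apply_zero]
  have hV' : ∀ b : Eu, fderiv ℝ (fun z => V z (atTime 0)) 0 (0, b) = b := fun b => by
    rw [hV.fderiv_eval hr0]
    exact hV.fderiv_apply_zero b
  obtain ⟨η, ζ, hη0, hζ0, hη, hζ, hJ⟩ := exists_section_jump hr0 hne hspan hU.contDiffAt_eval
    hV.contDiffAt_eval hU0 hV0 hU' hV'
  have hηt : Tendsto (fun l => (l, η l)) (𝓝 0) (𝓝 0) := by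
    have := (continuousAt_id (x := (0 : Euc k))).prodMk hη.self_of_nhds.continuousAt
    rwa [ContinuousAt, hη0] at this
  have hζt : Tendsto (fun l => (l, ζ l)) (𝓝 0) (𝓝 0) := by
    have := (continuousAt_id (x := (0 : Euc k))).prodMk hζ.self_of_nhds.continuousAt
    rwa [ContinuousAt, hζ0] at this
  have hηζt : Tendsto (fun l => (l, η l, ζ l)) (𝓝 0) (𝓝 0) := by
    have := (continuousAt_id (x := (0 : Euc k))).prodMk
      (hη.self_of_nhds.continuousAt.prodMk hζ.self_of_nhds.continuousAt)
    rwa [ContinuousAt, hη0, hζ0] at this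
  refine ⟨fun l t => U (l, η l) (atTime (t - t₀)), fun l t => V (l, ζ l) (atTime (t₀ - t)),
    fun ε hε => ?_, ?_, ?_, fun w hw μ => ?_⟩
  · filter_upwards [hηt.eventually hUo, hζt.eventually hVo, hηζt.eventually hJ,
      hηt.eventually (hU.eventually_norm_sub_le hε), hζt.eventually (hV.eventually_norm_sub_le hε)]
      with l h1 h2 h3 h4 h5
    obtain ⟨h6, h7⟩ := h3.2 ⟨rfl, rfl⟩
    -- The implicit equations contain only the section condition for the stable orbit. The one for
    -- the unstable orbit follows, since the jump is orthogonal to `F 0 (p t₀)`, a vector of `Es`.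
    have h8 : inner ℝ (F 0 (p t₀)) (V (l, ζ l) (atTime 0) - U (l, η l) (atTime 0)) = 0 :=
      Submodule.inner_right_of_mem_orthogonal (Submodule.mem_sup_left hfs) h7
    refine ⟨?_, ?_, ?_, ?_, ?_, fun t ht => ?_, fun t ht => ?_⟩
    · rw [hFg, isStableOrbit_iff_shift]
      simpa only [add_sub_cancel_left] using h1
    · rw [hFg, isUnstableOrbit_iff_reverse]
      simpa only [sub_sub_cancel] using h2
    · simpa only [sub_self] using h6
    · simp only [sub_self]
      rw [← sub_add_sub_cancel _ (U (l, η l) (atTime 0)), inner_add_right, h8, h6, add_zero]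
    · rw [hp.mem_adjointDecayingValues_iff hF0]
      simpa only [sub_self] using h7
    · simpa only [add_sub_cancel] using h4 (t - t₀) (sub_nonneg.2 ht)
    · simpa only [sub_sub_cancel] using h5 (t₀ - t) (sub_nonneg.2 ht)
  · obtain ⟨ε₁, hε₁, h1⟩ := hU.unique
    obtain ⟨ε₂, hε₂, h2⟩ := hV.unique
    obtain ⟨δ, hδ, h3⟩ := Metric.eventually_nhds_iff_ball.1 hJ
    refine ⟨min (min ε₁ ε₂) (δ / 2), by positivity, ?_⟩
    filter_upwards [h1, h2, Metric.ball_mem_nhds (0 : Euc k) hδ] with l h1 h2 hl u' v' h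
    have hu := h.stable
    have hv := h.unstable
    rw [hFg, isStableOrbit_iff_shift] at hu
    rw [hFg, isUnstableOrbit_iff_reverse] at hv
    have e1 := h1 _ _ hu.1 hu.2 (fun t ht => (h.close_plus (t₀ + t) (by linarith)).trans
      ((min_le_left _ _).trans (min_le_left _ _))) 0 le_rfl
    have e2 := h2 _ _ hv.1 hv.2 (fun t ht => (h.close_minus (t₀ - t) (by linarith)).trans
      ((min_le_left _ _).trans (min_le_right _ _))) 0 le_rfl
    simp only [add_zero] at e1
    simp only [sub_zero] at e2
    set a : Es := Es.orthogonalProjectionOnto (u' t₀ - p t₀) with ha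
    set b : Eu := Eu.orthogonalProjectionOnto (v' t₀ - p t₀) with hb
    have hδ2 : δ / 2 < δ := half_lt_self hδ
    have han : ‖a‖ < δ := ((Es.norm_orthogonalProjectionOnto_apply_le _).trans
      ((h.close_plus t₀ le_rfl).trans (min_le_right _ _))).trans_lt hδ2
    have hbn : ‖b‖ < δ := ((Eu.norm_orthogonalProjectionOnto_apply_le _).trans
      ((h.close_minus t₀ le_rfl).trans (min_le_right _ _))).trans_lt hδ2
    have hmem : (l, a, b) ∈ Metric.ball (0 : Euc k × Es × Eu) δ := by
      rw [mem_ball_zero_iff] at hl ⊢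
      exact max_lt hl (max_lt han hbn)
    have hj := h.jump
    rw [hp.mem_adjointDecayingValues_iff hF0] at hj
    have e1' : u' t₀ = U (l, a) (atTime 0) := e1
    have e2' : v' t₀ = V (l, b) (atTime 0) := e2
    obtain ⟨e3, e4⟩ := (h3 _ hmem).1 ⟨by rw [← e1']; exact h.section_plus, by
      rw [← e1', ← e2']; exact hj⟩
    have e3' : a = η l := e3
    have e4' : b = ζ l := e4
    rw [sub_self, ← e3', ← e4', ← e1', ← e2']
  · filter_upwards [hηt.eventually hU.contDiffAt_eval, hζt.eventually hV.contDiffAt_eval, hη, hζ]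
      with l h1 h2 h3 h4
    simp only [sub_self]
    exact (h2.comp l (contDiffAt_id.prodMk h4)).sub (h1.comp l (contDiffAt_id.prodMk h3))
  · have hwo := apply_mem_of_mem_boundedAdjointSolutions (t₀ := t₀) hw
    have hint := hp.adjoint_integrable hF0 hw.1 hwo
    obtain ⟨i1, i2⟩ := hU.inner_fderiv μ (fun s => w (t₀ + s))
      (fun t _ => hasDerivWithinAt_adjoint_shift hw.1 t₀ t) hint.1.1 hint.1.2
    obtain ⟨j1, j2⟩ := hV.inner_fderiv μ (fun s => w (t₀ - s))
      (fun t _ => hasDerivWithinAt_adjoint_reverse hw.1 t₀ t) hint.2.1 hint.2.2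
    simp only [fderiv_fun_neg, neg_apply, inner_neg_right, integral_neg, neg_neg,
      sub_zero] at j1 j2
    simp only [add_zero] at i2
    obtain ⟨k1, k2⟩ := integrable_and_integral_of_halfLines
      (h := fun s => inner ℝ (w s) (fderiv ℝ (fun m => F m (p s)) 0 μ)) i1
      (by simpa only [Pi.neg_def, neg_neg] using j1.neg)
    refine ⟨k1, ?_⟩
    simp only [sub_self]
    rw [inner_fderiv_jump hr0 hU.contDiffAt_eval.self_of_nhds hV.contDiffAt_eval.self_of_nhds
      hU' hV' hη.self_of_nhds hζ.self_of_nhds hη0 hζ0 hwo, hU.fderiv_eval hr0, hV.fderiv_eval hr0,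
      k2, i2]
    have j2' : inner ℝ (w t₀) (fderiv ℝ V 0 (μ, 0) (atTime 0)) = _ := j2
    rw [j2']
    ring

end JumpFamily

section Straightening

variable {X E : Type*} [NormedAddCommGroup X] [InnerProductSpace ℝ X] [FiniteDimensional ℝ X]
  [NormedAddCommGroup E] [InnerProductSpace ℝ E] [FiniteDimensional ℝ E]

theorem mem_ker_of_adjoint_apply {L : X →L[ℝ] E} {z : E}
    (h : L.adjoint z ∈ LinearMap.ker L.toLinearMap) : L.adjoint z = 0 := by
  have h1 : L (L.adjoint z) = 0 := h
  rw [← inner_self_eq_zero (𝕜 := ℝ), ContinuousLinearMap.adjoint_inner_left, h1, inner_zero_right]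

/-- A map vanishing at the origin whose values lie in the range of its derivative there is
straightened near the origin. -/
theorem exists_straightening {r : WithTop ℕ∞} (hr : r ≠ 0) {ξ : X → E}
    (hξ : ∀ᶠ l in 𝓝 0, ContDiffAt ℝ r ξ l) (h0 : ξ 0 = 0)
    (hrange : ∀ᶠ l in 𝓝 0, ξ l ∈ LinearMap.range (fderiv ℝ ξ 0).toLinearMap) {N : Set X}
    (hN : N ∈ 𝓝 0) :
    ∃ φ : OpenPartialHomeomorph X X, 0 ∈ φ.source ∧ φ.source ⊆ N ∧ φ 0 = 0 ∧
      ContDiffOn ℝ r φ φ.source ∧ ContDiffOn ℝ r φ.symm φ.target ∧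
      (∀ y ∈ φ.source, ξ y = 0 ↔ φ y ∈ LinearMap.ker (fderiv ℝ ξ 0).toLinearMap) ∧
      ∀ v ∈ LinearMap.ker (fderiv ℝ ξ 0).toLinearMap,
        HasDerivAt (fun s : ℝ => φ.symm (s • v)) v 0 := by
  set L := fderiv ℝ ξ 0 with hL
  set K := LinearMap.ker L.toLinearMap with hK
  set π : X →L[ℝ] X := K.starProjection with hπ
  set φ₀ : X → X := fun y => L.adjoint (ξ y) + π y with hφ₀
  have hφ : ∀ᶠ y in 𝓝 0, ContDiffAt ℝ r φ₀ y := by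
    filter_upwards [hξ] with y hy
    exact (L.adjoint.contDiff.contDiffAt.comp y hy).add π.contDiff.contDiffAt
  have hφ' : HasFDerivAt φ₀ (L.adjoint.comp L + π) 0 :=
    (L.adjoint.hasFDerivAt.comp 0 (hξ.self_of_nhds.differentiableAt hr).hasFDerivAt).add
      π.hasFDerivAt
  have hinj : ∀ x, (L.adjoint.comp L + π) x = 0 → x = 0 := by
    intro x hx
    have h1 : inner ℝ (L.adjoint (L x)) x + inner ℝ (π x) x = 0 := by
      rw [← inner_add_left]
      change inner ℝ ((L.adjoint.comp L + π) x) x = 0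
      rw [hx, inner_zero_left]
    have h2 : inner ℝ (π x) x = inner ℝ (π x) (π x) := by
      have := K.starProjection_inner_eq_zero x (π x) (K.starProjection_apply_mem x)
      rw [real_inner_comm, inner_sub_right, sub_eq_zero] at this
      exact this
    rw [ContinuousLinearMap.adjoint_inner_left, h2] at h1
    have h3 : (0 : ℝ) ≤ inner ℝ (L x) (L x) := real_inner_self_nonneg
    have h4 : (0 : ℝ) ≤ inner ℝ (π x) (π x) := real_inner_self_nonneg
    have h5 : L x = 0 := inner_self_eq_zero.1 (le_antisymm (by linarith) h3)
    have h5 : x ∈ K := h5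
    have h6 : π x = 0 := inner_self_eq_zero.1 (le_antisymm (by linarith) h4)
    rwa [← Submodule.starProjection_eq_self_iff.2 h5]
  obtain ⟨e, he⟩ : ∃ e : X ≃L[ℝ] X, (e : X →L[ℝ] X) = L.adjoint.comp L + π :=
    ⟨(LinearEquiv.ofInjectiveEndo (L.adjoint.comp L + π).toLinearMap
      ((injective_iff_map_eq_zero _).2 hinj)).toContinuousLinearEquiv, by ext; rfl⟩
  rw [← he] at hφ'
  have hev : ∀ᶠ y in 𝓝 0, fderiv ℝ φ₀ y ∈ Set.range ((↑) : (X ≃L[ℝ] X) → X →L[ℝ] X) :=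
    (hφ.self_of_nhds.continuousAt_fderiv hr).eventually (by rw [hφ'.fderiv]; exact e.nhds)
  obtain ⟨S, hSsub, hSo, hS0⟩ := mem_nhds_iff.1 (hφ.and (hev.and (hrange.and hN)))
  set ψ := hφ.self_of_nhds.toOpenPartialHomeomorph φ₀ hφ' hr
  have hψ : (ψ : X → X) = φ₀ := hφ.self_of_nhds.toOpenPartialHomeomorph_coe hφ' hr
  have hψ0 : 0 ∈ ψ.source := hφ.self_of_nhds.mem_toOpenPartialHomeomorph_source hφ' hr
  have hφ₀0 : φ₀ 0 = 0 := by simp [hφ₀, h0]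
  have hS : ∀ y ∈ (ψ.restrOpen S hSo).source, y ∈ S := fun y hy => hy.2
  have h0s : (0 : X) ∈ (ψ.restrOpen S hSo).source := ⟨hψ0, hS0⟩
  refine ⟨ψ.restrOpen S hSo, h0s, fun y hy => (hSsub (hS y hy)).2.2.2, ?_, ?_, ?_, ?_, ?_⟩
  · rw [OpenPartialHomeomorph.coe_restrOpen, hψ, hφ₀0]
  · intro y hy
    rw [OpenPartialHomeomorph.coe_restrOpen, hψ]
    exact (hSsub (hS y hy)).1.contDiffWithinAt
  · intro z hz
    have hy := (ψ.restrOpen S hSo).map_target hz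
    obtain ⟨h1, ⟨e', he'⟩, -⟩ := hSsub (hS _ hy)
    refine ((ψ.restrOpen S hSo).contDiffAt_symm (f₀' := e') hz ?_ ?_).contDiffWithinAt
    · rw [OpenPartialHomeomorph.coe_restrOpen, hψ, he']
      exact (h1.differentiableAt hr).hasFDerivAt
    · rwa [OpenPartialHomeomorph.coe_restrOpen, hψ]
  · intro y hy
    obtain ⟨-, -, ⟨x, hx⟩, -⟩ := hSsub (hS y hy)
    have hx' : L x = ξ y := hx
    have hπK : π y ∈ K := K.starProjection_apply_mem y
    rw [OpenPartialHomeomorph.coe_restrOpen, hψ, hφ₀]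
    constructor
    · intro h
      simpa only [h, map_zero, zero_add] using hπK
    · intro h
      have h1 : L.adjoint (ξ y) = 0 :=
        mem_ker_of_adjoint_apply ((K.add_mem_iff_left hπK).1 h)
      rw [← inner_self_eq_zero (𝕜 := ℝ)]
      nth_rewrite 2 [← hx']
      rw [← ContinuousLinearMap.adjoint_inner_left, h1, inner_zero_left]
  · intro v hv
    have hev' : e v = v := by
      have h1 : e v = L.adjoint (L v) + π v := congrArg (fun A => A v) he
      have h2 : L v = 0 := hv
      rw [h1, h2, map_zero, zero_add]
      exact Submodule.starProjection_eq_self_iff.2 hv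
    have h1 : HasFDerivAt ψ.symm (e.symm : X →L[ℝ] X) 0 := by
      refine ψ.hasFDerivAt_symm ?_ ?_
      · have := ψ.map_source hψ0
        rwa [hψ, hφ₀0] at this
      · have := ψ.left_inv hψ0
        rw [hψ, hφ₀0] at this
        rwa [this, hψ]
    have h2 : HasDerivAt (fun s : ℝ => s • v) v 0 := by
      simpa using (hasDerivAt_id (0 : ℝ)).smul_const v
    have h3 : HasFDerivAt ψ.symm (e.symm : X →L[ℝ] X) ((0 : ℝ) • v) := by rwa [zero_smul]
    have h4 := h3.comp_hasDerivAt (0 : ℝ) h2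
    have h5 : e.symm v = v := by rw [ContinuousLinearEquiv.symm_apply_eq, hev']
    rw [ContinuousLinearEquiv.coe_coe, h5] at h4
    exact h4

end Straightening

section ZeroSet

variable {k : ℕ} {E : Type*} [NormedAddCommGroup E] [InnerProductSpace ℝ E]
  [FiniteDimensional ℝ E]

/-- The zero set of a map whose values lie in the range of its derivative at the origin is a
regular submanifold near the origin, tangent to the kernel of the derivative. -/
theorem exists_regularSubmanifold {r : WithTop ℕ∞} (hr : r ≠ 0) {ξ : Euc k → E}
    (hξ : ∀ᶠ l in 𝓝 0, ContDiffAt ℝ r ξ l) (h0 : ξ 0 = 0)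
    (hrange : ∀ᶠ l in 𝓝 0, ξ l ∈ LinearMap.range (fderiv ℝ ξ 0).toLinearMap) {N : Set (Euc k)}
    (hN : N ∈ 𝓝 0) :
    ∃ U : Set (Euc k), IsOpen U ∧ 0 ∈ U ∧ U ⊆ N ∧
      IsRegularSubmanifold r
        (k - Module.finrank ℝ (LinearMap.range (fderiv ℝ ξ 0).toLinearMap)) {l ∈ U | ξ l = 0} ∧
      tangentVectors {l ∈ U | ξ l = 0} 0 = LinearMap.ker (fderiv ℝ ξ 0).toLinearMap := by
  obtain ⟨φ, hφ0, hφN, hφ00, hφ1, hφ2, hφ3, hφ4⟩ := exists_straightening hr hξ h0 hrange hN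
  refine ⟨φ.source, φ.open_source, hφ0, hφN, fun x hx => ?_, Set.Subset.antisymm ?_ ?_⟩
  · refine ⟨φ, LinearMap.ker (fderiv ℝ ξ 0).toLinearMap, hx.1, hφ1, hφ2, ?_, fun y hy => ?_⟩
    · have := LinearMap.finrank_range_add_finrank_ker (fderiv ℝ ξ 0).toLinearMap
      rw [finrank_euclideanSpace_fin] at this
      omega
    · rw [← hφ3 y hy]
      exact ⟨fun h => h.2, fun h => ⟨hy, h⟩⟩
  · rintro v ⟨c, hc0, hc, hcv⟩
    have h1 : HasFDerivAt ξ (fderiv ℝ ξ 0) (c 0) := by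
      rw [hc0]; exact (hξ.self_of_nhds.differentiableAt hr).hasFDerivAt
    have h2 := h1.comp_hasDerivAt (0 : ℝ) hcv
    have h3 : HasDerivAt (ξ ∘ c) 0 0 :=
      (hasDerivAt_const (0 : ℝ) (0 : E)).congr_of_eventuallyEq (hc.mono fun s hs => hs.2)
    exact h2.unique h3
  · intro v hv
    have ht0 : (0 : Euc k) ∈ φ.target := hφ00 ▸ φ.map_source hφ0
    refine ⟨fun s => φ.symm (s • v), ?_, ?_, hφ4 v hv⟩
    · have := φ.left_inv hφ0
      simpa only [zero_smul, hφ00] using this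
    · have h1 : Tendsto (fun s : ℝ => s • v) (𝓝 0) (𝓝 0) := by
        have : Continuous fun s : ℝ => s • v := by fun_prop
        exact this.tendsto' 0 0 (zero_smul ℝ v)
      filter_upwards [h1.eventually (φ.open_target.mem_nhds ht0)] with s hs
      have h2 := φ.map_target hs
      refine ⟨h2, (hφ3 _ h2).2 ?_⟩
      rw [φ.right_inv hs]
      exact Submodule.smul_mem _ s hv

end ZeroSet

section Gluing

variable {n : ℕ} {F : Euc n → Euc n} {t₀ : ℝ} {u v : ℝ → Euc n}

theorem SolvesOn.glue (hu : SolvesOn F (Set.Ici t₀) u) (hv : SolvesOn F (Set.Iic t₀) v)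
    (h : v t₀ = u t₀) : SolvesOn F Set.univ fun t => if t₀ ≤ t then u t else v t := by
  set x : ℝ → Euc n := fun t => if t₀ ≤ t then u t else v t with hx
  have hxu : ∀ t ∈ Set.Ici t₀, x t = u t := fun t ht => if_pos ht
  have hxv : ∀ t ∈ Set.Iic t₀, x t = v t := fun t ht => by
    rcases (show t ≤ t₀ from ht).lt_or_eq with h1 | rfl
    · exact if_neg (not_le.2 h1)
    · rw [hxu t Set.self_mem_Ici, h]
  have h1 : ∀ t ∈ Set.Ici t₀, HasDerivWithinAt x (F (x t)) (Set.Ici t₀) t := fun t ht => by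
    rw [hxu t ht]
    exact (hu t ht).congr hxu (hxu t ht)
  have h2 : ∀ t ∈ Set.Iic t₀, HasDerivWithinAt x (F (x t)) (Set.Iic t₀) t := fun t ht => by
    rw [hxv t ht]
    exact (hv t ht).congr hxv (hxv t ht)
  intro t _
  rcases lt_trichotomy t t₀ with ht | rfl | ht
  · exact ((h2 t ht.le).hasDerivAt (Iic_mem_nhds ht)).hasDerivWithinAt
  · rw [← Set.Iic_union_Ici (a := t)]
    exact (h2 t Set.self_mem_Iic).union (h1 t Set.self_mem_Ici)
  · exact ((h1 t ht.le).hasDerivAt (Ici_mem_nhds ht)).hasDerivWithinAt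

end Gluing

section Bifurcation

variable {n k d : ℕ} {r : ℕ∞} {F : Euc k → Euc n → Euc n} {g : Euc k → Euc n → Euc n}
  {pm pp : Euc n} {p : ℝ → Euc n} {t₀ : ℝ} {Pm Pp : Euc k → Euc n} {ξ : Euc k → Euc n}

theorem IsContinuation.eventuallyEq_of_continuation (hr : 1 ≤ r)
    (hF : ContDiff ℝ r fun y : Euc k × Euc n => F y.1 y.2) {q : Euc n}
    (hq : IsHyperbolicEquilibrium (F 0) q) (hPm : IsContinuation F q Pm)
    (hPp : IsContinuation F q Pp) : Pm =ᶠ[𝓝 0] Pp := by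
  obtain ⟨Q, -, hQ⟩ := exists_continuation hr hF hq
  exact (hPm.eventuallyEq hQ).trans (hPp.eventuallyEq hQ).symm

theorem fderiv_parameter_eq (hFg : ∀ l, family (F 0) g l = F l) (x : Euc n) :
    fderiv ℝ (fun m => F m x) 0 = fderiv ℝ (fun m => g m x) 0 := by
  have : (fun m => F m x) = fun m => F 0 x + g m x := funext fun m => by rw [← hFg m]; rfl
  rw [this, fderiv_const_add]

theorem IsJumpPair.eq_at_zero {f : Euc n → Euc n} {l : Euc k} {u v : ℝ → Euc n}
    (h : ∀ ε > 0, IsJumpPair f g p t₀ Pm Pp l ε u v) : u t₀ = v t₀ := by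
  have h1 : ‖u t₀ - p t₀‖ ≤ 0 :=
    le_of_forall_pos_le_add fun ε hε => by simpa using (h ε hε).close_plus t₀ le_rfl
  have h2 : ‖v t₀ - p t₀‖ ≤ 0 :=
    le_of_forall_pos_le_add fun ε hε => by simpa using (h ε hε).close_minus t₀ le_rfl
  rw [sub_eq_zero.1 (norm_le_zero_iff.1 h1), sub_eq_zero.1 (norm_le_zero_iff.1 h2)]

/-- A jump pair with vanishing jump is glued to a connecting orbit. -/
theorem IsJumpPair.isConnectingOrbit {f : Euc n → Euc n} {l : Euc k} {u v : ℝ → Euc n} {ε : ℝ}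
    (h : IsJumpPair f g p t₀ Pm Pp l ε u v) (huv : v t₀ = u t₀)
    (hm : IsHyperbolicEquilibrium (family f g l) (Pm l))
    (hp : IsHyperbolicEquilibrium (family f g l) (Pp l)) {a b : ℝ} (hab : 2 * ε < ‖p a - p b‖) :
    IsConnectingOrbit (family f g l) (Pm l) (Pp l) (fun t => if t₀ ≤ t then u t else v t) := by
  have hcl : ∀ t, ‖(if t₀ ≤ t then u t else v t) - p t‖ ≤ ε := fun t => by
    split_ifs with ht
    · exact h.close_plus t ht
    · exact h.close_minus t (not_le.1 ht).le
  refine ⟨hm, hp, h.stable.1.glue h.unstable.1 huv, ?_, ?_, a, b, fun hxy => ?_⟩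
  · refine h.unstable.2.congr' ?_
    filter_upwards [eventually_lt_atBot t₀] with t ht
    rw [if_neg (not_le.2 ht)]
  · refine h.stable.2.congr' ?_
    filter_upwards [eventually_ge_atTop t₀] with t ht
    rw [if_pos ht]
  · have h1 := hcl a
    have h2 := hcl b
    rw [show (if t₀ ≤ a then u a else v a) = if t₀ ≤ b then u b else v b from hxy] at h1
    have h3 := norm_sub_le_norm_sub_add_norm_sub (p a) (if t₀ ≤ b then u b else v b) (p b)
    rw [norm_sub_rev] at h1
    linarith

theorem inner_fderiv_eq_sum {X : Type*} [NormedAddCommGroup X] [InnerProductSpace ℝ X]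
    (L : Euc k →L[ℝ] X) (w : X) (v : Euc k) :
    inner ℝ w (L v) = ∑ j, inner ℝ w (L (EuclideanSpace.single j 1)) * v j := by
  have h : v = ∑ j, v j • EuclideanSpace.single j (1 : ℝ) := by
    ext i
    simp [Finset.sum_apply, Pi.single_apply]
  conv_lhs => rw [h]
  simp only [map_sum, map_smul, inner_sum, inner_smul_right, mul_comm]

theorem mem_ker_iff_of_basis {f : Euc n → Euc n} (hf : ContDiff ℝ 1 f)
    (hp : IsConnectingOrbit f pm pp p) (w : Module.Basis (Fin d) ℝ (boundedAdjointSolutions f p))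
    {v : Euc n} (hv : v ∈ (decayingSum f p t₀)ᗮ) :
    v = 0 ↔ ∀ i, inner ℝ ((w i : ℝ → Euc n) t₀) v = 0 := by
  refine ⟨fun h i => by rw [h, inner_zero_right], fun h => ?_⟩
  set W := w.map (hp.evalEquiv hf t₀) with hW
  have h1 : ∀ x : ((decayingSum f p t₀)ᗮ : Submodule ℝ (Euc n)), inner ℝ (x : Euc n) v = 0 := by
    intro x
    rw [← W.sum_repr x]
    simp only [Submodule.coe_sum, Submodule.coe_smul, sum_inner, inner_smul_left]
    refine Finset.sum_eq_zero fun i _ => ?_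
    have : ((W i : (decayingSum f p t₀)ᗮ) : Euc n) = (w i : ℝ → Euc n) t₀ := by
      rw [hW, Module.Basis.map_apply, hp.evalEquiv_apply]
    rw [this, h i, mul_zero]
  exact inner_self_eq_zero.1 (h1 ⟨v, hv⟩)

theorem finrank_decayingSum_orthogonal {f : Euc n → Euc n} (hf : ContDiff ℝ 1 f)
    (hp : IsConnectingOrbit f pm pp p) (w : Module.Basis (Fin d) ℝ (boundedAdjointSolutions f p)) :
    Module.finrank ℝ ((decayingSum f p t₀)ᗮ : Submodule ℝ (Euc n)) = d := by
  rw [Module.finrank_eq_card_basis (w.map (hp.evalEquiv hf t₀)), Fintype.card_fin]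

theorem fderiv_apply_mem_of_eventually_mem {X E : Type*} [NormedAddCommGroup X] [NormedSpace ℝ X]
    [NormedAddCommGroup E] [InnerProductSpace ℝ E] [FiniteDimensional ℝ E] {ξ : X → E}
    (hξ : DifferentiableAt ℝ ξ 0) {K : Submodule ℝ E} (h : ∀ᶠ l in 𝓝 0, ξ l ∈ Kᗮ) (v : X) :
    fderiv ℝ ξ 0 v ∈ Kᗮ := by
  have h1 := (K.orthogonalProjectionOnto.hasFDerivAt (x := ξ 0)).comp 0 hξ.hasFDerivAt
  have h2 : HasFDerivAt (K.orthogonalProjectionOnto ∘ ξ) (0 : X →L[ℝ] K) 0 :=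
    (hasFDerivAt_const (0 : K) (0 : X)).congr_of_eventuallyEq
      (h.mono fun l hl => K.orthogonalProjectionOnto_eq_zero_iff.2 hl)
  exact K.orthogonalProjectionOnto_eq_zero_iff.1 (congrArg (fun A => A v) (h1.unique h2))

end Bifurcation

theorem mainTheorem4 {n k d : ℕ} (r : ℕ∞) (hr : 1 ≤ r)
    (f : Euc n → Euc n) (hf : ContDiff ℝ r f)
    (g : Euc k → Euc n → Euc n) (hg : ContDiff ℝ r (fun y : Euc k × Euc n => g y.1 y.2))
    (hg0 : ∀ x, g 0 x = 0)
    (pm pp : Euc n) (p : ℝ → Euc n) (hp : IsConnectingOrbit f pm pp p)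
    (t₀ : ℝ) (hnd : IsNondegenerateAt f pm pp (p t₀))
    (w : Module.Basis (Fin d) ℝ (boundedAdjointSolutions f p)) :
    -- the equilibria have continuations
    (∃ Pm, IsContinuation (family f g) pm Pm) ∧ (∃ Pp, IsContinuation (family f g) pp Pp) ∧
    ∀ Pm Pp : Euc k → Euc n,
      IsContinuation (family f g) pm Pm → IsContinuation (family f g) pp Pp →
      -- the bifurcation function exists and is unique as a germ at `0`
      (∃ ξ, IsBifurcationFunction f g p t₀ Pm Pp ξ) ∧
      (∀ ξ₁ ξ₂, IsBifurcationFunction f g p t₀ Pm Pp ξ₁ →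
        IsBifurcationFunction f g p t₀ Pm Pp ξ₂ → ξ₁ =ᶠ[𝓝 0] ξ₂) ∧
      ∀ ξ : Euc k → Euc n, IsBifurcationFunction f g p t₀ Pm Pp ξ →
        -- it is of class `C^r`, with partial derivatives at `0` given by the Melnikov integrals
        ContDiffAt ℝ r ξ 0 ∧
        (∀ (i : Fin d) (j : Fin k),
          Integrable (melnikovIntegrand g p (w i : ℝ → Euc n) j) ∧
          fderiv ℝ (fun lam => inner ℝ ((w i : ℝ → Euc n) t₀) (ξ lam)) 0
              (EuclideanSpace.single j (1 : ℝ)) =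
            ∫ s, melnikovIntegrand g p (w i : ℝ → Euc n) j s) ∧
        -- persistence of the connection
        (d < k → Module.finrank ℝ (LinearMap.range (fderiv ℝ ξ 0).toLinearMap) = d →
          ∃ (U M : Set (Euc k)) (x : Euc k → ℝ → Euc n),
            IsOpen U ∧ 0 ∈ U ∧ M = {lam ∈ U | ξ lam = 0} ∧ 0 ∈ M ∧
            IsRegularSubmanifold r (k - d) M ∧
            tangentVectors M 0 = {v | ∀ i : Fin d,
              ∑ j : Fin k, (∫ s, melnikovIntegrand g p (w i : ℝ → Euc n) j s) * v j = 0} ∧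
            (∀ lam ∈ M, IsConnectingOrbit (family f g lam) (Pm lam) (Pp lam) (x lam) ∧
              (pm = pp → Pm lam = Pp lam)) ∧
            (∀ ε : ℝ, 0 < ε → ∀ᶠ lam in 𝓝[M] 0, ∀ t, ‖x lam t - p t‖ ≤ ε)) := by
  have hr1 : (1 : WithTop ℕ∞) ≤ (r : WithTop ℕ∞) := by exact_mod_cast hr
  have hr0 : (r : WithTop ℕ∞) ≠ 0 := fun h => by simp [h] at hr1
  obtain ⟨F, hF⟩ : ∃ F, F = family f g := ⟨_, rfl⟩
  have hFs : ContDiff ℝ r fun y : Euc k × Euc n => F y.1 y.2 := by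
    rw [hF]
    exact (hf.comp contDiff_snd).add hg
  have hf0 : f = F 0 := funext fun x => by rw [hF, family, hg0, add_zero]
  subst hf0
  have hFg : ∀ l, family (F 0) g l = F l := fun l => by rw [← hF]
  have hf1 : ContDiff ℝ 1 (F 0) := hf.of_le hr1
  rw [← hF]
  obtain ⟨Qm, hQm, -⟩ := exists_continuation hr hFs hp.hyp_minus
  obtain ⟨Qp, hQp, -⟩ := exists_continuation hr hFs hp.hyp_plus
  refine ⟨⟨Qm, hQm⟩, ⟨Qp, hQp⟩, fun Pm Pp hPm hPp => ?_⟩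
  obtain ⟨u, v, hJ, ⟨ε₁, hε₁, huniq⟩, hsmooth, hmel⟩ := hp.exists_jump hr hFs hFg hnd hPm hPp
  have huniq' : ∀ ξ, IsBifurcationFunction (F 0) g p t₀ Pm Pp ξ →
      ξ =ᶠ[𝓝 0] fun l => v l t₀ - u l t₀ := fun ξ hξ => by
    filter_upwards [hξ ε₁ hε₁, huniq] with l h1 h2
    obtain ⟨u', v', h3, h4⟩ := h1
    rw [h4, h2 u' v' h3]
  refine ⟨⟨fun l => v l t₀ - u l t₀, fun ε hε => (hJ ε hε).mono fun l hl => ⟨u l, v l, hl, rfl⟩⟩,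
    fun ξ₁ ξ₂ h1 h2 => (huniq' ξ₁ h1).trans (huniq' ξ₂ h2).symm, fun ξ hξ => ?_⟩
  have hξe := huniq' ξ hξ
  have hξs : ∀ᶠ l in 𝓝 0, ContDiffAt ℝ r ξ l := by
    filter_upwards [hsmooth, hξe.eventually_nhds] with l h1 h2 using h1.congr_of_eventuallyEq h2
  have hξd := hξs.self_of_nhds.differentiableAt hr0
  have hmel' : ∀ (i : Fin d) (j : Fin k),
      Integrable (melnikovIntegrand g p (w i : ℝ → Euc n) j) ∧
      inner ℝ ((w i : ℝ → Euc n) t₀) (fderiv ℝ ξ 0 (EuclideanSpace.single j (1 : ℝ))) =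
        ∫ s, melnikovIntegrand g p (w i : ℝ → Euc n) j s := fun i j => by
    have := hmel (w i) (w i).2 (EuclideanSpace.single j (1 : ℝ))
    simp only [fderiv_parameter_eq hFg] at this
    rw [hξe.fderiv_eq]
    exact this
  refine ⟨hξs.self_of_nhds, fun i j => ⟨(hmel' i j).1, ?_⟩, fun hdk hrank => ?_⟩
  · rw [← (hmel' i j).2]
    have := ((innerSL ℝ ((w i : ℝ → Euc n) t₀)).hasFDerivAt (x := ξ 0)).comp 0 hξd.hasFDerivAt
    exact congrArg (fun A => A (EuclideanSpace.single j (1 : ℝ))) this.fderiv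
  have hξ0 : ξ 0 = 0 := by
    rw [hξe.self_of_nhds, sub_eq_zero]
    exact (IsJumpPair.eq_at_zero fun ε hε => (hJ ε hε).self_of_nhds).symm
  have hξW : ∀ᶠ l in 𝓝 0, ξ l ∈ (decayingSum (F 0) p t₀)ᗮ := by
    filter_upwards [hξe, hJ 1 one_pos] with l h1 h2
    rw [h1, ← hp.mem_adjointDecayingValues_iff hf1]
    exact h2.jump
  have hrange : LinearMap.range (fderiv ℝ ξ 0).toLinearMap = (decayingSum (F 0) p t₀)ᗮ := by
    refine Submodule.eq_of_le_of_finrank_eq ?_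
      (hrank.trans (finrank_decayingSum_orthogonal hf1 hp w).symm)
    rintro _ ⟨y, rfl⟩
    exact fderiv_apply_mem_of_eventually_mem hξd hξW y
  obtain ⟨a, b, hab⟩ := hp.nonconstant
  have hab' : 0 < ‖p a - p b‖ := norm_pos_iff.2 (sub_ne_zero.2 hab)
  have hN : ∀ᶠ l in 𝓝 0, IsJumpPair (F 0) g p t₀ Pm Pp l (‖p a - p b‖ / 3) (u l) (v l) ∧
      ξ l = v l t₀ - u l t₀ ∧ IsHyperbolicEquilibrium (F l) (Pm l) ∧
      IsHyperbolicEquilibrium (F l) (Pp l) ∧ (pm = pp → Pm l = Pp l) := by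
    have h1 : ∀ᶠ l in 𝓝 0, pm = pp → Pm l = Pp l := by
      by_cases h : pm = pp
      · subst h
        exact (hPm.eventuallyEq_of_continuation hr hFs hp.hyp_minus hPp).mono fun l hl _ => hl
      · exact Eventually.of_forall fun l h' => absurd h' h
    exact (hJ _ (by positivity)).and (hξe.and (hPm.hyperbolic.and (hPp.hyperbolic.and h1)))
  obtain ⟨U, hU, hU0, hUN, hreg, htan⟩ := exists_regularSubmanifold hr0 hξs hξ0
    (by rw [hrange]; exact hξW) hN
  rw [hrank] at hreg
  refine ⟨U, {l ∈ U | ξ l = 0}, fun l t => if t₀ ≤ t then u l t else v l t, hU, hU0, rfl,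
    ⟨hU0, hξ0⟩, hreg, ?_, fun l hl => ?_, fun ε hε => ?_⟩
  · rw [htan]
    ext y
    have h1 : y ∈ LinearMap.ker (fderiv ℝ ξ 0).toLinearMap ↔ fderiv ℝ ξ 0 y = 0 := Iff.rfl
    rw [SetLike.mem_coe, h1, mem_ker_iff_of_basis hf1 hp w
      (fderiv_apply_mem_of_eventually_mem hξd hξW y), Set.mem_ofPred_eq]
    refine forall_congr' fun i => ?_
    rw [inner_fderiv_eq_sum]
    simp only [(hmel' i _).2]
  · obtain ⟨h1, h2, h3, h4, h5⟩ := hUN hl.1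
    rw [← hFg l] at h3 h4
    have h6 := h1.isConnectingOrbit (by rw [← sub_eq_zero, ← h2, hl.2]) h3 h4 (a := a) (b := b)
      (by linarith)
    rw [hFg] at h6
    exact ⟨h6, h5⟩
  · filter_upwards [(hJ ε hε).filter_mono nhdsWithin_le_nhds] with l hl t
    split_ifs with ht
    · exact hl.close_plus t ht
    · exact hl.close_minus t (not_le.1 ht).le
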